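/- **Setting.** Let $B$ be a definite quaternion algebra over $\mathbb{Q}$ with discriminant $d_B$ (the product of the primes $p$ for which $B_p=\mathbb{Q}_p\otimes B$ is a division algebra), let $\xi\in B$ be a nonzero element of trace $0$ with reduced norm $n(\xi)=-\xi^2$, and let $E=\mathbb{Q}(\xi)\subset B$, an imaginary quadratic field with ring of integers $\mathcal{O}_E$ and discriminant $d_\xi$. Put $a=2\sqrt{-n(\xi)}\sqrt{d_\xi}$ if $d_\xi$ is odd, $a=\sqrt{-n(\xi)}\sqrt{d_\xi}$ if $d_\xi$ is even (where $\sqrt{-n(\xi)}\sqrt{d_\xi}=-\sqrt{n(\xi)|d_\xi|}\in\mathbb{Q}$), and $b=\xi^2-a^2/4$. Let $p$ be a prime with $p\nmid d_B$. Fix an isomorphism of $\mathbb{Q}_p$-algebras $B_p\simeq M_2(\mathbb{Q}_p)$ that maps $\xi$ to $\begin{pmatrix} a/2 & b\\ 1& -a/2\end{pmatrix}$, and use it to identify $B_p^\times$ with $GL_2(\mathbb{Q}_p)$. Thus $E_p^\times=(\mathbb{Q}_p\otimes E)^\times$ is a subgroup of $GL_2(\mathbb{Q}_p)$. Let $\mathcal{O}_{E_p}=\mathbb{Z}_p\otimes\mathcal{O}_E$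 and $\mathcal{O}_{E_p,i}=\mathbb{Z}_p+p^i\mathcal{O}_{E_p}$ for $i\ge 0$. * Let $\chi_p$ be a continuous unitary character of $E_p^\times$, trivial on $\mathbb{Q}_p^\times$, and let $i_p(\chi)=\min\{i\ge 0 : \chi_p|_{\mathcal{O}_{E_p,i}^\times}\equiv 1\}$; $\chi_p$ is unramified if $i_p(\chi)=0$. * Let $\pi$ be a unitary representation of $B_p^\times=GL_2(\mathbb{Q}_p)$ (on a complex vector space with an invariant inner product $\langle\cdot,\cdot\rangle$) which is isomorphic to the irreducible unramified principal series with Satake parameter $(\alpha,\alpha^{-1})$ and trivial central character, i.e. to the space of functions $\varphi$ on $GL_2(\mathbb{Q}_p)$, right invariant under an open subgroup, with $\varphi\left(\begin{pmatrix} x&y\\0&z\end{pmatrix}g\right)=\alpha^{\mathrm{ord}_p(x/z)}|x/z|_p^{1/2}\varphi(g)$, under right translation; here $\alpha\in\mathbb{C}^\times$ and $\alpha^2\ne p^{\pm1}$. Let $f'_p\neq 0$ be a vector of $\pi$ fixed by $GL_2(\mathbb{Z}_p)$. * Put $\mu_p=\frac12\left(\mathrm{ord}_p((2\xi)^2)-\mathrm{ord}_p(d_\xi)\right)\in\mathbb{Z}$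 and $\gamma'_{0,p}=\begin{pmatrix}1&0\\0&p^{-\mu_p+i_p(\chi)}\end{pmatrix}$. * Local factors: $\zeta_p(s)=(1-p^{-s})^{-1}$; $L_p(\eta_p,s)=(1-e_p p^{-s})^{-1}$ with $e_p=1,-1,0$ according to whether $p$ is split, inert or ramified in $E$; $L_p(\pi,\mathrm{Ad},s)=(1-p^{-s})^{-1}(1-\alpha^2p^{-s})^{-1}(1-\alpha^{-2}p^{-s})^{-1}$; and, for the base change $\Pi$ of $\pi$ to $E_p$, $L_p(\Pi,\chi_p^{-1},s)=1$ if $i_p(\chi)>0$, while for $i_p(\chi)=0$ $$L_p(\Pi,\chi_p^{-1},s)=\prod_{P\mid p}\left(1-\alpha^{f_P}\chi_p(\varpi_P)^{-1}p^{-f_Ps}\right)^{-1}\left(1-\alpha^{-f_P}\chi_p(\varpi_P)^{-1}p^{-f_Ps}\right)^{-1},$$ where $P$ runs over the primes of $E$ above $p$, $f_P$ is the inertia degree, and $\varpi_P\in\mathcal{O}_E$ has valuation $1$ at $P$ and $0$ at the other prime above $p$, if there is one. * Let $ds$ be the invariant measure on $\mathbb{Q}_p^\times\backslash E_p^\times$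 for which the image of $\mathcal{O}_{E_p}^\times$ has volume $1$ (the quotient of the Haar measures with $\mathrm{vol}(\mathcal{O}_{E_p}^\times)=\mathrm{vol}(\mathbb{Z}_p^\times)=1$). For $h\in B_p^\times$ put $$\alpha_p(f'_p,\chi_p,h)=\frac{L_p(\eta_p,1)\,L_p(\pi,\mathrm{Ad},1)}{\zeta_p(2)\,L_p(\Pi,\chi_p^{-1},\frac12)}\int_{\mathbb{Q}_p^\times\backslash E_p^\times}\frac{\langle\pi(sh)f'_p,\pi(h)f'_p\rangle}{\langle f'_p,f'_p\rangle}\,\chi_p(s)^{-1}\,ds .$$ **Proposition.** For $h=\gamma'_{0,p}$ the integral converges absolutely, and $$\alpha_p(f'_p,\chi_p,\gamma'_{0,p})=\begin{cases}1 & (i_p(\chi)=0),\\ p^{-i_p(\chi)}L_p(\eta_p,1)^2 & (i_p(\chi)>0).\end{cases}$$ -/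

import Mathlib

open MeasureTheory NumberField
open scoped TensorProduct Quaternion

noncomputable section

namespace Toral

/-! ### The quadratic field `E = ℚ(ξ)` and its completion at `p` -/

/-- `E_p = ℚ_p ⊗ E`. -/
abbrev Ep (p : ℕ) [Fact p.Prime] (E : Type*) [Field E] [NumberField E] : Type _ :=
  ℚ_[p] ⊗[ℚ] E

section Completion

variable (p : ℕ) [Fact p.Prime] (E : Type*) [Field E] [NumberField E]

/-- `E_p` carries its topology as a finite dimensional `ℚ_p`-vector space. -/
instance instTopEp : TopologicalSpace (Ep p E) :=
  moduleTopology ℚ_[p] (Ep p E)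

instance instModTopEp : IsModuleTopology ℚ_[p] (Ep p E) := ⟨rfl⟩

instance instTopRingEp : IsTopologicalRing (Ep p E) :=
  IsModuleTopology.isTopologicalRing ℚ_[p] (Ep p E)

/-- The ring of integers `𝒪_{E_p}` of `E_p`: the `ℤ_p`-span of the ring of integers of `E`. -/
def integersEp : Submodule ℤ_[p] (Ep p E) :=
  Submodule.span ℤ_[p] (Set.range fun x : 𝓞 E => (1 : ℚ_[p]) ⊗ₜ[ℚ] (x : E))

/-- The order `𝒪_{E_p,i} = ℤ_p + p^i 𝒪_{E_p}`. -/
def orderEp (i : ℕ) : Set (Ep p E) :=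
  {x | ∃ c : ℤ_[p], ∃ y ∈ integersEp p E,
    x = algebraMap ℚ_[p] (Ep p E) c + (p : Ep p E) ^ i * y}

/-- The unit group `𝒪_{E_p,i}^×`. -/
def orderUnits (i : ℕ) : Set (Ep p E)ˣ :=
  {s | (s : Ep p E) ∈ orderEp p E i ∧ ((s⁻¹ : (Ep p E)ˣ) : Ep p E) ∈ orderEp p E i}

/-- `ℚ_p^×` inside `E_p^×`. -/
def scalars : Subgroup (Ep p E)ˣ :=
  (Units.map (algebraMap ℚ_[p] (Ep p E) : ℚ_[p] →* Ep p E)).range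

/-- The group `ℚ_p^× \ E_p^×`, with the quotient topology. -/
abbrev ToralQuotient : Type _ := (Ep p E)ˣ ⧸ scalars p E

/-- `ℚ_p^× \ E_p^×` carries its Borel `σ`-algebra. -/
instance instMeasToralQuotient : MeasurableSpace (ToralQuotient p E) := borel _

instance instBorelToralQuotient : BorelSpace (ToralQuotient p E) := ⟨rfl⟩

variable {p E}

/-- The conductor exponent `i_p(χ) = min {i ≥ 0 ∣ χ = 1 on 𝒪_{E_p,i}^×}`. -/
def conductorExp (χ : (Ep p E)ˣ →* Circle) : ℕ :=
  sInf {i : ℕ | ∀ s ∈ orderUnits p E i, χ s = 1}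

variable (p) in
/-- The inclusion `E^× → E_p^×`. -/
def unitsToEp : Eˣ →* (Ep p E)ˣ :=
  Units.map ((Algebra.TensorProduct.includeRight : E →ₐ[ℚ] Ep p E) : E →* Ep p E)

variable (p E) in
/-- The prime ideals of `𝓞 E` above `p`. -/
abbrev primesAbove : Set (Ideal (𝓞 E)) :=
  Ideal.primesOver (Ideal.span {(p : ℤ)}) (𝓞 E)

variable (p) in
/-- `t ∈ E^×` is a prime element for the prime ideal `P ∣ p`: it is integral, of valuation one at
`P`, and a unit at the other prime ideal above `p` (if there is one). -/
def IsPrimeElementAt (P : Ideal (𝓞 E)) (t : Eˣ) : Prop :=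
  ∃ x : 𝓞 E, (x : E) = t ∧ x ∈ P ∧ x ∉ P ^ 2 ∧ ∀ Q ∈ primesAbove p E, Q ≠ P → x ∉ Q

/-! ### Local `L`-factors -/

open scoped Classical in
variable (p E) in
/-- For quadratic `E`: `1`, `-1`, `0` according to whether `p` is split, inert or ramified in `E`;
this is the value at `p` of the quadratic character attached to `E/ℚ`
(extended by `0` where it is ramified). -/
def splittingSign : ℤ :=
  if (primesAbove p E).ncard = 2 then 1
  else if (Ideal.span {(p : 𝓞 E)}).IsPrime then -1
  else 0

variable (p) in
/-- `ζ_p(s)`. -/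
def zetaFactor (s : ℂ) : ℂ := (1 - (p : ℂ) ^ (-s))⁻¹

variable (p E) in
/-- `L_p(η_p, s)` for the quadratic character `η` attached to `E/ℚ`. -/
def etaFactor (s : ℂ) : ℂ := (1 - (splittingSign p E : ℂ) * (p : ℂ) ^ (-s))⁻¹

variable (p) in
/-- `L_p(π, Ad, s)` for the unramified `π` with Satake parameter `(α, α⁻¹)`. -/
def adjointFactor (α s : ℂ) : ℂ :=
  (1 - (p : ℂ) ^ (-s))⁻¹ * (1 - α ^ 2 * (p : ℂ) ^ (-s))⁻¹ * (1 - (α⁻¹) ^ 2 * (p : ℂ) ^ (-s))⁻¹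

/-- `L_p(Π, χ⁻¹, s)` for the base change `Π` to `E_p` of the unramified representation with Satake
parameter `(α, α⁻¹)`. At a prime `P ∣ p` with inertia degree `f`, the base change has Satake
parameter `(α^f, α^{-f})`; `ϖ P` is a prime element for `P`. The factor is `1` if `χ` is
ramified. -/
def baseChangeFactor (ϖ : Ideal (𝓞 E) → Eˣ) (χ : (Ep p E)ˣ →* Circle) (α s : ℂ) : ℂ :=
  if conductorExp χ = 0 then
    ∏ᶠ P ∈ primesAbove p E,
      ((1 - α ^ (P.inertiaDeg ℤ) * ((χ (unitsToEp p (ϖ P)))⁻¹ : Circle)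
          * (p : ℂ) ^ (-((P.inertiaDeg ℤ : ℂ) * s)))⁻¹ *
       (1 - (α⁻¹) ^ (P.inertiaDeg ℤ) * ((χ (unitsToEp p (ϖ P)))⁻¹ : Circle)
          * (p : ℂ) ^ (-((P.inertiaDeg ℤ : ℂ) * s)))⁻¹)
  else 1

/-! ### The embedding attached to `ξ` -/

/-- The constant `a`: it is `2 √(-n(ξ)) √(d_ξ)` if `d_ξ` is odd and `√(-n(ξ)) √(d_ξ)` if `d_ξ` is
even. Both radicands are negative, so `√(-n(ξ)) √(d_ξ) = -√(n(ξ) |d_ξ|)`, and `n(ξ) |d_ξ|` is the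
square of a rational number. Here `n(ξ)` is the norm of `ξ` and `d_ξ` is the discriminant of
`E`. -/
def constA (ξ : E) : ℚ :=
  if Odd (discr E) then -2 * Rat.sqrt (Algebra.norm ℚ ξ * |(discr E : ℚ)|)
  else -Rat.sqrt (Algebra.norm ℚ ξ * |(discr E : ℚ)|)

/-- The constant `b = ξ² - a²/4`, where `ξ² = -n(ξ)`. -/
def constB (ξ : E) : ℚ := -Algebra.norm ℚ ξ - constA ξ ^ 2 / 4

variable (p) in
/-- The matrix of `ξ` in `M_2(ℚ_p)`. -/
def xiMatrix (ξ : E) : Matrix (Fin 2) (Fin 2) ℚ_[p] :=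
  !![((constA ξ / 2 : ℚ) : ℚ_[p]), ((constB ξ : ℚ) : ℚ_[p]);
     1, ((-(constA ξ / 2) : ℚ) : ℚ_[p])]

variable (p) in
/-- `μ_p = (ord_p((2ξ)²) - ord_p(d_ξ)) / 2`; the division is exact, since `(2ξ)² / d_ξ` is the
square of a rational number. -/
def muExp (ξ : E) : ℤ :=
  (padicValRat p (-4 * Algebra.norm ℚ ξ) - padicValRat p (discr E : ℚ)) / 2

end Completion

section GL2

variable (p : ℕ) [Fact p.Prime]

/-- The matrix `diag(1, p^m)` in `GL_2(ℚ_p)`. -/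
def diagPow (m : ℤ) : GL (Fin 2) ℚ_[p] :=
  Matrix.GeneralLinearGroup.mkOfDetNeZero !![1, 0; 0, (p : ℚ_[p]) ^ m] (by
    have hp : (p : ℚ_[p]) ≠ 0 := by exact_mod_cast (Fact.out : p.Prime).ne_zero
    simpa [Matrix.det_fin_two_of] using zpow_ne_zero m hp)

/-! ### Unramified principal series -/

/-- The space of the (normalized, smooth) principal series of `GL_2(ℚ_p)` induced from the
unramified characters `μ₁, μ₂` of `ℚ_p^×` with `μ₁(p) = α`, `μ₂(p) = α⁻¹`: the functions `φ` that
are right invariant under some open subgroup, with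
`φ (b g) = μ₁(b₀₀) μ₂(b₁₁) |b₀₀ / b₁₁|^{1/2} φ(g)` for all upper triangular `b`. -/
def principalSeries (α : ℂ) : Submodule ℂ (GL (Fin 2) ℚ_[p] → ℂ) where
  carrier := {φ |
    (∀ b g : GL (Fin 2) ℚ_[p], b.1 1 0 = 0 →
      φ (b * g) = α ^ ((b.1 0 0).valuation - (b.1 1 1).valuation)
        * (Real.sqrt (‖b.1 0 0‖ / ‖b.1 1 1‖) : ℂ) * φ g) ∧
    ∃ U : Subgroup (GL (Fin 2) ℚ_[p]), IsOpen (U : Set (GL (Fin 2) ℚ_[p])) ∧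
      ∀ k ∈ U, ∀ g, φ (g * k) = φ g}
  add_mem' := by
    rintro φ ψ ⟨h₁, U, hU, h₂⟩ ⟨h₃, W, hW, h₄⟩
    refine ⟨fun b g hb => ?_, U ⊓ W, ?_, fun k hk g => ?_⟩
    · simp only [Pi.add_apply, h₁ b g hb, h₃ b g hb]; ring
    · simpa using hU.inter hW
    · simp only [Pi.add_apply, h₂ k hk.1 g, h₄ k hk.2 g]
  zero_mem' := ⟨fun b g _ => by simp, ⊤, by simp, fun k _ g => rfl⟩
  smul_mem' := by
    rintro c φ ⟨h₁, U, hU, h₂⟩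
    refine ⟨fun b g hb => ?_, U, hU, fun k hk g => ?_⟩
    · simp only [Pi.smul_apply, h₁ b g hb, smul_eq_mul]; ring
    · simp only [Pi.smul_apply, h₂ k hk g]

/-- `GL_2(ℚ_p)` acts on the principal series by right translation. -/
def principalSeriesRep (α : ℂ) : Representation ℂ (GL (Fin 2) ℚ_[p]) (principalSeries p α) where
  toFun h :=
    { toFun := fun φ => ⟨fun g => φ.1 (g * h), by
        obtain ⟨φ, h₁, U, hU, h₂⟩ := φ
        refine ⟨fun b g hb => by simpa only [mul_assoc] using h₁ b (g * h) hb,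
          U.comap (MulAut.conj h⁻¹).toMonoidHom, ?_, fun k hk g => ?_⟩
        · refine hU.preimage (f := fun k => h⁻¹ * k * h⁻¹⁻¹) ?_
          fun_prop
        · have := h₂ _ hk (g * h)
          simpa [mul_assoc] using this⟩
      map_add' := fun φ ψ => rfl
      map_smul' := fun c φ => rfl }
  map_one' := by ext φ g; simp
  map_mul' h₁ h₂ := by ext φ g; simp [mul_assoc]

end GL2

/-! ### The local factor -/

section Factor

variable (p : ℕ) [Fact p.Prime] (u v : ℚ)

/-- `B_p = ℚ_p ⊗ B` for the quaternion algebra `B = ℚ + ℚi + ℚj + ℚij`, `i² = u`, `j² = v`,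
`ij = -ji`. -/
abbrev Bp : Type := ℚ_[p] ⊗[ℚ] ℍ[ℚ,u,v]

variable {p u v} {E : Type*} [Field E] [NumberField E]
  {V : Type*} [NormedAddCommGroup V] [InnerProductSpace ℂ V]

/-- The embedding `E_p^× → B_p^×` induced by `σ : E → B`. -/
def torusEmb (σ : E →ₐ[ℚ] ℍ[ℚ,u,v]) : (Ep p E)ˣ →* (Bp p u v)ˣ :=
  Units.map ((Algebra.TensorProduct.map (AlgHom.id ℚ_[p] ℚ_[p]) σ :
    Ep p E →ₐ[ℚ_[p]] Bp p u v) : Ep p E →* Bp p u v)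

/-- The function
`s ↦ ⟨π(s h) f, π(h) f⟩ / ⟨f, f⟩ · χ(s)⁻¹` on `E_p^×`, where `⟨·, ·⟩` is linear in the first
variable. (Mathlib's `inner ℂ x y` is linear in `y`, so `⟨x, y⟩` is `inner ℂ y x`.) -/
def toralIntegrand (σ : E →ₐ[ℚ] ℍ[ℚ,u,v]) (π : Representation ℂ (Bp p u v)ˣ V) (f : V)
    (χ : (Ep p E)ˣ →* Circle) (h : (Bp p u v)ˣ) (s : (Ep p E)ˣ) : ℂ :=
  inner ℂ (π h f) (π (torusEmb σ s * h) f) / inner ℂ f f * ((χ s)⁻¹ : Circle)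

/-- The function on `ℚ_p^× \ E_p^×` induced by `toralIntegrand`, which is invariant under `ℚ_p^×`
when `π` has trivial central character and `χ` is trivial on `ℚ_p^×`
(so the choice of representatives does not matter). -/
def toralIntegrandQuot (σ : E →ₐ[ℚ] ℍ[ℚ,u,v]) (π : Representation ℂ (Bp p u v)ˣ V) (f : V)
    (χ : (Ep p E)ˣ →* Circle) (h : (Bp p u v)ˣ) (q : ToralQuotient p E) : ℂ :=
  toralIntegrand σ π f χ h q.out

/-- The normalized local factor
`L_p(η_p,1) L_p(π,Ad,1) / (ζ_p(2) L_p(Π,χ⁻¹,1/2)) · ∫ ⟨π(s h) f, π(h) f⟩ / ⟨f, f⟩ χ(s)⁻¹ ds`,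
the integral being over `ℚ_p^× \ E_p^×` with respect to the measure `ν`, for `π` unramified with
Satake parameter `(α, α⁻¹)`. -/
def localFactor (ϖ : Ideal (𝓞 E) → Eˣ) (α : ℂ) (ν : Measure (ToralQuotient p E))
    (σ : E →ₐ[ℚ] ℍ[ℚ,u,v]) (π : Representation ℂ (Bp p u v)ˣ V) (f : V)
    (χ : (Ep p E)ˣ →* Circle) (h : (Bp p u v)ˣ) : ℂ :=
  etaFactor p E 1 * adjointFactor p α 1 / (zetaFactor p 2 * baseChangeFactor ϖ χ α (1 / 2)) *
    ∫ q, toralIntegrandQuot σ π f χ h q ∂ν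

/-- The element `γ'_{0,p} = diag(1, p^{-μ_p + i_p(χ)})` of `B_p^×`, identified with `GL_2(ℚ_p)`
through `ι`. -/
def basePoint (ι : Bp p u v ≃ₐ[ℚ_[p]] Matrix (Fin 2) (Fin 2) ℚ_[p]) (ξ : E)
    (χ : (Ep p E)ˣ →* Circle) : (Bp p u v)ˣ :=
  Units.map (ι.symm : Matrix (Fin 2) (Fin 2) ℚ_[p] →* Bp p u v)
    (diagPow p (-muExp p ξ + (conductorExp χ : ℤ)))

end Factor

end Toral

end

noncomputable section

set_option linter.unusedSectionVars false

namespace Toral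

section Spherical

variable {p : ℕ} [Fact p.Prime]

/-! ### Integral matrices and the Cartan decomposition -/

/-! Let Ψ(g) = ⟨π(g)f, f⟩ / ⟨f, f⟩. By unitarity the integrand at s is Ψ(γ⁻¹ s γ) χ(s)⁻¹, with γ the
base point (`toralIntegrand_eq`). Since Ψ is invariant under GL_2(ℤ_p) on both sides and under the
centre, it depends only on the difference n of the elementary divisors, through X n = Ψ(diag(1,
p^n)) (`IsSpherical.eq_diagPow`).

Write 𝓞_E = ℤ[ω] with ω² = a + bω; these a, b are not the constants `constA`, `constB`. Then ξ =
q(2ω - b), and `constA`, `constB`, μ_p are tuned so that conjugation by γ makes the integral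
matrices meet E_p exactly in 𝒪_i = ℤ_p + p^i ω ℤ_p, i = i_p(χ) (`entryNorm_conj_omegaMatrix`). So
the integrand is X(d_i(s)) χ(s)⁻¹, where d_i(s) is the relative position of the lattices s𝒪_i and
𝒪_i (`IsSpherical.apply_conj_toralGL`). What remains is combinatorics on ℚ_p^× \ E_p^×, filtered by
the images U_i of 𝒪_i^×.

The Hecke operator gives a linear recurrence for X with characteristic roots β₁ = α/√p and β₂ =
α⁻¹/√p. Unitarity makes X 1 real of absolute value at most 1; together with α² ≠ p^{±1} this forces
|β₁|, |β₂| < 1 (`norm_satake_lt_one_aux`). Hence X decays geometrically and the integral converges.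

If χ is ramified, write i_p(χ) = i + 1. Outside U_{i+1} one has d_{i+1} = d_i + 2
(`relativePosition_succ`), so X(d_{i+1}) is X(d_i + 2) plus (1 - X 2) times the indicator of
U_{i+1}. The first function is U_i-invariant while χ is nontrivial on U_i, so it contributes 0, and
the integral is vol(U_{i+1})(1 - X 2) (`integral_of_ramified`). Here vol(U_{i+1}) = p^{-(i+1)}
L_p(η_p, 1), by counting cosets, and 1 - X 2 = ζ_p(2) / L_p(π, Ad, 1).

If χ is unramified, the integral is a sum over the cosets of U_0: one coset if p is inert, two if p
is ramified, and the powers of a prime element if p is split. The last sum is a two-sided generating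
series of X. In each case the value is matched with the L-factors by an identity of rational
functions in β₁, β₂. -/

/-- The maximum of the norms of the entries of a `2 × 2` matrix. -/
def entryNorm (g : Matrix (Fin 2) (Fin 2) ℚ_[p]) : ℝ :=
  max (max ‖g 0 0‖ ‖g 0 1‖) (max ‖g 1 0‖ ‖g 1 1‖)

theorem entryNorm_le_iff {g : Matrix (Fin 2) (Fin 2) ℚ_[p]} {r : ℝ} :
    entryNorm g ≤ r ↔ (‖g 0 0‖ ≤ r ∧ ‖g 0 1‖ ≤ r) ∧ ‖g 1 0‖ ≤ r ∧ ‖g 1 1‖ ≤ r := by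
  simp [entryNorm]

theorem prime_cast_pos : (0 : ℝ) < p := by exact_mod_cast (Fact.out : p.Prime).pos

theorem one_lt_prime_cast : (1 : ℝ) < p := by exact_mod_cast (Fact.out : p.Prime).one_lt

theorem padic_prime_ne_zero : (p : ℚ_[p]) ≠ 0 := by
  exact_mod_cast (Fact.out : p.Prime).ne_zero

/-- The matrix in `GL_2(ℚ_p)` with given entries. -/
def mkGL (a b c d : ℚ_[p]) (h : a * d - b * c ≠ 0) : GL (Fin 2) ℚ_[p] :=
  Matrix.GeneralLinearGroup.mkOfDetNeZero !![a, b; c, d] (by rwa [Matrix.det_fin_two_of])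

@[simp] theorem coe_mkGL (a b c d : ℚ_[p]) (h : a * d - b * c ≠ 0) :
    (mkGL a b c d h : Matrix (Fin 2) (Fin 2) ℚ_[p]) = !![a, b; c, d] := rfl

theorem coe_diagPow (m : ℤ) :
    (diagPow p m : Matrix (Fin 2) (Fin 2) ℚ_[p]) = !![1, 0; 0, (p : ℚ_[p]) ^ m] := rfl

/-- Lets GL_2(ℤ_p) be handled inside GL_2(ℚ_p) through two norm conditions; the inverse is integral
because the determinant is a unit. -/
theorem exists_map_eq_of_entryNorm_le_one (g : GL (Fin 2) ℚ_[p])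
    (h₁ : entryNorm (g : Matrix (Fin 2) (Fin 2) ℚ_[p]) ≤ 1)
    (h₂ : ‖(g : Matrix (Fin 2) (Fin 2) ℚ_[p]).det‖ = 1) :
    ∃ k : GL (Fin 2) ℤ_[p],
      Matrix.GeneralLinearGroup.map (algebraMap ℤ_[p] ℚ_[p]) k = g := by
  obtain ⟨⟨h00, h01⟩, h10, h11⟩ := entryNorm_le_iff.1 h₁
  let A : Matrix (Fin 2) (Fin 2) ℤ_[p] :=
    !![⟨g.1 0 0, h00⟩, ⟨g.1 0 1, h01⟩; ⟨g.1 1 0, h10⟩, ⟨g.1 1 1, h11⟩]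
  have hA : A.map (algebraMap ℤ_[p] ℚ_[p]) = g.1 := by
    ext i j
    fin_cases i <;> fin_cases j <;> rfl
  have hdet : IsUnit A.det := by
    have := RingHom.map_det (algebraMap ℤ_[p] ℚ_[p]) A
    rw [RingHom.mapMatrix_apply, hA] at this
    rw [PadicInt.isUnit_iff, PadicInt.norm_def]
    exact (congrArg norm this).trans h₂
  refine ⟨Matrix.GeneralLinearGroup.mk'' A hdet, ?_⟩
  ext i j
  exact congrFun (congrFun hA i) j

/-- A function on `GL_2(ℚ_p)` that is invariant under `GL_2(ℤ_p)` on both sides and under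
scalar matrices. -/
structure IsSpherical (Ψ : GL (Fin 2) ℚ_[p] → ℂ) : Prop where
  left : ∀ k g : GL (Fin 2) ℚ_[p], entryNorm (k : Matrix (Fin 2) (Fin 2) ℚ_[p]) ≤ 1 →
    ‖(k : Matrix (Fin 2) (Fin 2) ℚ_[p]).det‖ = 1 → Ψ (k * g) = Ψ g
  right : ∀ k g : GL (Fin 2) ℚ_[p], entryNorm (k : Matrix (Fin 2) (Fin 2) ℚ_[p]) ≤ 1 →
    ‖(k : Matrix (Fin 2) (Fin 2) ℚ_[p]).det‖ = 1 → Ψ (g * k) = Ψ g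
  scalar : ∀ (g g' : GL (Fin 2) ℚ_[p]) (z : ℚ_[p]),
    (g : Matrix (Fin 2) (Fin 2) ℚ_[p]) = z • (g' : Matrix (Fin 2) (Fin 2) ℚ_[p]) → Ψ g = Ψ g'

theorem det_ne_zero (g : GL (Fin 2) ℚ_[p]) : (g : Matrix (Fin 2) (Fin 2) ℚ_[p]).det ≠ 0 :=
  (Matrix.isUnit_iff_isUnit_det _).1 g.isUnit |>.ne_zero

theorem entryNorm_pos (g : GL (Fin 2) ℚ_[p]) :
    0 < entryNorm (g : Matrix (Fin 2) (Fin 2) ℚ_[p]) := by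
  by_contra! h
  obtain ⟨⟨h00, h01⟩, h10, h11⟩ := entryNorm_le_iff.1 h
  apply det_ne_zero g
  rw [Matrix.det_fin_two, norm_le_zero_iff.1 h00, norm_le_zero_iff.1 h01]
  simp

theorem exists_norm_eq_entryNorm (g : Matrix (Fin 2) (Fin 2) ℚ_[p]) :
    ∃ i j, ‖g i j‖ = entryNorm g := by
  unfold entryNorm
  rcases max_choice (max ‖g 0 0‖ ‖g 0 1‖) (max ‖g 1 0‖ ‖g 1 1‖) with h | h <;> rw [h]
  · rcases max_choice ‖g 0 0‖ ‖g 0 1‖ with h | h <;> rw [h] <;> exact ⟨_, _, rfl⟩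
  · rcases max_choice ‖g 1 0‖ ‖g 1 1‖ with h | h <;> rw [h] <;> exact ⟨_, _, rfl⟩

namespace IsSpherical

variable {Ψ : GL (Fin 2) ℚ_[p] → ℂ}

/-- The matrix exchanging the two basis vectors. -/
def swapGL (p : ℕ) [Fact p.Prime] : GL (Fin 2) ℚ_[p] := mkGL 0 1 1 0 (by simp)

theorem entryNorm_swapGL :
    entryNorm (swapGL p : Matrix (Fin 2) (Fin 2) ℚ_[p]) ≤ 1 := by
  simp [swapGL, entryNorm]

theorem norm_det_swapGL : ‖(swapGL p : Matrix (Fin 2) (Fin 2) ℚ_[p]).det‖ = 1 := by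
  simp [swapGL, Matrix.det_fin_two]

/-- An entry of maximal norm in the corner divides its row and column, so elimination uses integral
multipliers only. This gives g = x · k₁ · diag(1, p^n) · k₂ with k₁, k₂ in GL_2(ℤ_p). -/
theorem eq_of_norm_zero_zero (h : IsSpherical Ψ) (g : GL (Fin 2) ℚ_[p]) (n : ℕ)
    (hg : ‖(g : Matrix (Fin 2) (Fin 2) ℚ_[p]).det‖
      = (p : ℝ) ^ (-(n : ℤ)) * entryNorm (g : Matrix (Fin 2) (Fin 2) ℚ_[p]) ^ 2)
    (h00 : ‖g.1 0 0‖ = entryNorm (g : Matrix (Fin 2) (Fin 2) ℚ_[p])) :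
    Ψ g = Ψ (diagPow p n) := by
  have hpos := entryNorm_pos g
  rw [← h00] at hpos hg
  have hx : g.1 0 0 ≠ 0 := norm_pos_iff.1 hpos
  obtain ⟨⟨-, h01⟩, h10, -⟩ := entryNorm_le_iff.1 h00.symm.le
  have hp0 := padic_prime_ne_zero (p := p)
  have hpn : (p : ℚ_[p]) ^ n ≠ 0 := pow_ne_zero _ hp0
  set x := g.1 0 0 with hxdef
  -- The part of det g not accounted for by x² p^n; `hg` says exactly that it is a unit.
  set u : ℚ_[p] := g.1.det / (x ^ 2 * p ^ n) with hu
  have hunorm : ‖u‖ = 1 := by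
    rw [hu, norm_div, norm_mul, norm_pow, norm_pow, hg, Padic.norm_p, zpow_neg, zpow_natCast,
      inv_pow]
    have : (p : ℝ) ^ n ≠ 0 := pow_ne_zero _ prime_cast_pos.ne'
    field_simp
  have hu0 : u ≠ 0 := norm_pos_iff.1 (by rw [hunorm]; exact one_pos)
  let k₁ := mkGL 1 0 (g.1 1 0 / x) u (by simpa using hu0)
  let k₂ := mkGL 1 (g.1 0 1 / x) 0 1 (by simp)
  have e : (g : Matrix (Fin 2) (Fin 2) ℚ_[p])
      = x • ((k₁ * diagPow p n * k₂ : GL (Fin 2) ℚ_[p]) : Matrix (Fin 2) (Fin 2) ℚ_[p]) := by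
    have hd := Matrix.det_fin_two (g : Matrix (Fin 2) (Fin 2) ℚ_[p])
    ext i j
    fin_cases i <;> fin_cases j <;>
      simp [k₁, k₂, coe_diagPow] <;> try field_simp
    · rfl
    rw [hu, hd, ← hxdef]
    field_simp
    ring
  rw [h.scalar _ _ _ e, h.right, h.left]
  · simp [k₁, entryNorm_le_iff, hunorm, div_le_one hpos, h10]
  · simp [k₁, Matrix.det_fin_two, hunorm]
  · simp [k₂, entryNorm_le_iff, div_le_one hpos, h01]
  · simp [k₂, Matrix.det_fin_two]

/-- The Cartan decomposition: a spherical function only depends on the elementary divisors. -/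
theorem eq_diagPow (h : IsSpherical Ψ) (g : GL (Fin 2) ℚ_[p]) (n : ℕ)
    (hg : ‖(g : Matrix (Fin 2) (Fin 2) ℚ_[p]).det‖
      = (p : ℝ) ^ (-(n : ℤ)) * entryNorm (g : Matrix (Fin 2) (Fin 2) ℚ_[p]) ^ 2) :
    Ψ g = Ψ (diagPow p n) := by
  -- An entry of maximal norm is brought to the corner by a column swap, then by a row swap; neither
  -- changes the determinant norm or the entry norm.
  have hcol : ∀ g : GL (Fin 2) ℚ_[p], ‖(g : Matrix (Fin 2) (Fin 2) ℚ_[p]).det‖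
      = (p : ℝ) ^ (-(n : ℤ)) * entryNorm (g : Matrix (Fin 2) (Fin 2) ℚ_[p]) ^ 2 →
      ∀ j, ‖g.1 0 j‖ = entryNorm (g : Matrix (Fin 2) (Fin 2) ℚ_[p]) →
      Ψ g = Ψ (diagPow p n) := by
    intro g hg j hj
    fin_cases j
    · exact h.eq_of_norm_zero_zero g n hg hj
    have hn : entryNorm ((g * swapGL p : GL (Fin 2) ℚ_[p]) : Matrix (Fin 2) (Fin 2) ℚ_[p])
        = entryNorm (g : Matrix (Fin 2) (Fin 2) ℚ_[p]) := by
      simp [entryNorm, swapGL, Matrix.mul_apply, Fin.sum_univ_two, max_comm]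
    rw [← h.right _ g entryNorm_swapGL norm_det_swapGL]
    refine h.eq_of_norm_zero_zero _ n ?_ ?_
    · rw [hn, ← hg, Units.val_mul, Matrix.det_mul, norm_mul, norm_det_swapGL, mul_one]
    · rw [hn, ← hj]
      simp [swapGL, Matrix.mul_apply, Fin.sum_univ_two]
  obtain ⟨i, j, hij⟩ := exists_norm_eq_entryNorm (g : Matrix (Fin 2) (Fin 2) ℚ_[p])
  fin_cases i
  · exact hcol g hg j hij
  have hn : entryNorm ((swapGL p * g : GL (Fin 2) ℚ_[p]) : Matrix (Fin 2) (Fin 2) ℚ_[p])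
      = entryNorm (g : Matrix (Fin 2) (Fin 2) ℚ_[p]) := by
    simp [entryNorm, swapGL, Matrix.mul_apply, Fin.sum_univ_two, max_comm]
  rw [← h.left _ g entryNorm_swapGL norm_det_swapGL]
  refine hcol _ ?_ j ?_
  · rw [hn, ← hg, Units.val_mul, Matrix.det_mul, norm_mul, norm_det_swapGL, one_mul]
  · rw [hn, ← hij]
    simp [swapGL, Matrix.mul_apply, Fin.sum_univ_two]

end IsSpherical

/-! ### Hecke operator on the spherical vector of the principal series -/

/-- With n the valuation of b₀₀/b₁₁, the modulus factor |b₀₀/b₁₁|^{1/2} = (√p)^{-n} merges with α^n.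
-/
theorem principalSeries_apply_of_triangular {α : ℂ}
    (φ : principalSeries p α) (b g : GL (Fin 2) ℚ_[p]) (hb : b.1 1 0 = 0) (n : ℤ)
    (hn : ‖b.1 0 0‖ = (p : ℝ) ^ (-n) * ‖b.1 1 1‖) :
    φ.1 (b * g) = (α / (Real.sqrt p : ℂ)) ^ n * φ.1 g := by
  have hd := det_ne_zero b
  rw [Matrix.det_fin_two, hb, mul_zero, sub_zero] at hd
  have h0 : b.1 0 0 ≠ 0 := left_ne_zero_of_mul hd
  have h1 : b.1 1 1 ≠ 0 := right_ne_zero_of_mul hd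
  have hp := prime_cast_pos (p := p)
  have hv : (b.1 0 0).valuation - (b.1 1 1).valuation = n := by
    have := hn
    rw [Padic.norm_eq_zpow_neg_valuation h0, Padic.norm_eq_zpow_neg_valuation h1,
      ← zpow_add₀ hp.ne'] at this
    have := zpow_right_injective₀ hp one_lt_prime_cast.ne' this
    omega
  rw [φ.2.1 b g hb, hv, hn, mul_div_assoc, div_self (norm_ne_zero_iff.2 h1), mul_one, div_zpow]
  have hs : Real.sqrt ((p : ℝ) ^ (-n)) = (Real.sqrt p) ^ (-n) := by
    rw [Real.sqrt_eq_iff_mul_self_eq (by positivity) (by positivity), ← mul_zpow,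
      Real.mul_self_sqrt hp.le]
  rw [hs]
  push_cast
  rw [zpow_neg]
  ring

/-- Iwasawa decomposition g = bk: the larger entry of the bottom row becomes b₁₁, and b₀₀ is det g
divided by it. So only the determinant and the size of the bottom row matter. -/
theorem principalSeries_apply {α : ℂ}
    (φ : principalSeries p α)
    (hφ : ∀ k g : GL (Fin 2) ℚ_[p], entryNorm (k : Matrix (Fin 2) (Fin 2) ℚ_[p]) ≤ 1 →
      ‖(k : Matrix (Fin 2) (Fin 2) ℚ_[p]).det‖ = 1 → φ.1 (g * k) = φ.1 g)
    (g : GL (Fin 2) ℚ_[p]) (n : ℤ)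
    (hn : ‖(g : Matrix (Fin 2) (Fin 2) ℚ_[p]).det‖
      = (p : ℝ) ^ (-n) * max ‖g.1 1 0‖ ‖g.1 1 1‖ ^ 2) :
    φ.1 g = (α / (Real.sqrt p : ℂ)) ^ n * φ.1 1 := by
  have hdet := det_ne_zero g
  have hd := Matrix.det_fin_two (g : Matrix (Fin 2) (Fin 2) ℚ_[p])
  have hpos : 0 < max ‖g.1 1 0‖ ‖g.1 1 1‖ := by
    by_contra! h
    rw [max_le_iff, norm_le_zero_iff, norm_le_zero_iff] at h
    rw [hd, h.1, h.2] at hdet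
    simp at hdet
  rcases le_total ‖g.1 1 0‖ ‖g.1 1 1‖ with hle | hle
  · rw [max_eq_right hle] at hn hpos
    have hy : g.1 1 1 ≠ 0 := norm_pos_iff.1 hpos
    let b := mkGL (g.1.det / g.1 1 1) (g.1 0 1) 0 (g.1 1 1) (by
      rw [mul_zero, sub_zero, div_mul_cancel₀ _ hy]; exact hdet)
    let k := mkGL 1 0 (g.1 1 0 / g.1 1 1) 1 (by simp)
    have e : g = b * 1 * k := by
      ext i j
      fin_cases i <;> fin_cases j <;>
        simp [b, k, Matrix.mul_apply, Fin.sum_univ_two] <;> field_simp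
      rw [hd]; ring
    rw [e, hφ, principalSeries_apply_of_triangular φ b 1 (by simp [b]) n]
    · simp only [b, coe_mkGL, Matrix.of_apply, Matrix.cons_val', Matrix.cons_val_zero,
        Matrix.cons_val_one, norm_div, hn, Matrix.cons_val_fin_one]
      field_simp
    · simp [k, entryNorm_le_iff, div_le_one hpos, hle]
    · simp [k, Matrix.det_fin_two]
  · rw [max_eq_left hle] at hn hpos
    have hy : g.1 1 0 ≠ 0 := norm_pos_iff.1 hpos
    let b := mkGL (g.1.det / g.1 1 0) (g.1 0 0) 0 (g.1 1 0) (by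
      rw [mul_zero, sub_zero, div_mul_cancel₀ _ hy]; exact hdet)
    let k := mkGL 0 (-1) 1 (g.1 1 1 / g.1 1 0) (by simp)
    have e : g = b * 1 * k := by
      ext i j
      fin_cases i <;> fin_cases j <;>
        simp [b, k, Matrix.mul_apply, Fin.sum_univ_two] <;> field_simp
      rw [hd]; ring
    rw [e, hφ, principalSeries_apply_of_triangular φ b 1 (by simp [b]) n]
    · simp only [b, coe_mkGL, Matrix.of_apply, Matrix.cons_val', Matrix.cons_val_zero,
        Matrix.cons_val_one, norm_div, hn, Matrix.cons_val_fin_one]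
      field_simp
    · simp [k, entryNorm_le_iff, div_le_one hpos, hle]
    · simp [k, Matrix.det_fin_two]

/-- The representatives `(p j; 0 1)` of the cosets in the Hecke operator at `p`. -/
def heckeRep (p : ℕ) [Fact p.Prime] (j : ℕ) : GL (Fin 2) ℚ_[p] :=
  mkGL p j 0 1 (by simpa using padic_prime_ne_zero)

theorem coe_heckeRep (j : ℕ) :
    (heckeRep p j : Matrix (Fin 2) (Fin 2) ℚ_[p]) = !![(p : ℚ_[p]), (j : ℚ_[p]); 0, 1] := rfl

theorem norm_le_inv_of_lt_one {x : ℚ_[p]} (h : ‖x‖ < 1) : ‖x‖ ≤ (p : ℝ)⁻¹ := by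
  have := (Padic.norm_le_pow_iff_norm_lt_pow_add_one x (-1)).2 (by simpa using h)
  simpa using this

theorem norm_le_div_of_lt {x y : ℚ_[p]} (h : ‖x‖ < ‖y‖) : ‖x‖ ≤ ‖y‖ / p := by
  have hy : 0 < ‖y‖ := (norm_nonneg x).trans_lt h
  have : ‖x / y‖ < 1 := by rwa [norm_div, div_lt_one hy]
  have := norm_le_inv_of_lt_one this
  rw [norm_div, div_le_iff₀ hy] at this
  rwa [div_eq_inv_mul]

theorem norm_natCast_sub_natCast_eq_one {i j : ℕ} (hi : i < p) (hj : j < p) (hij : i ≠ j) :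
    ‖(i : ℚ_[p]) - (j : ℚ_[p])‖ = 1 := by
  have h1 : ‖(((i : ℤ) - (j : ℤ) : ℤ) : ℚ_[p])‖ ≤ 1 := Padic.norm_int_le_one _
  rcases h1.lt_or_eq with h | h
  · rw [Padic.norm_intCast_lt_one_iff] at h
    exfalso
    have := Int.eq_zero_of_abs_lt_dvd h (by rw [abs_lt]; omega)
    omega
  · simpa using h

theorem norm_natCast_le_one (j : ℕ) : ‖(j : ℚ_[p])‖ ≤ 1 := by
  simpa using Padic.norm_int_le_one (p := p) (j : ℤ)

/-- Exactly one of the vectors `j c + d` (`0 ≤ j < p`) is small if `|d| ≤ |c|`. -/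
theorem exists_norm_le_div {c d : ℚ_[p]} (hc : c ≠ 0) (h : ‖d‖ ≤ ‖c‖) :
    ∃ j₀ < p, ‖(j₀ : ℚ_[p]) * c + d‖ ≤ ‖c‖ / p ∧
      ∀ j < p, j ≠ j₀ → ‖(j : ℚ_[p]) * c + d‖ = ‖c‖ := by
  have hc' : 0 < ‖c‖ := norm_pos_iff.2 hc
  have hx : ‖-d / c‖ ≤ 1 := by rw [norm_div, norm_neg]; exact (div_le_one hc').2 h
  obtain ⟨y, hy⟩ : ∃ y : ℤ_[p], (y : ℚ_[p]) = -d / c := ⟨⟨-d / c, hx⟩, rfl⟩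
  obtain ⟨j₀, hj₀, hm⟩ := PadicInt.exists_mem_range y
  rw [IsLocalRing.mem_maximalIdeal, PadicInt.mem_nonunits, PadicInt.norm_def, PadicInt.coe_sub,
    PadicInt.coe_natCast, hy] at hm
  have e : ‖(j₀ : ℚ_[p]) * c + d‖ < ‖c‖ := by
    have : (j₀ : ℚ_[p]) * c + d = -(-d / c - j₀) * c := by field_simp; ring
    rw [this, norm_mul, norm_neg]
    exact mul_lt_of_lt_one_left hc' hm
  refine ⟨j₀, hj₀, norm_le_div_of_lt e, fun j hj hne => ?_⟩
  have : (j : ℚ_[p]) * c + d = ((j : ℚ_[p]) - j₀) * c + ((j₀ : ℚ_[p]) * c + d) := by ring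
  have hn : ‖((j : ℚ_[p]) - j₀) * c‖ = ‖c‖ := by
    rw [norm_mul, norm_natCast_sub_natCast_eq_one hj hj₀ hne, one_mul]
  rw [this, Padic.add_eq_max_of_ne (by rw [hn]; exact e.ne'), hn, max_eq_left e.le]

theorem exists_norm_eq_zpow {x : ℚ_[p]} (hx : x ≠ 0) : ∃ n : ℤ, ‖x‖ = (p : ℝ) ^ (-n) :=
  ⟨_, Padic.norm_eq_zpow_neg_valuation hx⟩

/-- The eigenvalue `√p (α + α⁻¹)` of the Hecke operator. -/
def heckeEigenvalue (p : ℕ) (α : ℂ) : ℂ := (Real.sqrt p : ℂ) * (α + α⁻¹)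

/-- The bottom row (c, d) becomes (pc, jc + d) or (c, pd). Among these p + 1 rows exactly one is
small enough to send the exponent n to n - 1, and the other p send it to n + 1. The total pβ^{n+1} +
β^{n-1} is (pβ + β⁻¹)β^n. -/
theorem principalSeries_hecke {α : ℂ} (hα : α ≠ 0) (φ : principalSeries p α)
    (hφ : ∀ k g : GL (Fin 2) ℚ_[p], entryNorm (k : Matrix (Fin 2) (Fin 2) ℚ_[p]) ≤ 1 →
      ‖(k : Matrix (Fin 2) (Fin 2) ℚ_[p]).det‖ = 1 → φ.1 (g * k) = φ.1 g)
    (g : GL (Fin 2) ℚ_[p]) :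
    ∑ j ∈ Finset.range p, φ.1 (g * heckeRep p j) + φ.1 (g * diagPow p 1)
      = heckeEigenvalue p α * φ.1 g := by
  have hp := prime_cast_pos (p := p)
  have hdet := det_ne_zero g
  have hd := Matrix.det_fin_two (g : Matrix (Fin 2) (Fin 2) ℚ_[p])
  set β : ℂ := α / (Real.sqrt p : ℂ) with hβ
  have hsq : (Real.sqrt p : ℂ) ≠ 0 := by
    exact_mod_cast (Real.sqrt_pos.2 hp).ne'
  have hsq2 : (Real.sqrt p : ℂ) ^ 2 = p := by
    have := Real.sq_sqrt hp.le
    exact_mod_cast this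
  have hβ0 : β ≠ 0 := div_ne_zero hα hsq
  have hlam : heckeEigenvalue p α = p * β + β⁻¹ := by
    rw [heckeEigenvalue, hβ, ← hsq2]
    field_simp
  set c := g.1 1 0 with hc
  set d := g.1 1 1 with hd'
  obtain ⟨n, hn⟩ : ∃ n : ℤ, ‖(g : Matrix (Fin 2) (Fin 2) ℚ_[p]).det‖
      = (p : ℝ) ^ (-n) * max ‖c‖ ‖d‖ ^ 2 := by
    have : ∃ y : ℚ_[p], max ‖c‖ ‖d‖ = ‖y‖ ∧ y ≠ 0 := by
      have hcd : ¬ (c = 0 ∧ d = 0) := by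
        rintro ⟨h1, h2⟩
        rw [hd, h1, h2] at hdet
        simp at hdet
      rcases le_total ‖c‖ ‖d‖ with h | h
      · refine ⟨d, max_eq_right h, fun h0 => hcd ⟨?_, h0⟩⟩
        rw [h0, norm_zero] at h
        exact norm_le_zero_iff.1 h
      · refine ⟨c, max_eq_left h, fun h0 => hcd ⟨h0, ?_⟩⟩
        rw [h0, norm_zero] at h
        exact norm_le_zero_iff.1 h
    obtain ⟨y, hy, hy0⟩ := this
    obtain ⟨n, hn⟩ := exists_norm_eq_zpow (div_ne_zero hdet (pow_ne_zero 2 hy0))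
    refine ⟨n, ?_⟩
    rw [hy, ← hn, norm_div, norm_pow, div_mul_cancel₀]
    exact pow_ne_zero 2 (norm_ne_zero_iff.2 hy0)
  have hg : φ.1 g = β ^ n * φ.1 1 := principalSeries_apply φ hφ g n hn
  have hj : ∀ (j : ℕ) (m : ℤ), ‖g.1.det‖ * (p : ℝ)⁻¹
      = (p : ℝ) ^ (-m) * max (‖c‖ / p) ‖(j : ℚ_[p]) * c + d‖ ^ 2 →
      φ.1 (g * heckeRep p j) = β ^ m * φ.1 1 := by
    intro j m hm
    apply principalSeries_apply φ hφ
    rw [Units.val_mul, Matrix.det_mul, norm_mul]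
    convert hm using 3
    · simp [coe_heckeRep, Matrix.det_fin_two]
    · simp [coe_heckeRep, Matrix.mul_apply, Fin.sum_univ_two, ← hc, ← hd', div_eq_mul_inv,
        mul_comm]
  have hinf : ∀ m : ℤ, ‖g.1.det‖ * (p : ℝ)⁻¹
      = (p : ℝ) ^ (-m) * max ‖c‖ (‖d‖ / p) ^ 2 →
      φ.1 (g * diagPow p 1) = β ^ m * φ.1 1 := by
    intro m hm
    apply principalSeries_apply φ hφ
    rw [Units.val_mul, Matrix.det_mul, norm_mul]
    convert hm using 3
    · simp [coe_diagPow, Matrix.det_fin_two]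
    · simp [coe_diagPow, Matrix.mul_apply, Fin.sum_univ_two, ← hc, ← hd', div_eq_mul_inv]
  have hup : (p : ℝ) ^ (-(n + 1)) = (p : ℝ) ^ (-n) * (p : ℝ)⁻¹ := by
    rw [neg_add, zpow_add₀ hp.ne', zpow_neg_one]
  have hdown : (p : ℝ) ^ (-(n - 1)) = (p : ℝ) ^ (-n) * p := by
    rw [neg_sub, sub_eq_add_neg, add_comm, zpow_add₀ hp.ne', zpow_one]
  have hfin : (p * β ^ (n + 1) + β ^ (n - 1)) * φ.1 1 = heckeEigenvalue p α * φ.1 g := by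
    rw [hg, hlam, zpow_add_one₀ hβ0, zpow_sub_one₀ hβ0]
    ring
  have hple : ∀ x : ℝ, 0 ≤ x → x / p ≤ x := fun x hx => div_le_self hx one_lt_prime_cast.le
  -- If |d| ≤ |c| the exceptional row comes from the residue j₀ of -d/c; if |c| < |d| it comes from
  -- diag(1, p).
  rcases le_or_gt ‖d‖ ‖c‖ with hdc | hdc
  · have hc0 : c ≠ 0 := by
      rintro h0
      rw [h0, norm_zero] at hdc
      rw [hd, h0, norm_le_zero_iff.1 hdc] at hdet
      simp at hdet
    rw [max_eq_left hdc] at hn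
    obtain ⟨j₀, hj₀, hs, hl⟩ := exists_norm_le_div hc0 hdc
    have e1 : φ.1 (g * heckeRep p j₀) = β ^ (n - 1) * φ.1 1 := by
      apply hj
      rw [max_eq_left hs, hn, hdown]
      field_simp
    have e2 : ∀ j ∈ (Finset.range p).erase j₀,
        φ.1 (g * heckeRep p j) = β ^ (n + 1) * φ.1 1 := by
      intro j hjm
      rw [Finset.mem_erase, Finset.mem_range] at hjm
      apply hj
      rw [hl j hjm.2 hjm.1, max_eq_right (hple _ (norm_nonneg _)), hn, hup]
      ring
    have e3 : φ.1 (g * diagPow p 1) = β ^ (n + 1) * φ.1 1 := by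
      apply hinf
      rw [max_eq_left ((hple _ (norm_nonneg _)).trans hdc), hn, hup]
      ring
    rw [← Finset.add_sum_erase _ _ (Finset.mem_range.2 hj₀), e1, Finset.sum_congr rfl e2, e3,
      Finset.sum_const, Finset.card_erase_of_mem (Finset.mem_range.2 hj₀), Finset.card_range,
      ← hfin, nsmul_eq_mul, Nat.cast_sub (Fact.out : p.Prime).one_le]
    push_cast
    ring
  · rw [max_eq_right hdc.le] at hn
    have e2 : ∀ j ∈ Finset.range p, φ.1 (g * heckeRep p j) = β ^ (n + 1) * φ.1 1 := by
      intro j hjm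
      apply hj
      have hlt : ‖(j : ℚ_[p]) * c‖ < ‖d‖ := by
        rw [norm_mul]
        refine lt_of_le_of_lt ?_ hdc
        exact mul_le_of_le_one_left (norm_nonneg _) (norm_natCast_le_one j)
      rw [Padic.add_eq_max_of_ne hlt.ne, max_eq_right hlt.le,
        max_eq_right ((hple _ (norm_nonneg _)).trans hdc.le), hn, hup]
      ring
    have e3 : φ.1 (g * diagPow p 1) = β ^ (n - 1) * φ.1 1 := by
      apply hinf
      rw [max_eq_right (norm_le_div_of_lt hdc), hn, hdown]
      field_simp
    rw [Finset.sum_congr rfl e2, e3, Finset.sum_const, Finset.card_range, ← hfin, nsmul_eq_mul]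
    ring

end Spherical

/-! ### The normalized spherical matrix coefficient and its values X n -/

section SphericalCoefficient

variable {p : ℕ} [Fact p.Prime]

/-- The normalized matrix coefficient `⟨ρ(g) f, f⟩ / ⟨f, f⟩`. -/
def matrixCoeff {V : Type*} [NormedAddCommGroup V] [InnerProductSpace ℂ V]
    (ρ : Representation ℂ (GL (Fin 2) ℚ_[p]) V) (f : V) (g : GL (Fin 2) ℚ_[p]) : ℂ :=
  inner ℂ f (ρ g f) / inner ℂ f f

/-- The properties of the sequence of values of the normalized spherical function at the matrices
`diag(1, p^n)`. -/
structure IsSphericalSequence (p : ℕ) (α : ℂ) (X : ℕ → ℂ) : Prop where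
  zero : X 0 = 1
  one : (p + 1) * X 1 = heckeEigenvalue p α
  succ : ∀ n, heckeEigenvalue p α * X (n + 1) = p * X (n + 2) + X n
  real : (starRingEnd ℂ) (X 1) = X 1
  norm_le : ‖X 1‖ ≤ 1

variable {V : Type*} [NormedAddCommGroup V] [InnerProductSpace ℂ V]
  {ρ : Representation ℂ (GL (Fin 2) ℚ_[p]) V} {f : V}

/-- The scalar can be moved to the left of x, where it is a triangular matrix with equal diagonal
entries and acts trivially. -/
theorem principalSeriesRep_scalar {α : ℂ} (φ : principalSeries p α) (g g' : GL (Fin 2) ℚ_[p])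
    (z : ℚ_[p])
    (h : (g : Matrix (Fin 2) (Fin 2) ℚ_[p]) = z • (g' : Matrix (Fin 2) (Fin 2) ℚ_[p])) :
    principalSeriesRep p α g φ = principalSeriesRep p α g' φ := by
  have hz : z ≠ 0 := by
    rintro rfl
    apply det_ne_zero g
    rw [h, zero_smul, Matrix.det_zero]
  ext x
  change φ.1 (x * g) = φ.1 (x * g')
  have e : x * g = mkGL z 0 0 z (by simpa using hz) * (x * g') := by
    ext i j
    fin_cases i <;> fin_cases j <;>
      simp [h, Matrix.mul_apply, Fin.sum_univ_two] <;> ring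
  rw [e, principalSeries_apply_of_triangular φ _ _ (by simp) 0 (by simp)]
  simp

variable {α : ℂ} (hunit : ∀ h x y, inner ℂ (ρ h x) (ρ h y) = inner ℂ x y)
  (T : ρ.Equiv (principalSeriesRep p α))
  (hfix : ∀ k : GL (Fin 2) ℤ_[p],
    ρ (Matrix.GeneralLinearGroup.map (algebraMap ℤ_[p] ℚ_[p]) k) f = f)

theorem apply_eq_self_of_fixed
    (hfix : ∀ k : GL (Fin 2) ℤ_[p],
      ρ (Matrix.GeneralLinearGroup.map (algebraMap ℤ_[p] ℚ_[p]) k) f = f)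
    (k : GL (Fin 2) ℚ_[p]) (h₁ : entryNorm (k : Matrix (Fin 2) (Fin 2) ℚ_[p]) ≤ 1)
    (h₂ : ‖(k : Matrix (Fin 2) (Fin 2) ℚ_[p]).det‖ = 1) : ρ k f = f := by
  obtain ⟨k', rfl⟩ := exists_map_eq_of_entryNorm_le_one k h₁ h₂
  exact hfix k'

theorem equiv_apply (T : ρ.Equiv (principalSeriesRep p α)) (g : GL (Fin 2) ℚ_[p]) (x : V) :
    T (ρ g x) = principalSeriesRep p α g (T x) :=
  LinearMap.congr_fun (T.toIntertwiningMap.isIntertwining' g) x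

include hunit T hfix in
-- Right invariance is the invariance of f; left invariance follows from it by unitarity; the
-- trivial central character is carried over from the principal series by T.
theorem isSpherical_matrixCoeff : IsSpherical (matrixCoeff ρ f) where
  left k g h₁ h₂ := by
    have hk := apply_eq_self_of_fixed hfix k h₁ h₂
    simp only [matrixCoeff, map_mul, Module.End.mul_apply]
    congr 1
    conv_lhs => rw [← hk]
    rw [hunit, hk]
  right k g h₁ h₂ := by
    have hk := apply_eq_self_of_fixed hfix k h₁ h₂
    simp only [matrixCoeff, map_mul, Module.End.mul_apply, hk]
  scalar g g' z h := by
    have : ρ g f = ρ g' f := by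
      apply EquivLike.injective T
      rw [equiv_apply, equiv_apply, principalSeriesRep_scalar _ g g' z h]
    simp only [matrixCoeff, this]

include T hfix in
-- T f is a fixed vector of the principal series, so f itself is an eigenvector of the Hecke
-- operator. Applying ρ(g) and pairing with f gives the relation at g.
theorem matrixCoeff_hecke (hα : α ≠ 0) (g : GL (Fin 2) ℚ_[p]) :
    ∑ j ∈ Finset.range p, matrixCoeff ρ f (g * heckeRep p j)
        + matrixCoeff ρ f (g * diagPow p 1)
      = heckeEigenvalue p α * matrixCoeff ρ f g := by
  have key : ∑ j ∈ Finset.range p, ρ (heckeRep p j) f + ρ (diagPow p 1) f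
      = heckeEigenvalue p α • f := by
    apply EquivLike.injective T
    rw [map_add, map_sum, map_smul]
    simp only [equiv_apply]
    ext x
    have := principalSeries_hecke hα (T f) (fun k x h₁ h₂ => by
      conv_rhs => rw [← apply_eq_self_of_fixed hfix k h₁ h₂, equiv_apply]
      rfl) x
    rw [Submodule.coe_add, Submodule.coe_sum, Pi.add_apply, Finset.sum_apply]
    exact this
  simp only [matrixCoeff, map_mul, Module.End.mul_apply]
  rw [← Finset.sum_div, ← add_div, ← inner_sum, ← inner_add_right, ← map_sum, ← map_add, key,
    map_smul, inner_smul_right, mul_div_assoc]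

include hunit in
theorem matrixCoeff_inv (g : GL (Fin 2) ℚ_[p]) :
    matrixCoeff ρ f g⁻¹ = (starRingEnd ℂ) (matrixCoeff ρ f g) := by
  have : inner ℂ f (ρ g⁻¹ f) = inner ℂ (ρ g f) f := by
    rw [← hunit g, ← Module.End.mul_apply, ← map_mul, mul_inv_cancel, map_one,
      Module.End.one_apply]
  rw [matrixCoeff, matrixCoeff, this, map_div₀, inner_conj_symm, inner_conj_symm]

include hunit in
theorem norm_matrixCoeff_le (hf : f ≠ 0) (g : GL (Fin 2) ℚ_[p]) : ‖matrixCoeff ρ f g‖ ≤ 1 := by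
  have hpos : 0 < ‖f‖ := norm_pos_iff.2 hf
  have hn : ‖ρ g f‖ = ‖f‖ := by
    have := hunit g f f
    rw [inner_self_eq_norm_sq_to_K, inner_self_eq_norm_sq_to_K] at this
    have h2 : ‖ρ g f‖ ^ 2 = ‖f‖ ^ 2 := by exact_mod_cast this
    exact (pow_left_inj₀ (norm_nonneg _) (norm_nonneg _) two_ne_zero).1 h2
  rw [matrixCoeff, norm_div, inner_self_eq_norm_sq_to_K, div_le_one (by
    rw [norm_pow, RCLike.norm_ofReal, abs_norm]; exact pow_pos hpos 2)]
  refine (norm_inner_le_norm f (ρ g f)).trans ?_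
  rw [hn]
  simp [sq]

theorem norm_prime_pow (n : ℕ) : ‖(p : ℚ_[p]) ^ n‖ = (p : ℝ) ^ (-(n : ℤ)) := by
  rw [norm_pow, Padic.norm_p, zpow_neg, zpow_natCast, inv_pow]

theorem entryNorm_eq_one_of_one {g : Matrix (Fin 2) (Fin 2) ℚ_[p]} (h : entryNorm g ≤ 1)
    (h' : g 1 1 = 1) : entryNorm g = 1 := by
  refine le_antisymm h ?_
  rw [← norm_one (α := ℚ_[p]), ← h']
  exact (entryNorm_le_iff.1 le_rfl).2.2

include hunit T hfix in
-- The Hecke relation at 1 and at diag(p^{n+1}, 1), evaluated through the Cartan decomposition,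
-- yields the value X 1 and the recurrence.
theorem isSphericalSequence_matrixCoeff (hα : α ≠ 0) (hf : f ≠ 0) :
    IsSphericalSequence p α fun n => matrixCoeff ρ f (diagPow p n) := by
  have hS := isSpherical_matrixCoeff hunit T hfix
  have hp := prime_cast_pos (p := p)
  have hp1 : ((p : ℝ)⁻¹) ≤ 1 := inv_le_one_of_one_le₀ one_lt_prime_cast.le
  have hd1 : ‖(diagPow p 1 : Matrix (Fin 2) (Fin 2) ℚ_[p]).det‖ = (p : ℝ)⁻¹ := by
    simp [coe_diagPow, Matrix.det_fin_two]
  refine ⟨?_, ?_, fun n => ?_, ?_, norm_matrixCoeff_le hunit hf _⟩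
  · have : diagPow p ((0 : ℕ) : ℤ) = 1 := by
      ext i j
      fin_cases i <;> fin_cases j <;> simp [coe_diagPow]
    simp only [this, matrixCoeff, map_one, Module.End.one_apply]
    exact div_self (inner_self_ne_zero.2 hf)
  · have h := matrixCoeff_hecke T hfix hα 1
    have h1 : matrixCoeff ρ f 1 = 1 := by
      simp only [matrixCoeff, map_one, Module.End.one_apply]
      exact div_self (inner_self_ne_zero.2 hf)
    have hj : ∀ j ∈ Finset.range p, matrixCoeff ρ f (1 * heckeRep p j)
        = matrixCoeff ρ f (diagPow p (1 : ℕ)) := by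
      intro j _
      rw [one_mul]
      apply hS.eq_diagPow
      rw [entryNorm_eq_one_of_one]
      · simp [coe_heckeRep, Matrix.det_fin_two]
      · simp [coe_heckeRep, entryNorm_le_iff, hp1, norm_natCast_le_one]
      · simp [coe_heckeRep]
    rw [Finset.sum_congr rfl hj, h1, mul_one, one_mul, Finset.sum_const, Finset.card_range,
      nsmul_eq_mul] at h
    rw [← h]
    push_cast
    ring
  -- The power of p is put in the upper left corner: then all p products with `heckeRep` have lower
  -- right entry 1 and lead uniformly to n + 2, while the product with diag(1, p) is p · diag(p^n,
  -- 1) and leads back to n.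
  · let g : GL (Fin 2) ℚ_[p] := mkGL ((p : ℚ_[p]) ^ (n + 1)) 0 0 1
      (by
        rw [mul_one, mul_zero, sub_zero]
        exact pow_ne_zero _ (padic_prime_ne_zero (p := p)))
    have hpow : ∀ m : ℕ, ‖(p : ℚ_[p]) ^ m‖ ≤ 1 := fun m => by
      rw [norm_pow, Padic.norm_p]
      exact pow_le_one₀ (by positivity) hp1
    have h := matrixCoeff_hecke T hfix hα g
    have hg : matrixCoeff ρ f g = matrixCoeff ρ f (diagPow p (n + 1 : ℕ)) := by
      apply hS.eq_diagPow
      rw [entryNorm_eq_one_of_one]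
      · rw [← norm_prime_pow]
        simp [g, Matrix.det_fin_two]
      · simpa [g, entryNorm_le_iff] using hpow (n + 1)
      · simp [g]
    have hj : ∀ j ∈ Finset.range p, matrixCoeff ρ f (g * heckeRep p j)
        = matrixCoeff ρ f (diagPow p (n + 2 : ℕ)) := by
      intro j _
      apply hS.eq_diagPow
      have e : ((g * heckeRep p j : GL (Fin 2) ℚ_[p]) : Matrix (Fin 2) (Fin 2) ℚ_[p])
          = !![(p : ℚ_[p]) ^ (n + 2), p ^ (n + 1) * j; 0, 1] := by
        ext i j
        fin_cases i <;> fin_cases j <;> simp [g, coe_heckeRep]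
        ring
      rw [e, entryNorm_eq_one_of_one]
      · rw [← norm_prime_pow]
        simp [Matrix.det_fin_two]
      · have h1 : ‖(p : ℚ_[p]) ^ (n + 1) * j‖ ≤ 1 := by
          rw [norm_mul]
          exact mul_le_one₀ (hpow _) (norm_nonneg _) (norm_natCast_le_one j)
        have h2 := hpow (n + 2)
        rw [entryNorm_le_iff]
        simp only [Matrix.of_apply, Matrix.cons_val', Matrix.cons_val_zero,
          Matrix.cons_val_one, Matrix.cons_val_fin_one, norm_zero, norm_one]
        exact ⟨⟨h2, h1⟩, zero_le_one, le_rfl⟩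
      · simp
    have hinf : matrixCoeff ρ f (g * diagPow p 1) = matrixCoeff ρ f (diagPow p (n : ℕ)) := by
      apply hS.eq_diagPow
      have e : ((g * diagPow p 1 : GL (Fin 2) ℚ_[p]) : Matrix (Fin 2) (Fin 2) ℚ_[p])
          = !![(p : ℚ_[p]) ^ (n + 1), 0; 0, p] := by
        ext i j
        fin_cases i <;> fin_cases j <;> simp [g, coe_diagPow]
      have e2 : entryNorm !![(p : ℚ_[p]) ^ (n + 1), 0; 0, p] = (p : ℝ)⁻¹ := by
        refine le_antisymm ?_ ?_
        · rw [entryNorm_le_iff]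
          have : ‖(p : ℚ_[p]) ^ (n + 1)‖ ≤ (p : ℝ)⁻¹ := by
            rw [pow_succ, norm_mul, Padic.norm_p]
            exact mul_le_of_le_one_left (by positivity) (hpow n)
          simpa [hp.le] using this
        · have := (entryNorm_le_iff.1 (le_refl
            (entryNorm !![(p : ℚ_[p]) ^ (n + 1), 0; 0, (p : ℚ_[p])]))).2.2
          simpa using this
      rw [e, e2, Matrix.det_fin_two_of, mul_zero, sub_zero, norm_mul, norm_prime_pow,
        Padic.norm_p]
      push_cast
      rw [neg_add, zpow_add₀ hp.ne', zpow_neg_one]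
      ring
    rw [Finset.sum_congr rfl hj, hg, hinf, Finset.sum_const, Finset.card_range,
      nsmul_eq_mul] at h
    exact h.symm
  -- Inversion conjugates the coefficient, and diag(1, p)⁻¹ has the same difference of elementary
  -- divisors as diag(1, p); hence X 1 is real.
  · rw [← matrixCoeff_inv hunit]
    apply hS.eq_diagPow
    have e : (((diagPow p (1 : ℕ))⁻¹ : GL (Fin 2) ℚ_[p]) : Matrix (Fin 2) (Fin 2) ℚ_[p])
        = !![1, 0; 0, (p : ℚ_[p])⁻¹] := by
      have : (diagPow p (1 : ℕ))⁻¹ = diagPow p (-1) := by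
        rw [inv_eq_iff_mul_eq_one]
        ext i j
        fin_cases i <;> fin_cases j <;> simp [coe_diagPow]
      rw [this, coe_diagPow, zpow_neg_one]
    have e2 : entryNorm !![1, 0; 0, (p : ℚ_[p])⁻¹] = p := by
      have : (1 : ℝ) ≤ p := one_lt_prime_cast.le
      simp [entryNorm, this]
    rw [e, e2, Matrix.det_fin_two_of]
    simp
    field_simp

end SphericalCoefficient

/-! ### Size and generating function of the sequence X -/

section SphericalSequence

variable {p : ℕ} [Fact p.Prime] {α : ℂ} {X : ℕ → ℂ}

/-- The normalized Satake parameter `α / √p`. -/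
def satake (p : ℕ) (α : ℂ) : ℂ := α / (Real.sqrt p : ℂ)

theorem sqrt_prime_ne_zero : (Real.sqrt p : ℂ) ≠ 0 := by
  exact_mod_cast (Real.sqrt_pos.2 (prime_cast_pos (p := p))).ne'

theorem sqrt_prime_sq : (Real.sqrt p : ℂ) ^ 2 = p := by
  have := Real.sq_sqrt (prime_cast_pos (p := p)).le
  exact_mod_cast this

theorem satake_mul_satake_inv (hα : α ≠ 0) : satake p α * satake p α⁻¹ = (p : ℂ)⁻¹ := by
  have := sqrt_prime_ne_zero (p := p)
  rw [satake, satake, ← sqrt_prime_sq]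
  field_simp

theorem heckeEigenvalue_eq :
    heckeEigenvalue p α = p * (satake p α + satake p α⁻¹) := by
  have := sqrt_prime_ne_zero (p := p)
  rw [heckeEigenvalue, satake, satake, ← sqrt_prime_sq]
  field_simp

theorem satake_sq : satake p α ^ 2 = α ^ 2 * (p : ℂ)⁻¹ := by
  rw [satake, div_pow, sqrt_prime_sq, div_eq_mul_inv]

theorem prime_complex_ne_zero : (p : ℂ) ≠ 0 := by
  exact_mod_cast (Fact.out : p.Prime).ne_zero

theorem one_add_prime_inv_ne_zero : 1 + (p : ℂ)⁻¹ ≠ 0 := by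
  have := prime_cast_pos (p := p)
  have h : (0 : ℝ) < 1 + (p : ℝ)⁻¹ := by positivity
  have h' := Complex.ofReal_ne_zero.2 h.ne'
  push_cast at h'
  exact h'

theorem one_sub_prime_inv_ne_zero : 1 - (p : ℂ)⁻¹ ≠ 0 := by
  have h : (0 : ℝ) < 1 - (p : ℝ)⁻¹ := sub_pos.2 (inv_lt_one_of_one_lt₀ one_lt_prime_cast)
  have h' := Complex.ofReal_ne_zero.2 h.ne'
  push_cast at h'
  exact h'

namespace IsSphericalSequence

variable (hX : IsSphericalSequence p α X)

include hX

theorem apply_one :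
    (1 + (p : ℂ)⁻¹) * X 1 = satake p α + satake p α⁻¹ := by
  have h := hX.one
  rw [heckeEigenvalue_eq] at h
  have := prime_complex_ne_zero (p := p)
  generalize satake p α⁻¹ = β₂ at *
  field_simp
  linear_combination h

theorem apply_add_two (hα : α ≠ 0) (n : ℕ) :
    X (n + 2) = (satake p α + satake p α⁻¹) * X (n + 1)
      - satake p α * satake p α⁻¹ * X n := by
  have h := hX.succ n
  rw [heckeEigenvalue_eq] at h
  have := prime_complex_ne_zero (p := p)
  rw [satake_mul_satake_inv hα]
  generalize satake p α⁻¹ = β₂ at *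
  field_simp
  linear_combination -h

/-- Reality of X 1 makes α + α⁻¹ real, so α is real or |α| = 1. In the real case |X 1| ≤ 1 confines
|α| to [p^{-1/2}, p^{1/2}], and the conditions on α² remove the endpoints. -/
theorem norm_satake_lt_one_aux (hα : α ≠ 0) (hα₁ : α ^ 2 ≠ p) (hα₂ : α ^ 2 ≠ (p : ℂ)⁻¹) :
    ‖α‖ < Real.sqrt p ∧ ‖α‖⁻¹ < Real.sqrt p := by
  have hp := prime_cast_pos (p := p)
  set q := Real.sqrt p with hq
  have hq2 : q ^ 2 = p := Real.sq_sqrt hp.le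
  have hq1 : 1 < q := by
    rw [hq, Real.lt_sqrt zero_le_one, one_pow]; exact one_lt_prime_cast
  have hq0 : 0 < q := one_pos.trans hq1
  have h1 := hX.one
  have hreal : (starRingEnd ℂ) (α + α⁻¹) = α + α⁻¹ := by
    have h2 := congrArg (starRingEnd ℂ) h1
    rw [map_mul, hX.real, map_add, map_natCast, map_one, h1, heckeEigenvalue, map_mul,
      Complex.conj_ofReal] at h2
    exact (mul_left_cancel₀ (sqrt_prime_ne_zero (p := p)) h2).symm
  have hle : q * ‖α + α⁻¹‖ ≤ q ^ 2 + 1 := by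
    have h2 := congrArg norm h1
    rw [heckeEigenvalue, norm_mul, norm_mul, Complex.norm_real, Real.norm_of_nonneg hq0.le] at h2
    rw [← h2]
    have h3 : ‖(p : ℂ) + 1‖ = q ^ 2 + 1 := by
      rw [hq2]
      have : ((p : ℂ) + 1) = ((p + 1 : ℕ) : ℂ) := by push_cast; rfl
      rw [this, Complex.norm_natCast]
      push_cast; rfl
    rw [h3]
    exact mul_le_of_le_one_right (by positivity) hX.norm_le
  have hcα : (starRingEnd ℂ) α ≠ 0 := by simpa using hα
  have hcases : (starRingEnd ℂ) α = α ∨ α * (starRingEnd ℂ) α = 1 := by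
    rw [map_add, map_inv₀] at hreal
    -- Equality of α + α⁻¹ with its conjugate, cleared of denominators, factors in this way.
    have : ((starRingEnd ℂ) α - α) * (α * (starRingEnd ℂ) α - 1) = 0 := by
      field_simp at hreal
      linear_combination hreal
    rcases mul_eq_zero.1 this with h | h
    · exact Or.inl (sub_eq_zero.1 h)
    · exact Or.inr (sub_eq_zero.1 h)
  rcases hcases with h | h
  · obtain ⟨a, ha⟩ := Complex.conj_eq_iff_real.1 h
    subst ha
    have ha0 : a ≠ 0 := by exact_mod_cast hα
    have hpos : 0 < |a| := abs_pos.2 ha0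
    have e : ‖(a : ℂ) + (a : ℂ)⁻¹‖ = |a| + |a|⁻¹ := by
      rw [← Complex.ofReal_inv, ← Complex.ofReal_add, Complex.norm_real, Real.norm_eq_abs,
        ← abs_inv]
      rcases ha0.lt_or_gt with hn | hn
      · exact abs_add_eq_add_abs_iff _ _ |>.2 (Or.inr ⟨hn.le, (inv_lt_zero.2 hn).le⟩)
      · exact abs_add_eq_add_abs_iff _ _ |>.2 (Or.inl ⟨hn.le, (inv_pos.2 hn).le⟩)
    rw [e] at hle
    rw [Complex.norm_real, Real.norm_eq_abs]
    set t := |a|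
    have ht2 : t ^ 2 = a ^ 2 := sq_abs a
    -- This is q(t + t⁻¹) ≤ q² + 1 multiplied by t; the quadratic polynomial in t has the roots q
    -- and 1/q.
    have key : (t - q) * (q * t - 1) ≤ 0 := by
      have : q * (t + t⁻¹) * t ≤ (q ^ 2 + 1) * t := mul_le_mul_of_nonneg_right hle hpos.le
      have e2 : q * (t + t⁻¹) * t = q * t ^ 2 + q := by field_simp
      rw [e2] at this
      nlinarith
    have hne1 : t ≠ q := by
      intro h0
      apply hα₁
      have : a ^ 2 = p := by rw [← ht2, h0, hq2]
      exact_mod_cast this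
    have hne2 : q * t ≠ 1 := by
      intro h0
      apply hα₂
      have : a ^ 2 = (p : ℝ)⁻¹ := by
        refine eq_inv_of_mul_eq_one_left ?_
        rw [← ht2, ← hq2, mul_comm, ← mul_pow, h0, one_pow]
      have h3 : ((a ^ 2 : ℝ) : ℂ) = (((p : ℝ)⁻¹ : ℝ) : ℂ) := by rw [this]
      push_cast at h3
      exact h3
    rw [inv_lt_iff_one_lt_mul₀ hpos]
    by_contra hcon
    rcases lt_or_gt_of_ne hne1 with h1 | h1
    · rcases lt_or_gt_of_ne hne2 with h2 | h2
      · have := mul_pos_of_neg_of_neg (sub_neg.2 h1) (sub_neg.2 h2)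
        linarith
      · exact hcon ⟨h1, h2⟩
    · have h2 : 0 < q * t - 1 := by nlinarith
      have := mul_pos (sub_pos.2 h1) h2
      linarith
  · have : ‖α‖ = 1 := by
      have h2 := congrArg norm h
      rw [norm_mul, Complex.norm_conj, norm_one] at h2
      nlinarith [norm_nonneg α]
    rw [this]
    simpa using hq1

theorem norm_satake_lt_one (hα : α ≠ 0) (hα₁ : α ^ 2 ≠ p) (hα₂ : α ^ 2 ≠ (p : ℂ)⁻¹) :
    ‖satake p α‖ < 1 ∧ ‖satake p α⁻¹‖ < 1 := by
  have hq : 0 < Real.sqrt p := Real.sqrt_pos.2 (prime_cast_pos (p := p))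
  have h := hX.norm_satake_lt_one_aux hα hα₁ hα₂
  simp only [satake, norm_div, norm_inv, Complex.norm_real, Real.norm_of_nonneg hq.le,
    div_lt_one hq]
  exact h

/-- The two roots may coincide, in which case X n involves n β₁^n; a rate r strictly larger than
both absolute values covers every case. -/
theorem exists_bound (hα : α ≠ 0) (hα₁ : α ^ 2 ≠ p) (hα₂ : α ^ 2 ≠ (p : ℂ)⁻¹) :
    ∃ C r : ℝ, 0 ≤ C ∧ 0 ≤ r ∧ r < 1 ∧ ∀ n, ‖X n‖ ≤ C * r ^ n := by
  obtain ⟨h₁, h₂⟩ := hX.norm_satake_lt_one hα hα₁ hα₂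
  set β₁ := satake p α
  set β₂ := satake p α⁻¹
  obtain ⟨r, hr, hr1⟩ := exists_between (max_lt h₁ h₂)
  rw [max_lt_iff] at hr
  have hr0 : 0 ≤ r := (norm_nonneg _).trans hr.1.le
  -- Removing the root β₁ from the recurrence leaves a geometric sequence of ratio β₂.
  have hu : ∀ n, X (n + 1) - β₁ * X n = β₂ ^ n * (X 1 - β₁ * X 0) := by
    intro n
    induction n with
    | zero => simp
    | succ n ih =>
      rw [pow_succ', mul_assoc, ← ih, hX.apply_add_two hα]
      ring
  set D := ‖X 1 - β₁ * X 0‖ with hD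
  have hpos : 0 < r - ‖β₁‖ := sub_pos.2 hr.1
  -- The term 1 starts the induction at X 0 = 1, and D / (r - |β₁|) makes |β₁| C + D ≤ C r in its
  -- step.
  refine ⟨max 1 (D / (r - ‖β₁‖)), r, by positivity, hr0, hr1, fun n => ?_⟩
  induction n with
  | zero => simp [hX.zero]
  | succ n ih =>
    set C := max 1 (D / (r - ‖β₁‖))
    have hC : D ≤ C * (r - ‖β₁‖) := (div_le_iff₀ hpos).1 (le_max_right _ _)
    have e : X (n + 1) = β₁ * X n + β₂ ^ n * (X 1 - β₁ * X 0) := by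
      rw [← hu]; ring
    calc ‖X (n + 1)‖ ≤ ‖β₁‖ * ‖X n‖ + ‖β₂‖ ^ n * D := by
          rw [e, hD, ← norm_mul, ← norm_pow, ← norm_mul]
          exact norm_add_le _ _
      _ ≤ ‖β₁‖ * (C * r ^ n) + r ^ n * (C * (r - ‖β₁‖)) := by
          gcongr
          exact hr.2.le
      _ = C * r ^ (n + 1) := by ring

theorem summable_mul_pow (hα : α ≠ 0) (hα₁ : α ^ 2 ≠ p) (hα₂ : α ^ 2 ≠ (p : ℂ)⁻¹)
    {z : ℂ} (hz : ‖z‖ = 1) : Summable fun n => X n * z ^ n := by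
  obtain ⟨C, r, hC, hr, hr1, h⟩ := hX.exists_bound hα hα₁ hα₂
  refine Summable.of_norm_bounded ((summable_geometric_of_lt_one hr hr1).mul_left C) fun n => ?_
  rw [norm_mul, norm_pow, hz, one_pow, mul_one]
  exact h n

theorem one_sub_satake_mul_ne_zero (hα : α ≠ 0) (hα₁ : α ^ 2 ≠ p) (hα₂ : α ^ 2 ≠ (p : ℂ)⁻¹)
    {z : ℂ} (hz : ‖z‖ ≤ 1) : 1 - satake p α * z ≠ 0 ∧ 1 - satake p α⁻¹ * z ≠ 0 := by
  obtain ⟨h₁, h₂⟩ := hX.norm_satake_lt_one hα hα₁ hα₂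
  constructor
  all_goals
    intro h
    have h2 := congrArg norm (sub_eq_zero.1 h)
    rw [norm_one, norm_mul] at h2
    have := mul_le_of_le_one_right (norm_nonneg (satake p α)) hz
    have := mul_le_of_le_one_right (norm_nonneg (satake p α⁻¹)) hz
    linarith

theorem one_sub_satake_sq_ne_zero (hα : α ≠ 0) (hα₁ : α ^ 2 ≠ p) (hα₂ : α ^ 2 ≠ (p : ℂ)⁻¹) :
    1 - satake p α ^ 2 ≠ 0 ∧ 1 - satake p α⁻¹ ^ 2 ≠ 0 := by
  obtain ⟨h₁, h₂⟩ := hX.norm_satake_lt_one hα hα₁ hα₂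
  rw [sq, sq]
  exact ⟨(hX.one_sub_satake_mul_ne_zero hα hα₁ hα₂ h₁.le).1,
    (hX.one_sub_satake_mul_ne_zero hα hα₁ hα₂ h₂.le).2⟩

/-- The generating function of the values of the spherical function. -/
theorem hasSum_mul_pow (hα : α ≠ 0) (hα₁ : α ^ 2 ≠ p) (hα₂ : α ^ 2 ≠ (p : ℂ)⁻¹)
    {z : ℂ} (hz : ‖z‖ = 1) :
    HasSum (fun n => X n * z ^ n)
      ((1 + (p : ℂ)⁻¹ - (satake p α + satake p α⁻¹) * (p : ℂ)⁻¹ * z) /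
        ((1 + (p : ℂ)⁻¹) * ((1 - satake p α * z) * (1 - satake p α⁻¹ * z)))) := by
  have hs := hX.summable_mul_pow hα hα₁ hα₂ hz
  obtain ⟨h₁, h₂⟩ := hX.one_sub_satake_mul_ne_zero hα hα₁ hα₂ hz.le
  have hc := one_add_prime_inv_ne_zero (p := p)
  have h1 := hX.apply_one
  have hcc := satake_mul_satake_inv (p := p) hα
  convert hs.hasSum using 1
  rw [div_eq_iff (mul_ne_zero hc (mul_ne_zero h₁ h₂))]
  set S := ∑' n, X n * z ^ n with hS
  -- Splitting off two terms and summing the recurrence gives a linear equation for S.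
  have e1 : S = 1 + ∑' n, X (n + 1) * z ^ (n + 1) := by
    rw [hS, hs.tsum_eq_zero_add, hX.zero]
    simp
  have hs1 : Summable fun n => X (n + 1) * z ^ (n + 1) := (summable_nat_add_iff 1).2 hs
  have e2 : ∑' n, X (n + 1) * z ^ (n + 1) = X 1 * z + ∑' n, X (n + 2) * z ^ (n + 2) := by
    rw [hs1.tsum_eq_zero_add]
    simp
  have e3 : ∑' n, X (n + 2) * z ^ (n + 2)
      = (satake p α + satake p α⁻¹) * z * (∑' n, X (n + 1) * z ^ (n + 1))
        - (satake p α * satake p α⁻¹) * z ^ 2 * S := by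
    rw [hS, ← tsum_mul_left, ← tsum_mul_left, ← (hs1.mul_left _).tsum_sub (hs.mul_left _)]
    refine tsum_congr fun n => ?_
    rw [hX.apply_add_two hα]
    ring
  set S₁ := ∑' n, X (n + 1) * z ^ (n + 1)
  rw [e3] at e2
  set β₁ := satake p α
  set β₂ := satake p α⁻¹
  rw [← hcc] at h1 ⊢
  linear_combination (- (1 + β₁ * β₂) * (1 - (β₁ + β₂) * z)) * e1 - (1 + β₁ * β₂) * e2 - z * h1

end IsSphericalSequence

end SphericalSequence

section LocalArithmetic

/-! ### Orders in quadratic algebras over `ℚ_p` -/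

/-- The quadratic `ℚ_p`-algebra generated by `ω` with `ω² = a + b ω`. -/
abbrev LocalAlg (p : ℕ) [Fact p.Prime] (a b : ℤ) : Type :=
  QuadraticAlgebra ℚ_[p] (a : ℚ_[p]) (b : ℚ_[p])

variable {p : ℕ} [Fact p.Prime] {a b : ℤ}

theorem norm_add_le_of_le {x y : ℚ_[p]} {r : ℝ} (hx : ‖x‖ ≤ r) (hy : ‖y‖ ≤ r) : ‖x + y‖ ≤ r :=
  (Padic.nonarchimedean x y).trans (max_le hx hy)

theorem norm_sub_le_of_le {x y : ℚ_[p]} {r : ℝ} (hx : ‖x‖ ≤ r) (hy : ‖y‖ ≤ r) : ‖x - y‖ ≤ r := by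
  rw [sub_eq_add_neg]
  exact norm_add_le_of_le hx (by rwa [norm_neg])

theorem norm_add_lt_of_lt {x y : ℚ_[p]} {r : ℝ} (hx : ‖x‖ < r) (hy : ‖y‖ < r) : ‖x + y‖ < r :=
  (Padic.nonarchimedean x y).trans_lt (max_lt hx hy)

theorem norm_sub_lt_of_lt {x y : ℚ_[p]} {r : ℝ} (hx : ‖x‖ < r) (hy : ‖y‖ < r) : ‖x - y‖ < r := by
  rw [sub_eq_add_neg]
  exact norm_add_lt_of_lt hx (by rwa [norm_neg])

theorem norm_int_mul_le (n : ℤ) (x : ℚ_[p]) : ‖(n : ℚ_[p]) * x‖ ≤ ‖x‖ := by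
  rw [norm_mul]
  exact mul_le_of_le_one_left (norm_nonneg _) (Padic.norm_int_le_one n)

theorem norm_mul_lt_one_left {x y : ℚ_[p]} (hx : ‖x‖ < 1) (hy : ‖y‖ ≤ 1) : ‖x * y‖ < 1 := by
  rw [norm_mul]
  exact mul_lt_one_of_nonneg_of_lt_one_left (norm_nonneg _) hx hy

theorem norm_eq_of_norm_sub_lt {x y : ℚ_[p]} (h : ‖x - y‖ < ‖y‖) : ‖x‖ = ‖y‖ := by
  have : x = (x - y) + y := by ring
  rw [this, Padic.add_eq_max_of_ne h.ne, max_eq_right h.le]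

theorem one_le_prime_pow (i : ℕ) : (1 : ℝ) ≤ (p : ℝ) ^ i :=
  one_le_pow₀ one_lt_prime_cast.le

/-- The gauge of the order `ℤ_p + p^i ω ℤ_p`. -/
def gauge (i : ℕ) (x : LocalAlg p a b) : ℝ := max ‖x.re‖ ((p : ℝ) ^ i * ‖x.im‖)

theorem gauge_le_iff {i : ℕ} {x : LocalAlg p a b} {r : ℝ} :
    gauge i x ≤ r ↔ ‖x.re‖ ≤ r ∧ (p : ℝ) ^ i * ‖x.im‖ ≤ r := max_le_iff

theorem norm_re_le_gauge (i : ℕ) (x : LocalAlg p a b) : ‖x.re‖ ≤ gauge i x := le_max_left _ _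

theorem pow_mul_norm_im_le_gauge (i : ℕ) (x : LocalAlg p a b) :
    (p : ℝ) ^ i * ‖x.im‖ ≤ gauge i x := le_max_right _ _

theorem norm_im_le_gauge (i : ℕ) (x : LocalAlg p a b) : ‖x.im‖ ≤ gauge i x :=
  (le_mul_of_one_le_left (norm_nonneg _) (one_le_prime_pow i)).trans
    (pow_mul_norm_im_le_gauge i x)

theorem gauge_nonneg (i : ℕ) (x : LocalAlg p a b) : 0 ≤ gauge i x :=
  (norm_nonneg _).trans (norm_re_le_gauge i x)

theorem gauge_mono {i j : ℕ} (h : i ≤ j) (x : LocalAlg p a b) : gauge i x ≤ gauge j x := by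
  refine gauge_le_iff.2 ⟨norm_re_le_gauge j x, le_trans ?_ (pow_mul_norm_im_le_gauge j x)⟩
  exact mul_le_mul_of_nonneg_right (pow_le_pow_right₀ one_lt_prime_cast.le h) (norm_nonneg _)

/-- The lattice ℤ_p + p^i ω ℤ_p is a ring: a and b are integers, and p^i |im| bounds |im|, so every
term of the product formula is controlled. -/
theorem gauge_mul_le (i : ℕ) (x y : LocalAlg p a b) :
    gauge i (x * y) ≤ gauge i x * gauge i y := by
  have hx := norm_re_le_gauge i x
  have hy := norm_re_le_gauge i y
  have hx' := pow_mul_norm_im_le_gauge i x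
  have hy' := pow_mul_norm_im_le_gauge i y
  have hx'' := norm_im_le_gauge i x
  have hy'' := norm_im_le_gauge i y
  have h0 := gauge_nonneg i x
  have hp := one_le_prime_pow (p := p) i
  rw [gauge_le_iff, QuadraticAlgebra.re_mul, QuadraticAlgebra.im_mul]
  constructor
  · refine norm_add_le_of_le ?_ ?_
    · rw [norm_mul]; gcongr
    · rw [mul_assoc]
      refine (norm_int_mul_le _ _).trans ?_
      rw [norm_mul]; gcongr
  · have key : ∀ w : ℚ_[p], ‖w‖ ≤ gauge i x * gauge i y / (p : ℝ) ^ i →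
        (p : ℝ) ^ i * ‖w‖ ≤ gauge i x * gauge i y := fun w hw => by
      rwa [le_div_iff₀ (by positivity), mul_comm] at hw
    apply key
    refine norm_add_le_of_le (norm_add_le_of_le ?_ ?_) ?_
    · rw [norm_mul, le_div_iff₀ (by positivity)]
      calc ‖x.re‖ * ‖y.im‖ * (p : ℝ) ^ i = ‖x.re‖ * ((p : ℝ) ^ i * ‖y.im‖) := by ring
        _ ≤ _ := by gcongr
    · rw [norm_mul, le_div_iff₀ (by positivity)]
      calc ‖x.im‖ * ‖y.re‖ * (p : ℝ) ^ i = ((p : ℝ) ^ i * ‖x.im‖) * ‖y.re‖ := by ring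
        _ ≤ _ := by gcongr
    · rw [mul_assoc]
      refine (norm_int_mul_le _ _).trans ?_
      rw [norm_mul, le_div_iff₀ (by positivity)]
      calc ‖x.im‖ * ‖y.im‖ * (p : ℝ) ^ i = ((p : ℝ) ^ i * ‖x.im‖) * ‖y.im‖ := by ring
        _ ≤ _ := by gcongr

theorem gauge_smul (i : ℕ) (c : ℚ_[p]) (x : LocalAlg p a b) :
    gauge i (c • x) = ‖c‖ * gauge i x := by
  simp only [gauge, QuadraticAlgebra.re_smul, QuadraticAlgebra.im_smul, smul_eq_mul, norm_mul]
  rw [mul_max_of_nonneg _ _ (norm_nonneg _)]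
  ring_nf

theorem gauge_star_le (i : ℕ) (x : LocalAlg p a b) : gauge i (star x) ≤ gauge i x := by
  rw [gauge_le_iff, QuadraticAlgebra.re_star, QuadraticAlgebra.im_star, norm_neg]
  refine ⟨norm_add_le_of_le (norm_re_le_gauge i x) ?_, pow_mul_norm_im_le_gauge i x⟩
  exact (norm_int_mul_le _ _).trans (norm_im_le_gauge i x)

theorem gauge_star (i : ℕ) (x : LocalAlg p a b) : gauge i (star x) = gauge i x := by
  refine le_antisymm (gauge_star_le i x) ?_
  conv_lhs => rw [← star_star x]
  exact gauge_star_le i _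

/-- Each term of re² + b re im - a im² is bounded by the squared gauge. Units attaining equality are
the scalar multiples of units of the order, hence the form of `orderStab`. -/
theorem norm_norm_le (i : ℕ) (x : LocalAlg p a b) : ‖x.norm‖ ≤ gauge i x ^ 2 := by
  have h1 := norm_re_le_gauge i x
  have h2 := norm_im_le_gauge i x
  have h0 := gauge_nonneg i x
  rw [QuadraticAlgebra.norm_def, sq]
  refine norm_sub_le_of_le (norm_add_le_of_le ?_ ?_) ?_
  · rw [norm_mul]; gcongr
  · rw [mul_assoc]
    refine (norm_int_mul_le _ _).trans ?_
    rw [norm_mul]; gcongr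
  · rw [mul_assoc]
    refine (norm_int_mul_le _ _).trans ?_
    rw [norm_mul]; gcongr

/-- The gauge takes values in |ℚ_p|, so units can be rescaled to gauge one. -/
theorem exists_norm_eq_gauge (i : ℕ) (x : LocalAlg p a b) : ∃ y : ℚ_[p], ‖y‖ = gauge i x := by
  rcases max_choice ‖x.re‖ ((p : ℝ) ^ i * ‖x.im‖) with h | h
  · exact ⟨x.re, h.symm⟩
  · refine ⟨x.im / (p : ℚ_[p]) ^ i, ?_⟩
    rw [gauge, h, norm_div, norm_pow, Padic.norm_p, inv_pow, div_inv_eq_mul, mul_comm]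

theorem unit_norm_ne_zero (s : (LocalAlg p a b)ˣ) : (s : LocalAlg p a b).norm ≠ 0 :=
  (QuadraticAlgebra.isUnit_iff_norm_isUnit.1 s.isUnit).ne_zero

theorem unit_gauge_pos (i : ℕ) (s : (LocalAlg p a b)ˣ) : 0 < gauge i (s : LocalAlg p a b) := by
  rcases (gauge_nonneg i (s : LocalAlg p a b)).lt_or_eq with h | h
  · exact h
  · have h1 := norm_norm_le i (s : LocalAlg p a b)
    rw [← h] at h1
    have h2 := norm_pos_iff.2 (unit_norm_ne_zero s)
    norm_num at h1
    exact absurd h1 (unit_norm_ne_zero s)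

theorem unit_inv_eq (s : (LocalAlg p a b)ˣ) :
    ((s⁻¹ : (LocalAlg p a b)ˣ) : LocalAlg p a b)
      = (s : LocalAlg p a b).norm⁻¹ • star (s : LocalAlg p a b) := by
  have h := unit_norm_ne_zero s
  apply Units.inv_eq_of_mul_eq_one_right
  rw [mul_smul_comm, ← QuadraticAlgebra.algebraMap_norm_eq_mul_star, Algebra.smul_def, ← map_mul,
    inv_mul_cancel₀ h, map_one]

theorem gauge_inv (i : ℕ) (s : (LocalAlg p a b)ˣ) :
    gauge i ((s⁻¹ : (LocalAlg p a b)ˣ) : LocalAlg p a b)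
      = gauge i (s : LocalAlg p a b) / ‖(s : LocalAlg p a b).norm‖ := by
  rw [unit_inv_eq, gauge_smul, gauge_star, norm_inv, div_eq_inv_mul]

theorem norm_norm_inv (s : (LocalAlg p a b)ˣ) :
    ‖((s⁻¹ : (LocalAlg p a b)ˣ) : LocalAlg p a b).norm‖ = ‖(s : LocalAlg p a b).norm‖⁻¹ := by
  refine eq_inv_of_mul_eq_one_left ?_
  rw [← norm_mul, ← map_mul, Units.inv_mul, map_one, norm_one]

theorem norm_norm_mul (s t : (LocalAlg p a b)ˣ) :
    ‖((s * t : (LocalAlg p a b)ˣ) : LocalAlg p a b).norm‖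
      = ‖(s : LocalAlg p a b).norm‖ * ‖(t : LocalAlg p a b).norm‖ := by
  rw [Units.val_mul, map_mul, norm_mul]

/-- The group `ℚ_p^× (ℤ_p + p^i ω ℤ_p)^×`, described as the group of the units whose norm is as
large as the gauge permits. -/
def orderStab (p : ℕ) [Fact p.Prime] (a b : ℤ) (i : ℕ) : Subgroup (LocalAlg p a b)ˣ where
  carrier := {s | ‖(s : LocalAlg p a b).norm‖ = gauge i (s : LocalAlg p a b) ^ 2}
  one_mem' := by simp [gauge, QuadraticAlgebra.re_one, QuadraticAlgebra.im_one]
  mul_mem' := by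
    intro s t hs ht
    refine le_antisymm (norm_norm_le _ _) ?_
    rw [norm_norm_mul, hs, ht, ← mul_pow]
    exact pow_le_pow_left₀ (gauge_nonneg _ _) (gauge_mul_le _ _ _) 2
  inv_mem' := by
    intro s hs
    have h := norm_ne_zero_iff.2 (unit_norm_ne_zero s)
    change _ = _
    rw [norm_norm_inv, gauge_inv, div_pow, ← hs, sq]
    field_simp

theorem mem_orderStab {i : ℕ} {s : (LocalAlg p a b)ˣ} : s ∈ orderStab p a b i ↔
    ‖(s : LocalAlg p a b).norm‖ = gauge i (s : LocalAlg p a b) ^ 2 := Iff.rfl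

theorem mem_orderStab_of_le {i : ℕ} {s : (LocalAlg p a b)ˣ}
    (h : gauge i (s : LocalAlg p a b) ^ 2 ≤ ‖(s : LocalAlg p a b).norm‖) :
    s ∈ orderStab p a b i := le_antisymm (norm_norm_le _ _) h

theorem orderStab_anti : Antitone (orderStab p a b) := by
  intro i j hij s hs
  apply mem_orderStab_of_le
  rw [mem_orderStab.1 hs]
  exact pow_le_pow_left₀ (gauge_nonneg _ _) (gauge_mono hij _) 2

/-- Writing x as u⁻¹(ux) and bounding the gauge of u⁻¹ turns submultiplicativity into equality. -/
theorem gauge_mul_of_mem {i : ℕ} {u : (LocalAlg p a b)ˣ} (hu : u ∈ orderStab p a b i)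
    (x : LocalAlg p a b) :
    gauge i ((u : LocalAlg p a b) * x) = gauge i (u : LocalAlg p a b) * gauge i x := by
  refine le_antisymm (gauge_mul_le _ _ _) ?_
  have h := unit_gauge_pos i u
  have h1 := gauge_mul_le i ((u⁻¹ : (LocalAlg p a b)ˣ) : LocalAlg p a b) ((u : LocalAlg p a b) * x)
  rw [Units.inv_mul_cancel_left, gauge_inv, mem_orderStab.1 hu] at h1
  calc _ ≤ gauge i (u : LocalAlg p a b) * (gauge i (u : LocalAlg p a b) /
        gauge i (u : LocalAlg p a b) ^ 2 * gauge i ((u : LocalAlg p a b) * x)) := by gcongr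
    _ = _ := by field_simp

/-- Once s is rescaled to gauge one its norm is integral, and n is the valuation of that norm. -/
theorem exists_relativePosition (i : ℕ) (s : (LocalAlg p a b)ˣ) :
    ∃ n : ℕ, ‖(s : LocalAlg p a b).norm‖
      = (p : ℝ) ^ (-(n : ℤ)) * gauge i (s : LocalAlg p a b) ^ 2 := by
  have hpos := unit_gauge_pos i s
  obtain ⟨y, hy⟩ := exists_norm_eq_gauge i (s : LocalAlg p a b)
  have hy0 : y ≠ 0 := norm_pos_iff.1 (hy ▸ hpos)
  have hle := norm_norm_le i (s : LocalAlg p a b)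
  obtain ⟨n, hn⟩ := exists_norm_eq_zpow (div_ne_zero (unit_norm_ne_zero s) (pow_ne_zero 2 hy0))
  have h1 : ‖(s : LocalAlg p a b).norm / y ^ 2‖ ≤ 1 := by
    rw [norm_div, norm_pow, hy]
    exact (div_le_one (by positivity)).2 hle
  have hn0 : 0 ≤ n := by
    rw [hn] at h1
    by_contra! hneg
    exact absurd h1 (not_le.2 (one_lt_zpow₀ one_lt_prime_cast (by omega)))
  lift n to ℕ using hn0
  refine ⟨n, ?_⟩
  rw [← hn, norm_div, norm_pow, hy, div_mul_cancel₀]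
  positivity

/-- The relative position of the lattices `s 𝒪` and `𝒪`, for `𝒪 = ℤ_p + p^i ω ℤ_p`. -/
def relativePosition (i : ℕ) (s : (LocalAlg p a b)ˣ) : ℕ := (exists_relativePosition i s).choose

theorem relativePosition_spec (i : ℕ) (s : (LocalAlg p a b)ˣ) :
    ‖(s : LocalAlg p a b).norm‖
      = (p : ℝ) ^ (-(relativePosition i s : ℤ)) * gauge i (s : LocalAlg p a b) ^ 2 :=
  (exists_relativePosition i s).choose_spec

theorem relativePosition_eq {i : ℕ} {s : (LocalAlg p a b)ˣ} {n : ℕ}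
    (h : ‖(s : LocalAlg p a b).norm‖
      = (p : ℝ) ^ (-(n : ℤ)) * gauge i (s : LocalAlg p a b) ^ 2) :
    relativePosition i s = n := by
  have h1 := relativePosition_spec i s
  have hpos := pow_pos (unit_gauge_pos i s) 2
  rw [h] at h1
  have h2 := zpow_right_injective₀ prime_cast_pos one_lt_prime_cast.ne'
    (mul_right_cancel₀ hpos.ne' h1)
  omega

theorem relativePosition_eq_zero_iff {i : ℕ} {s : (LocalAlg p a b)ˣ} :
    relativePosition i s = 0 ↔ s ∈ orderStab p a b i := by
  constructor
  · intro h
    have := relativePosition_spec i s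
    rw [h] at this
    rw [mem_orderStab]
    simpa using this
  · intro h
    apply relativePosition_eq
    simpa using mem_orderStab.1 h

theorem relativePosition_mul_left {i : ℕ} {u : (LocalAlg p a b)ˣ} (hu : u ∈ orderStab p a b i)
    (s : (LocalAlg p a b)ˣ) : relativePosition i (u * s) = relativePosition i s := by
  apply relativePosition_eq
  rw [norm_norm_mul, mem_orderStab.1 hu, relativePosition_spec i s, Units.val_mul,
    gauge_mul_of_mem hu]
  ring

theorem relativePosition_inv (i : ℕ) (s : (LocalAlg p a b)ˣ) :
    relativePosition i s⁻¹ = relativePosition i s := by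
  apply relativePosition_eq
  have h := norm_ne_zero_iff.2 (unit_norm_ne_zero s)
  rw [norm_norm_inv, gauge_inv, div_pow, mul_div_assoc', ← relativePosition_spec, sq]
  field_simp

/-- If re dominates p^{i+1} im, then re² dominates the norm and s is a scalar times a unit of the
order. Otherwise |re| < p^{i+1} |im|, which by discreteness of the norm improves to |re| ≤ p^i |im|.
-/
theorem mem_orderStab_succ_or (i : ℕ) (s : (LocalAlg p a b)ˣ) :
    s ∈ orderStab p a b (i + 1) ∨
      ‖(s : LocalAlg p a b).re‖ ≤ (p : ℝ) ^ i * ‖(s : LocalAlg p a b).im‖ := by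
  have hp := prime_cast_pos (p := p)
  set x := (s : LocalAlg p a b) with hx
  rcases le_or_gt ((p : ℝ) ^ (i + 1) * ‖x.im‖) ‖x.re‖ with h | h
  · left
    apply mem_orderStab_of_le
    have hg : gauge (i + 1) x = ‖x.re‖ := max_eq_left h
    have hpos : 0 < ‖x.re‖ := hg ▸ unit_gauge_pos (i + 1) s
    have him : ‖x.im‖ < ‖x.re‖ := by
      rcases (norm_nonneg x.im).lt_or_eq with h0 | h0
      · refine lt_of_lt_of_le ?_ h
        exact lt_mul_of_one_lt_left h0 (one_lt_pow₀ one_lt_prime_cast (by omega))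
      · rwa [← h0]
    rw [hg, ← norm_pow]
    refine (norm_eq_of_norm_sub_lt ?_).ge
    have e : x.norm - x.re ^ 2 = ((b : ℚ_[p]) * x.re - a * x.im) * x.im := by
      rw [QuadraticAlgebra.norm_def]; ring
    have h1 : ‖(b : ℚ_[p]) * x.re - a * x.im‖ ≤ ‖x.re‖ :=
      norm_sub_le_of_le (norm_int_mul_le _ _) ((norm_int_mul_le _ _).trans him.le)
    rw [e, norm_mul, norm_pow, sq]
    exact mul_lt_mul_of_le_of_lt_of_nonneg_of_pos h1 him (norm_nonneg _) hpos
  · right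
    have h2 : ‖x.re‖ < ‖x.im / (p : ℚ_[p]) ^ (i + 1)‖ := by
      rw [norm_div, norm_pow, Padic.norm_p, inv_pow, div_inv_eq_mul, mul_comm]
      exact h
    have h3 := norm_le_div_of_lt h2
    rw [norm_div, norm_pow, Padic.norm_p, inv_pow, div_inv_eq_mul] at h3
    refine h3.trans (le_of_eq ?_)
    rw [pow_succ]
    field_simp

/-- Outside the stabilizer the gauges at levels i and i + 1 are both governed by im. The gauge grows
by a factor p while the norm of s is unchanged, and the gauge enters squared. -/
theorem relativePosition_succ {i : ℕ} {s : (LocalAlg p a b)ˣ}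
    (hs : s ∉ orderStab p a b (i + 1)) :
    relativePosition (i + 1) s = relativePosition i s + 2 := by
  have hp := prime_cast_pos (p := p)
  have h := (mem_orderStab_succ_or i s).resolve_left hs
  set x := (s : LocalAlg p a b) with hx
  have h1 : gauge i x = (p : ℝ) ^ i * ‖x.im‖ := max_eq_right h
  have h2 : gauge (i + 1) x = (p : ℝ) ^ (i + 1) * ‖x.im‖ := by
    refine max_eq_right (h.trans ?_)
    gcongr
    · exact one_lt_prime_cast.le
    · omega
  apply relativePosition_eq
  rw [← hx, relativePosition_spec i s, ← hx, h1, h2]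
  push_cast
  rw [neg_add, zpow_add₀ hp.ne']
  have : (p : ℝ) ^ (-2 : ℤ) = ((p : ℝ) ^ 2)⁻¹ := by rw [zpow_neg]; rfl
  rw [this, pow_succ (p : ℝ) i]
  field_simp

/-- Lets a bound at level 0 dominate the integrand at every level. -/
theorem le_relativePosition_zero (i : ℕ) (s : (LocalAlg p a b)ˣ) :
    relativePosition 0 s ≤ relativePosition i s := by
  induction i with
  | zero => rfl
  | succ i ih =>
    by_cases h : s ∈ orderStab p a b (i + 1)
    · rw [relativePosition_eq_zero_iff.2 (orderStab_anti (Nat.zero_le _) h)]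
      exact Nat.zero_le _
    · rw [relativePosition_succ h]
      omega

/-! ### Cosets of the unit groups of the orders -/

/-- The element `c + p^i ω`. -/
def cosetElt (p : ℕ) [Fact p.Prime] (a b : ℤ) (i c : ℕ) : LocalAlg p a b := ⟨c, (p : ℚ_[p]) ^ i⟩

/-- The `c` for which `c + p^i ω` is a unit. -/
def cosetIndex (p : ℕ) [Fact p.Prime] (a b : ℤ) (i : ℕ) : Finset ℕ :=
  (Finset.range p).filter fun c => ‖(cosetElt p a b i c).norm‖ = 1

theorem norm_p_pow (i : ℕ) : ‖(p : ℚ_[p]) ^ i‖ = ((p : ℝ) ^ i)⁻¹ := by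
  rw [norm_pow, Padic.norm_p, inv_pow]

theorem cosetElt_isUnit {i c : ℕ} (h : c ∈ cosetIndex p a b i) :
    IsUnit (cosetElt p a b i c) := by
  rw [QuadraticAlgebra.isUnit_iff_norm_isUnit, isUnit_iff_ne_zero, ← norm_ne_zero_iff,
    (Finset.mem_filter.1 h).2]
  exact one_ne_zero

open scoped Classical in
/-- The unit `c + p^i ω`. -/
def cosetUnit (p : ℕ) [Fact p.Prime] (a b : ℤ) (i c : ℕ) : (LocalAlg p a b)ˣ :=
  if h : IsUnit (cosetElt p a b i c) then h.unit else 1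

theorem coe_cosetUnit {i c : ℕ} (h : c ∈ cosetIndex p a b i) :
    (cosetUnit p a b i c : LocalAlg p a b) = cosetElt p a b i c := by
  rw [cosetUnit, dif_pos (cosetElt_isUnit h), IsUnit.unit_spec]

theorem gauge_cosetElt (i c : ℕ) : gauge i (cosetElt p a b i c) = 1 := by
  have : (p : ℝ) ^ i ≠ 0 := pow_ne_zero _ prime_cast_pos.ne'
  rw [gauge, cosetElt, norm_p_pow, mul_inv_cancel₀ this]
  exact max_eq_right (norm_natCast_le_one c)

theorem cosetUnit_mem {i c : ℕ} (h : c ∈ cosetIndex p a b i) :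
    cosetUnit p a b i c ∈ orderStab p a b i := by
  rw [mem_orderStab, coe_cosetUnit h, gauge_cosetElt, (Finset.mem_filter.1 h).2, one_pow]

/-- Such an im makes the gauge at level i + 1 at least p, too large for an element of norm one. -/
theorem not_mem_of_norm_im {i : ℕ} {s : (LocalAlg p a b)ˣ}
    (hN : ‖(s : LocalAlg p a b).norm‖ = 1)
    (him : ‖(s : LocalAlg p a b).im‖ = ((p : ℝ) ^ i)⁻¹) : s ∉ orderStab p a b (i + 1) := by
  intro h
  have hp := prime_cast_pos (p := p)
  have h1 := pow_mul_norm_im_le_gauge (i + 1) (s : LocalAlg p a b)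
  rw [him, pow_succ] at h1
  have h2 : (p : ℝ) ≤ gauge (i + 1) (s : LocalAlg p a b) := by
    refine le_of_eq_of_le ?_ h1
    field_simp
  have h3 := mem_orderStab.1 h
  have := one_lt_prime_cast (p := p)
  rw [hN] at h3
  nlinarith

theorem inv_mul_im {x y : (LocalAlg p a b)ˣ} :
    ((x⁻¹ * y : (LocalAlg p a b)ˣ) : LocalAlg p a b).im
      = (x : LocalAlg p a b).norm⁻¹ * ((x : LocalAlg p a b).re * (y : LocalAlg p a b).im
        - (x : LocalAlg p a b).im * (y : LocalAlg p a b).re) := by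
  rw [Units.val_mul, unit_inv_eq, smul_mul_assoc, QuadraticAlgebra.im_smul, smul_eq_mul,
    QuadraticAlgebra.im_mul, QuadraticAlgebra.re_star, QuadraticAlgebra.im_star]
  ring

theorem cosetUnit_not_mem {i c : ℕ} (h : c ∈ cosetIndex p a b i) :
    cosetUnit p a b i c ∉ orderStab p a b (i + 1) := by
  apply not_mem_of_norm_im
  · rw [coe_cosetUnit h, (Finset.mem_filter.1 h).2]
  · rw [coe_cosetUnit h, cosetElt, norm_p_pow]

/-- The im coordinate of the quotient is (c - d) p^i up to a unit, and distinct residues differ by a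
unit. -/
theorem cosetUnit_inv_mul_not_mem {i c d : ℕ} (hc : c ∈ cosetIndex p a b i)
    (hd : d ∈ cosetIndex p a b i) (hcd : c ≠ d) :
    (cosetUnit p a b i c)⁻¹ * cosetUnit p a b i d ∉ orderStab p a b (i + 1) := by
  have hc' := Finset.mem_filter.1 hc
  have hd' := Finset.mem_filter.1 hd
  apply not_mem_of_norm_im
  · rw [norm_norm_mul, norm_norm_inv, coe_cosetUnit hc, coe_cosetUnit hd, hc'.2, hd'.2]
    simp
  · rw [inv_mul_im, coe_cosetUnit hc, coe_cosetUnit hd, norm_mul, norm_inv, hc'.2]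
    simp only [cosetElt]
    rw [mul_comm ((p : ℚ_[p]) ^ i) (d : ℚ_[p]), ← sub_mul, norm_mul,
      norm_natCast_sub_natCast_eq_one (Finset.mem_range.1 hc'.1) (Finset.mem_range.1 hd'.1) hcd,
      norm_p_pow]
    simp

theorem exists_nat_norm_sub_lt_one {x : ℚ_[p]} (hx : ‖x‖ ≤ 1) :
    ∃ c < p, ‖x - (c : ℚ_[p])‖ < 1 := by
  obtain ⟨y, hy⟩ : ∃ y : ℤ_[p], (y : ℚ_[p]) = x := ⟨⟨x, hx⟩, rfl⟩
  obtain ⟨c, hc, hm⟩ := PadicInt.exists_mem_range y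
  rw [IsLocalRing.mem_maximalIdeal, PadicInt.mem_nonunits, PadicInt.norm_def, PadicInt.coe_sub,
    PadicInt.coe_natCast, hy] at hm
  exact ⟨c, hc, hm⟩

/-- Rescaling by p^i / im turns s into y + p^i ω with y integral, and modulo the next stabilizer
only y mod p matters. The representative is the residue c of y. -/
theorem exists_cosetUnit {i : ℕ} {s : (LocalAlg p a b)ˣ} (hs : s ∈ orderStab p a b i)
    (hs' : s ∉ orderStab p a b (i + 1)) :
    ∃ c ∈ cosetIndex p a b i, (cosetUnit p a b i c)⁻¹ * s ∈ orderStab p a b (i + 1) := by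
  have hp := prime_cast_pos (p := p)
  have hpi : (0 : ℝ) < (p : ℝ) ^ i := pow_pos hp i
  have h := (mem_orderStab_succ_or i s).resolve_left hs'
  set x := (s : LocalAlg p a b) with hx
  have hg : gauge i x = (p : ℝ) ^ i * ‖x.im‖ := max_eq_right h
  have him : 0 < ‖x.im‖ := by
    have := unit_gauge_pos i s
    rw [← hx, hg] at this
    exact pos_of_mul_pos_right this hpi.le
  have him0 : x.im ≠ 0 := norm_pos_iff.1 him
  set y : ℚ_[p] := x.re * (p : ℚ_[p]) ^ i / x.im with hy
  have hy1 : ‖y‖ ≤ 1 := by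
    rw [hy, norm_div, norm_mul, norm_p_pow, div_le_one him, ← div_eq_mul_inv, div_le_iff₀ hpi,
      mul_comm]
    exact h
  obtain ⟨c, hc, hcy⟩ := exists_nat_norm_sub_lt_one hy1
  have hp0 := padic_prime_ne_zero (p := p)
  have hre : x.re = y * (x.im / (p : ℚ_[p]) ^ i) := by
    rw [hy]
    have := pow_ne_zero i hp0
    field_simp
  have hNy : x.norm = (x.im / (p : ℚ_[p]) ^ i) ^ 2 *
      (y ^ 2 + b * y * (p : ℚ_[p]) ^ i - a * ((p : ℚ_[p]) ^ i) ^ 2) := by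
    rw [QuadraticAlgebra.norm_def, hre]
    have := pow_ne_zero i hp0
    field_simp
  -- The hypothesis on s says that y + p^i ω has unit norm. This depends only on y mod p, so c + p^i
  -- ω has unit norm too.
  have hy2 : ‖y ^ 2 + b * y * (p : ℚ_[p]) ^ i - a * ((p : ℚ_[p]) ^ i) ^ 2‖ = 1 := by
    have h1 := mem_orderStab.1 hs
    rw [← hx, hg, hNy, norm_mul, norm_pow, norm_div, norm_p_pow, div_inv_eq_mul,
      mul_comm ‖x.im‖] at h1
    have h2 : ((p : ℝ) ^ i * ‖x.im‖) ^ 2 ≠ 0 := by positivity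
    exact mul_left_cancel₀ h2 (by rw [h1, mul_one])
  have hpi1 : ‖(p : ℚ_[p]) ^ i‖ ≤ 1 := by
    rw [norm_p_pow]; exact inv_le_one_of_one_le₀ (one_le_prime_pow i)
  have hcm : c ∈ cosetIndex p a b i := by
    refine Finset.mem_filter.2 ⟨Finset.mem_range.2 hc, ?_⟩
    rw [← hy2]
    apply norm_eq_of_norm_sub_lt
    rw [hy2, QuadraticAlgebra.norm_def, cosetElt]
    have e : (c : ℚ_[p]) * c + b * c * (p : ℚ_[p]) ^ i - a * (p : ℚ_[p]) ^ i * (p : ℚ_[p]) ^ i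
        - (y ^ 2 + b * y * (p : ℚ_[p]) ^ i - a * ((p : ℚ_[p]) ^ i) ^ 2)
        = (y - c) * (-(y + c) - b * (p : ℚ_[p]) ^ i) := by ring
    change ‖(c : ℚ_[p]) * c + b * c * (p : ℚ_[p]) ^ i - a * (p : ℚ_[p]) ^ i * (p : ℚ_[p]) ^ i
        - (y ^ 2 + b * y * (p : ℚ_[p]) ^ i - a * ((p : ℚ_[p]) ^ i) ^ 2)‖ < 1
    rw [e]
    refine norm_mul_lt_one_left hcy (norm_sub_le_of_le ?_ ((norm_int_mul_le _ _).trans hpi1))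
    rw [norm_neg]
    exact norm_add_le_of_le hy1 (norm_natCast_le_one c)
  refine ⟨c, hcm, ?_⟩
  have hcN := (Finset.mem_filter.1 hcm).2
  have hu := cosetUnit_mem hcm
  have huc := coe_cosetUnit hcm
  apply mem_orderStab_of_le
  rw [norm_norm_mul, norm_norm_inv, huc, hcN, inv_one, one_mul, mem_orderStab.1 hs, ← hx]
  refine pow_le_pow_left₀ (gauge_nonneg _ _) ?_ 2
  have hgi : gauge i (((cosetUnit p a b i c)⁻¹ * s : (LocalAlg p a b)ˣ) : LocalAlg p a b)
      = gauge i x := by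
    rw [Units.val_mul, gauge_mul_of_mem (inv_mem hu), gauge_inv, huc, hcN, gauge_cosetElt]
    simp [hx]
  refine gauge_le_iff.2 ⟨?_, ?_⟩
  · rw [← hgi]; exact norm_re_le_gauge _ _
  · rw [inv_mul_im, huc, norm_mul, norm_inv, hcN, inv_one, one_mul, ← hx, hg, cosetElt]
    -- The factor c - y has norm at most 1/p, which pays for the passage from level i to level i +
    -- 1.
    have e : (c : ℚ_[p]) * x.im - (p : ℚ_[p]) ^ i * x.re = (c - y) * x.im := by
      rw [hy]; field_simp
    change (p : ℝ) ^ (i + 1) * ‖(c : ℚ_[p]) * x.im - (p : ℚ_[p]) ^ i * x.re‖ ≤ _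
    rw [e, norm_mul, norm_sub_rev]
    have := norm_le_inv_of_lt_one hcy
    calc (p : ℝ) ^ (i + 1) * (‖y - c‖ * ‖x.im‖) ≤ (p : ℝ) ^ (i + 1) * ((p : ℝ)⁻¹ * ‖x.im‖) := by
          gcongr
      _ = (p : ℝ) ^ i * ‖x.im‖ := by rw [pow_succ]; field_simp

/-- At positive level the norm of c + p^{i+1} ω is c² modulo p, so only c = 0 drops out. With the
trivial coset the index is p. -/
theorem card_cosetIndex_succ (i : ℕ) : (cosetIndex p a b (i + 1)).card = p - 1 := by
  have : cosetIndex p a b (i + 1) = (Finset.range p).erase 0 := by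
    ext c
    rw [cosetIndex, Finset.mem_filter, Finset.mem_erase, and_comm, and_congr_left_iff]
    intro hc
    rw [Finset.mem_range] at hc
    have hpi1 : ‖(p : ℚ_[p]) ^ (i + 1)‖ < 1 := by
      rw [norm_p_pow]
      exact inv_lt_one_of_one_lt₀ (one_lt_pow₀ one_lt_prime_cast (by omega))
    have hd : ‖(cosetElt p a b (i + 1) c).norm - (c : ℚ_[p]) ^ 2‖ < 1 := by
      have e : (cosetElt p a b (i + 1) c).norm - (c : ℚ_[p]) ^ 2
          = (p : ℚ_[p]) ^ (i + 1) * (b * c - a * (p : ℚ_[p]) ^ (i + 1)) := by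
        rw [QuadraticAlgebra.norm_def, cosetElt]; ring
      rw [e]
      exact norm_mul_lt_one_left hpi1 (norm_sub_le_of_le
        ((norm_int_mul_le _ _).trans (norm_natCast_le_one c))
        ((norm_int_mul_le _ _).trans hpi1.le))
    constructor
    · rintro h rfl
      rw [Nat.cast_zero, zero_pow two_ne_zero, sub_zero, h] at hd
      exact lt_irrefl _ hd
    · intro h
      have h1 : ‖(c : ℚ_[p])‖ = 1 := by
        have := norm_natCast_sub_natCast_eq_one hc (Fact.out : p.Prime).pos h
        simpa using this
      have h2 : ‖(c : ℚ_[p]) ^ 2‖ = 1 := by rw [norm_pow, h1, one_pow]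
      rw [norm_eq_of_norm_sub_lt (by rwa [h2]), h2]
  rw [this, Finset.card_erase_of_mem (Finset.mem_range.2 (Fact.out : p.Prime).pos),
    Finset.card_range]

end LocalArithmetic

section LocalPrimes

variable {p : ℕ} [Fact p.Prime] {a b : ℤ}

/-! ### Prime elements of quadratic algebras over `ℚ_p` -/

/-- The integer `r` is a root modulo `p` of the minimal polynomial `x² - b x - a` of `ω`. -/
def IsRootMod (p : ℕ) (a b r : ℤ) : Prop := (p : ℤ) ∣ r ^ 2 - b * r - a

theorem IsRootMod.conj {r : ℤ} (h : IsRootMod p a b r) : IsRootMod p a b (b - r) := by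
  unfold IsRootMod at *
  convert h using 1
  ring

theorem IsRootMod.norm_lt_one {r : ℤ} (h : IsRootMod p a b r) :
    ‖(r : ℚ_[p]) ^ 2 - b * r - a‖ < 1 := by
  have := (Padic.norm_intCast_lt_one_iff (p := p)).2 h
  push_cast at this
  exact this

/-- The element `x` of `ℤ_p + ω ℤ_p` lies in the prime ideal `(p, ω - r)`. -/
def MemPrime (r : ℤ) (x : LocalAlg p a b) : Prop :=
  gauge 0 x ≤ 1 ∧ ‖x.re + r * x.im‖ < 1

theorem gauge_zero_le_iff {x : LocalAlg p a b} {t : ℝ} :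
    gauge 0 x ≤ t ↔ ‖x.re‖ ≤ t ∧ ‖x.im‖ ≤ t := by
  rw [gauge_le_iff, pow_zero, one_mul]

theorem MemPrime.star {r : ℤ} {x : LocalAlg p a b} (h : MemPrime r x) :
    MemPrime (b - r) (star x) := by
  refine ⟨by rw [gauge_star]; exact h.1, ?_⟩
  rw [QuadraticAlgebra.re_star, QuadraticAlgebra.im_star]
  convert h.2 using 2
  push_cast
  ring

/-- The prime (p, ω - r) times its conjugate (p, ω - (b - r)) is contained in p(ℤ_p + ωℤ_p). -/
theorem MemPrime.gauge_mul_le {r : ℤ} (hr : IsRootMod p a b r) {x y : LocalAlg p a b}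
    (hx : MemPrime r x) (hy : MemPrime (b - r) y) : gauge 0 (x * y) ≤ (p : ℝ)⁻¹ := by
  obtain ⟨hx1, hx2⟩ := gauge_zero_le_iff.1 hx.1
  obtain ⟨hy1, hy2⟩ := gauge_zero_le_iff.1 hy.1
  have h1 := hx.2
  have h2 := hy.2
  have hf := hr.norm_lt_one
  push_cast at h2
  rw [gauge_zero_le_iff, QuadraticAlgebra.re_mul, QuadraticAlgebra.im_mul]
  constructor
  · apply norm_le_inv_of_lt_one
    -- The coordinate is a combination of the residue of x at r, the residue of y at b - r and the
    -- minimal polynomial at r, all of norm less than 1.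
    have e : x.re * y.re + a * x.im * y.im = (x.re + r * x.im) * y.re
        - (y.re + (b - r) * y.im) * (r * x.im)
        - ((r : ℚ_[p]) ^ 2 - b * r - a) * (x.im * y.im) := by ring
    rw [e]
    refine norm_sub_lt_of_lt (norm_sub_lt_of_lt (norm_mul_lt_one_left h1 hy1)
      (norm_mul_lt_one_left h2 ((norm_int_mul_le _ _).trans hx2))) (norm_mul_lt_one_left hf ?_)
    rw [norm_mul]
    exact mul_le_one₀ hx2 (norm_nonneg _) hy2
  · apply norm_le_inv_of_lt_one
    have e : x.re * y.im + x.im * y.re + b * x.im * y.im = (x.re + r * x.im) * y.im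
        + (y.re + (b - r) * y.im) * x.im := by ring
    rw [e]
    exact norm_add_lt_of_lt (norm_mul_lt_one_left h1 hy2) (norm_mul_lt_one_left h2 hx2)

/-- Modulo p the norm is the product of the residues re + r im and re + (b - r) im, so one of them
is small. -/
theorem memPrime_or_of_norm_lt_one {r : ℤ} (hr : IsRootMod p a b r) {x : LocalAlg p a b}
    (hx : gauge 0 x ≤ 1) (hN : ‖x.norm‖ < 1) : MemPrime r x ∨ MemPrime (b - r) x := by
  obtain ⟨hx1, hx2⟩ := gauge_zero_le_iff.1 hx
  have e : (x.re + r * x.im) * (x.re + ((b - r : ℤ) : ℚ_[p]) * x.im)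
      = x.norm - ((r : ℚ_[p]) ^ 2 - b * r - a) * (x.im * x.im) := by
    rw [QuadraticAlgebra.norm_def]
    push_cast
    ring
  have h : ‖(x.re + r * x.im) * (x.re + ((b - r : ℤ) : ℚ_[p]) * x.im)‖ < 1 := by
    rw [e]
    refine norm_sub_lt_of_lt hN (norm_mul_lt_one_left hr.norm_lt_one ?_)
    rw [norm_mul]
    exact mul_le_one₀ hx2 (norm_nonneg _) hx2
  by_contra! hcon
  have h1 : 1 ≤ ‖x.re + r * x.im‖ := not_lt.1 fun h => hcon.1 ⟨hx, h⟩
  have h2 : 1 ≤ ‖x.re + ((b - r : ℤ) : ℚ_[p]) * x.im‖ := not_lt.1 fun h => hcon.2 ⟨hx, h⟩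
  rw [norm_mul] at h
  nlinarith

theorem MemPrime.congr {r r' : ℤ} (h : (p : ℤ) ∣ r - r') {x : LocalAlg p a b}
    (hx : MemPrime r x) : MemPrime r' x := by
  refine ⟨hx.1, ?_⟩
  have e : x.re + r' * x.im = (x.re + r * x.im) - ((r - r' : ℤ) : ℚ_[p]) * x.im := by
    push_cast; ring
  rw [e]
  exact norm_sub_lt_of_lt hx.2 (norm_mul_lt_one_left ((Padic.norm_intCast_lt_one_iff).2 h)
    (gauge_zero_le_iff.1 hx.1).2)

/-- A local prime element in the prime ideal `(p, ω - r)`. -/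
structure IsLocalPrime (r : ℤ) (s : (LocalAlg p a b)ˣ) : Prop where
  mem : MemPrime r (s : LocalAlg p a b)
  norm_eq : ‖(s : LocalAlg p a b).norm‖ = (p : ℝ)⁻¹

theorem gauge_zero_le_inv_of_lt_one {x : LocalAlg p a b} (hx : gauge 0 x < 1) :
    gauge 0 x ≤ (p : ℝ)⁻¹ := by
  obtain ⟨h1, h2⟩ : ‖x.re‖ < 1 ∧ ‖x.im‖ < 1 := by
    simpa [gauge] using hx
  exact gauge_zero_le_iff.2 ⟨norm_le_inv_of_lt_one h1, norm_le_inv_of_lt_one h2⟩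

/-- A smaller gauge would be at most 1/p, and the norm would then be at most p⁻². -/
theorem IsLocalPrime.gauge_eq {r : ℤ} {s : (LocalAlg p a b)ˣ} (hs : IsLocalPrime r s) :
    gauge 0 (s : LocalAlg p a b) = 1 := by
  refine hs.mem.1.antisymm (not_lt.1 fun h => ?_)
  have h1 := gauge_zero_le_inv_of_lt_one h
  have h2 := norm_norm_le 0 (s : LocalAlg p a b)
  have h3 : (p : ℝ)⁻¹ < 1 := inv_lt_one_of_one_lt₀ one_lt_prime_cast
  have h4 : (0 : ℝ) < (p : ℝ)⁻¹ := inv_pos.2 prime_cast_pos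
  have h5 := gauge_nonneg 0 (s : LocalAlg p a b)
  rw [hs.norm_eq] at h2
  nlinarith

theorem IsLocalPrime.relativePosition_eq_one {r : ℤ} {s : (LocalAlg p a b)ˣ}
    (hs : IsLocalPrime r s) : relativePosition 0 s = 1 := by
  apply relativePosition_eq
  rw [hs.gauge_eq, hs.norm_eq]
  simp

theorem IsLocalPrime.mul_mem {r : ℤ} (hr : IsRootMod p a b r) {s t : (LocalAlg p a b)ˣ}
    (hs : IsLocalPrime r s) (ht : IsLocalPrime (b - r) t) : s * t ∈ orderStab p a b 0 := by
  apply mem_orderStab_of_le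
  rw [norm_norm_mul, hs.norm_eq, ht.norm_eq, ← sq]
  exact pow_le_pow_left₀ (gauge_nonneg _ _) (hs.mem.gauge_mul_le hr ht.mem) 2

theorem exists_smul_gauge_eq_one (i : ℕ) (s : (LocalAlg p a b)ˣ) :
    ∃ c : ℚ_[p]ˣ, gauge i ((Units.map (algebraMap ℚ_[p] (LocalAlg p a b) : ℚ_[p] →* LocalAlg p a b) c * s :
      (LocalAlg p a b)ˣ) : LocalAlg p a b) = 1 := by
  obtain ⟨y, hy⟩ := exists_norm_eq_gauge i (s : LocalAlg p a b)
  have hpos := unit_gauge_pos i s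
  have hy0 : y ≠ 0 := norm_pos_iff.1 (hy ▸ hpos)
  refine ⟨(Units.mk0 y hy0)⁻¹, ?_⟩
  have : ((Units.map (algebraMap ℚ_[p] (LocalAlg p a b) : ℚ_[p] →* LocalAlg p a b) (Units.mk0 y hy0)⁻¹ * s :
      (LocalAlg p a b)ˣ) : LocalAlg p a b) = y⁻¹ • (s : LocalAlg p a b) := by
    rw [Units.val_mul, Algebra.smul_def]
    simp
  rw [this, gauge_smul, norm_inv, hy, inv_mul_cancel₀ hpos.ne']

theorem scalar_mem_orderStab (i : ℕ) (c : ℚ_[p]ˣ) :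
    Units.map (algebraMap ℚ_[p] (LocalAlg p a b) : ℚ_[p] →* LocalAlg p a b) c ∈ orderStab p a b i := by
  rw [mem_orderStab]
  simp [QuadraticAlgebra.norm_def, gauge, QuadraticAlgebra.algebraMap_eq, sq]

/-- Induction on the valuation of the norm: w can be divided out of a primitive element of its
prime, and the quotient is again primitive. While its norm is not a unit the quotient stays in the
same prime, since an element of the conjugate prime times w would be divisible by p. -/
theorem IsLocalPrime.exists_pow_of_memPrime {r : ℤ} (hr : IsRootMod p a b r)
    {w : (LocalAlg p a b)ˣ} (hw : IsLocalPrime r w) (n : ℕ) :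
    ∀ s : (LocalAlg p a b)ˣ, gauge 0 (s : LocalAlg p a b) = 1 → MemPrime r (s : LocalAlg p a b) →
      ‖(s : LocalAlg p a b).norm‖ = (p : ℝ) ^ (-(n : ℤ)) → (w ^ n)⁻¹ * s ∈ orderStab p a b 0 := by
  have hp := prime_cast_pos (p := p)
  induction n with
  | zero =>
    intro s hs _ hN
    rw [pow_zero, inv_one, one_mul, mem_orderStab, hs, hN]
    simp
  | succ n ih =>
    intro s hs hsr hN
    set y := w⁻¹ * s with hy
    have hyN : ‖(y : LocalAlg p a b).norm‖ = (p : ℝ) ^ (-(n : ℤ)) := by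
      rw [hy, norm_norm_mul, norm_norm_inv, hw.norm_eq, hN]
      push_cast
      rw [neg_add, zpow_add₀ hp.ne', zpow_neg_one]
      field_simp
    -- Here w⁻¹ s = N(w)⁻¹ w̄ s, and w̄ lies in the conjugate prime, so w̄ s is divisible by p.
    have hyle : gauge 0 (y : LocalAlg p a b) ≤ 1 := by
      have h1 := hsr.gauge_mul_le hr hw.mem.star
      rw [hy, Units.val_mul, unit_inv_eq, smul_mul_assoc, gauge_smul, norm_inv, hw.norm_eq,
        inv_inv, mul_comm (Star.star _)]
      calc _ ≤ (p : ℝ) * (p : ℝ)⁻¹ := by gcongr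
        _ = 1 := mul_inv_cancel₀ hp.ne'
    have hsy : (s : LocalAlg p a b) = w * y := by
      rw [hy, ← Units.val_mul, mul_inv_cancel_left]
    have hy1 : gauge 0 (y : LocalAlg p a b) = 1 := by
      refine hyle.antisymm ?_
      have h1 := Toral.gauge_mul_le 0 (w : LocalAlg p a b) (y : LocalAlg p a b)
      rwa [← hsy, hs, hw.gauge_eq, one_mul] at h1
    have e : (w ^ (n + 1))⁻¹ * s = (w ^ n)⁻¹ * y := by
      rw [hy, pow_succ', mul_inv_rev, mul_assoc]
    rw [e]
    rcases Nat.eq_zero_or_pos n with rfl | hn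
    · rw [pow_zero, inv_one, one_mul, mem_orderStab, hyN, hy1]
      simp
    · have hlt : ‖(y : LocalAlg p a b).norm‖ < 1 := by
        rw [hyN]
        exact zpow_lt_one_of_neg₀ one_lt_prime_cast (by omega)
      rcases memPrime_or_of_norm_lt_one hr hyle hlt with h | h
      · exact ih y hy1 h hyN
      · have h1 := hw.mem.gauge_mul_le hr h
        rw [← hsy, hs] at h1
        exact absurd h1 (not_le.2 (inv_lt_one_of_one_lt₀ one_lt_prime_cast))

/-- A local prime element generates the units up to `ℚ_p^× (ℤ_p + ω ℤ_p)^×`. -/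
theorem IsLocalPrime.exists_zpow {r : ℤ} (hr : IsRootMod p a b r) {w : (LocalAlg p a b)ˣ}
    (hw : IsLocalPrime r w) (s : (LocalAlg p a b)ˣ) :
    ∃ n : ℤ, (w ^ n)⁻¹ * s ∈ orderStab p a b 0 := by
  have key : ∀ s : (LocalAlg p a b)ˣ, gauge 0 (s : LocalAlg p a b) = 1 →
      MemPrime r (s : LocalAlg p a b) → ∃ n : ℤ, (w ^ n)⁻¹ * s ∈ orderStab p a b 0 := by
    intro s hs hsr
    obtain ⟨n, hn⟩ := exists_relativePosition 0 s
    rw [hs, one_pow, mul_one] at hn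
    exact ⟨n, by simpa using hw.exists_pow_of_memPrime hr n s hs hsr hn⟩
  obtain ⟨c, hc⟩ := exists_smul_gauge_eq_one 0 s
  set z := Units.map (algebraMap ℚ_[p] (LocalAlg p a b) : ℚ_[p] →* LocalAlg p a b) c
  have hz : z ∈ orderStab p a b 0 := scalar_mem_orderStab 0 c
  suffices h : ∃ n : ℤ, (w ^ n)⁻¹ * (z * s) ∈ orderStab p a b 0 by
    obtain ⟨n, hn⟩ := h
    refine ⟨n, ?_⟩
    rw [mul_left_comm] at hn
    exact (Subgroup.mul_mem_cancel_left _ hz).1 hn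
  set t := z * s
  rcases (norm_norm_le 0 (t : LocalAlg p a b)).lt_or_eq with h | h
  · rw [hc, one_pow] at h
    rcases memPrime_or_of_norm_lt_one hr hc.le h with h1 | h1
    · exact key t hc h1
    -- If t lies in the conjugate prime, then t̄ lies in the prime of w. Since t t̄ is a scalar, the
    -- exponent found for t̄ is negated.
    · have hN := unit_norm_ne_zero t
      have hst : IsUnit (Star.star (t : LocalAlg p a b)) := by
        rw [QuadraticAlgebra.isUnit_iff_norm_isUnit, QuadraticAlgebra.norm_star]
        exact isUnit_iff_ne_zero.2 hN
      obtain ⟨t', ht'⟩ := hst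
      have h2 := h1.star
      rw [sub_sub_cancel, ← ht'] at h2
      obtain ⟨n, hn⟩ := key t' (by rw [ht', gauge_star]; exact hc) h2
      have htt : t * t' ∈ orderStab p a b 0 := by
        have : t * t' = Units.map (algebraMap ℚ_[p] (LocalAlg p a b) : ℚ_[p] →* LocalAlg p a b)
            (Units.mk0 _ hN) := by
          ext1
          rw [Units.val_mul, ht', ← QuadraticAlgebra.algebraMap_norm_eq_mul_star]
          rfl
        rw [this]
        exact scalar_mem_orderStab 0 _
      refine ⟨-n, ?_⟩
      have := Subgroup.mul_mem _ (inv_mem hn) htt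
      convert this using 1
      rw [mul_inv_rev, inv_inv, zpow_neg, inv_inv]
      rw [mul_comm t'⁻¹, mul_assoc, mul_comm t, inv_mul_cancel_left]
  · exact ⟨0, by rw [zpow_zero, inv_one, one_mul]; exact h⟩

/-- The residue at the other root b - r is multiplicative modulo p and is a unit at w. So the powers
w^n stay primitive while their norms are p^{-n}; negative exponents follow by inversion. -/
theorem IsLocalPrime.relativePosition_zpow {r : ℤ} (hr : IsRootMod p a b r)
    {w : (LocalAlg p a b)ˣ} (hw : IsLocalPrime r w)
    (hw' : ¬ MemPrime (b - r) (w : LocalAlg p a b)) (n : ℤ) :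
    relativePosition 0 (w ^ n) = n.natAbs := by
  have hp := prime_cast_pos (p := p)
  have hev : ∀ n : ℕ, gauge 0 ((w ^ n : (LocalAlg p a b)ˣ) : LocalAlg p a b) ≤ 1 ∧
      ‖((w ^ n : (LocalAlg p a b)ˣ) : LocalAlg p a b).re
        + ((b - r : ℤ) : ℚ_[p]) * ((w ^ n : (LocalAlg p a b)ˣ) : LocalAlg p a b).im‖ = 1 := by
    intro n
    induction n with
    | zero =>
      rw [pow_zero, Units.val_one, gauge_zero_le_iff, QuadraticAlgebra.re_one,
        QuadraticAlgebra.im_one]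
      simp
    | succ n ih =>
      obtain ⟨ih1, ih2⟩ := ih
      set x := ((w ^ n : (LocalAlg p a b)ˣ) : LocalAlg p a b) with hx
      have hle : gauge 0 ((w ^ (n + 1) : (LocalAlg p a b)ˣ) : LocalAlg p a b) ≤ 1 := by
        rw [pow_succ, Units.val_mul]
        exact (Toral.gauge_mul_le _ _ _).trans (mul_le_one₀ ih1 (gauge_nonneg _ _) hw.mem.1)
      refine ⟨hle, ?_⟩
      have hw1 : ‖(w : LocalAlg p a b).re + ((b - r : ℤ) : ℚ_[p]) * (w : LocalAlg p a b).im‖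
          = 1 := by
        refine le_antisymm ?_ (not_lt.1 fun h => hw' ⟨hw.mem.1, h⟩)
        obtain ⟨h1, h2⟩ := gauge_zero_le_iff.1 hw.mem.1
        exact norm_add_le_of_le h1 ((norm_int_mul_le _ _).trans h2)
      have hprod : ‖(x.re + ((b - r : ℤ) : ℚ_[p]) * x.im) * ((w : LocalAlg p a b).re
          + ((b - r : ℤ) : ℚ_[p]) * (w : LocalAlg p a b).im)‖ = 1 := by
        rw [norm_mul, ih2, hw1, one_mul]
      rw [← hprod]
      apply norm_eq_of_norm_sub_lt
      rw [hprod, pow_succ, Units.val_mul, ← hx, QuadraticAlgebra.re_mul, QuadraticAlgebra.im_mul]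
      have e : x.re * (w : LocalAlg p a b).re + a * x.im * (w : LocalAlg p a b).im
          + ((b - r : ℤ) : ℚ_[p]) * (x.re * (w : LocalAlg p a b).im
            + x.im * (w : LocalAlg p a b).re + b * x.im * (w : LocalAlg p a b).im)
          - (x.re + ((b - r : ℤ) : ℚ_[p]) * x.im) * ((w : LocalAlg p a b).re
            + ((b - r : ℤ) : ℚ_[p]) * (w : LocalAlg p a b).im)
          = -(((r : ℚ_[p]) ^ 2 - b * r - a) * (x.im * (w : LocalAlg p a b).im)) := by
        push_cast; ring
      rw [e, norm_neg]
      refine norm_mul_lt_one_left hr.norm_lt_one ?_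
      rw [norm_mul]
      exact mul_le_one₀ (gauge_zero_le_iff.1 ih1).2 (norm_nonneg _)
        (gauge_zero_le_iff.1 hw.mem.1).2
  have hnat : ∀ n : ℕ, relativePosition 0 (w ^ n) = n := by
    intro n
    obtain ⟨h1, h2⟩ := hev n
    apply relativePosition_eq
    have hg : gauge 0 ((w ^ n : (LocalAlg p a b)ˣ) : LocalAlg p a b) = 1 := by
      refine h1.antisymm ?_
      rw [← h2]
      exact norm_add_le_of_le (norm_re_le_gauge 0 _)
        ((norm_int_mul_le _ _).trans (norm_im_le_gauge 0 _))
    rw [hg, Units.val_pow_eq_pow_val, map_pow, norm_pow, hw.norm_eq, zpow_neg, zpow_natCast,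
      inv_pow]
    simp
  rcases n.natAbs_eq with h | h
  · conv_lhs => rw [h, zpow_natCast, hnat]
  · conv_lhs => rw [h, zpow_neg, relativePosition_inv, zpow_natCast, hnat]

/-- If `x² - b x - a` has no root modulo `p`, then `ℤ_p + ω ℤ_p` is unramified. -/
theorem orderStab_zero_eq_top (h : ∀ r, ¬ IsRootMod p a b r) : orderStab p a b 0 = ⊤ := by
  rw [eq_top_iff]
  intro s _
  obtain ⟨c, hc⟩ := exists_smul_gauge_eq_one 0 s
  refine (Subgroup.mul_mem_cancel_left _ (scalar_mem_orderStab 0 c)).1 ?_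
  set x := Units.map (algebraMap ℚ_[p] (LocalAlg p a b) : ℚ_[p] →* LocalAlg p a b) c * s
  apply mem_orderStab_of_le
  rw [hc, one_pow]
  by_contra! hlt
  obtain ⟨h1, h2⟩ := gauge_zero_le_iff.1 hc.le
  set y := (x : LocalAlg p a b)
  -- If im were small, smallness of the norm would make re small too, contradicting gauge one.
  have him : ‖y.im‖ = 1 := by
    refine h2.antisymm (not_lt.1 fun h3 => ?_)
    have h4 : ‖y.re * y.re‖ < 1 := by
      have e : y.re * y.re = y.norm - y.im * (b * y.re - a * y.im) := by
        rw [QuadraticAlgebra.norm_def]; ring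
      rw [e]
      exact norm_sub_lt_of_lt hlt (norm_mul_lt_one_left h3
        (norm_sub_le_of_le ((norm_int_mul_le _ _).trans h1) ((norm_int_mul_le _ _).trans h2)))
    have h5 : ‖y.re‖ < 1 := by
      rw [norm_mul] at h4
      by_contra! h6
      nlinarith
    have : gauge 0 y < 1 := max_lt h5 (by rwa [pow_zero, one_mul])
    exact this.ne hc
  have him0 : y.im ≠ 0 := norm_pos_iff.1 (him ▸ one_pos)
  have hx1 : ‖-y.re / y.im‖ ≤ 1 := by rw [norm_div, him, div_one, norm_neg]; exact h1
  obtain ⟨d, hd, hdx⟩ := exists_nat_norm_sub_lt_one hx1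
  set t := -y.re / y.im with ht
  -- Dividing the small norm by the unit im² exhibits the residue d of -re/im as a root modulo p.
  apply h (d : ℤ)
  rw [IsRootMod, ← Padic.norm_intCast_lt_one_iff]
  have e : (((d : ℤ) ^ 2 - b * d - a : ℤ) : ℚ_[p])
      = y.norm / y.im ^ 2 - (t - d) * (t + d - b) := by
    rw [QuadraticAlgebra.norm_def, ht]
    push_cast
    field_simp
    ring
  rw [e]
  refine norm_sub_lt_of_lt ?_ (norm_mul_lt_one_left hdx ?_)
  · rw [norm_div, norm_pow, him, one_pow, div_one]; exact hlt
  · exact norm_sub_le_of_le (norm_add_le_of_le hx1 (norm_natCast_le_one d))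
      (Padic.norm_int_le_one b)

/-- The norm of c + ω is the minimal polynomial of ω evaluated at -c. -/
theorem mem_cosetIndex_zero {c : ℕ} :
    c ∈ cosetIndex p a b 0 ↔ c < p ∧ ¬ IsRootMod p a b (-c) := by
  rw [cosetIndex, Finset.mem_filter, Finset.mem_range, and_congr_right_iff]
  intro _
  rw [IsRootMod, ← Padic.norm_intCast_lt_one_iff]
  have e : (cosetElt p a b 0 c).norm = (((-c : ℤ) ^ 2 - b * (-c : ℤ) - a : ℤ) : ℚ_[p]) := by
    rw [QuadraticAlgebra.norm_def, cosetElt]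
    push_cast
    ring
  rw [e]
  constructor
  · intro h; rw [h]; exact lt_irrefl _
  · intro h; exact (Padic.norm_int_le_one _).antisymm (not_lt.1 h)

theorem exists_unique_nat_dvd_add (p : ℕ) [Fact p.Prime] (r : ℤ) :
    ∃ c < p, ∀ d < p, (p : ℤ) ∣ d + r ↔ d = c := by
  have hp : 0 < p := (Fact.out : p.Prime).pos
  have h0 := Int.emod_nonneg (-r) (by omega : (p : ℤ) ≠ 0)
  have h1 := Int.emod_lt_of_pos (-r) (by omega : (0 : ℤ) < p)
  have h2 := Int.emod_add_mul_ediv (-r) p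
  refine ⟨((-r) % p).toNat, by omega, fun d hd => ⟨fun ⟨k, hk⟩ => ?_, fun h => ?_⟩⟩
  · have h3 : (d : ℤ) - (-r) % p = p * (k + (-r) / p) := by rw [mul_add]; omega
    have h4 := Int.eq_zero_of_abs_lt_dvd ⟨_, h3⟩ (by rw [abs_lt]; omega)
    omega
  · refine ⟨-((-r) / p), ?_⟩
    rw [mul_neg]
    omega

theorem isRootMod_iff {r : ℤ} (hr : IsRootMod p a b r) (t : ℤ) :
    IsRootMod p a b t ↔ (p : ℤ) ∣ t - r ∨ (p : ℤ) ∣ t - (b - r) := by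
  have hp : Prime (p : ℤ) := Nat.prime_iff_prime_int.1 Fact.out
  have e : t ^ 2 - b * t - a = (t - r) * (t - (b - r)) + (r ^ 2 - b * r - a) := by ring
  rw [IsRootMod, e, dvd_add_left hr, hp.dvd_mul]

/-- In this and the next two counts the excluded c are the negatives of the roots modulo p. Adding
the trivial coset gives the indices p + 1, p, p - 1, that is p - e_p. -/
theorem card_cosetIndex_zero_of_no_root (h : ∀ r, ¬ IsRootMod p a b r) :
    (cosetIndex p a b 0).card = p := by
  have : cosetIndex p a b 0 = Finset.range p := by
    ext c
    rw [mem_cosetIndex_zero, Finset.mem_range]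
    exact ⟨fun h => h.1, fun hc => ⟨hc, h _⟩⟩
  rw [this, Finset.card_range]

theorem card_cosetIndex_zero_of_double_root {r : ℤ} (hr : IsRootMod p a b r)
    (h : (p : ℤ) ∣ b - r - r) : (cosetIndex p a b 0).card = p - 1 := by
  obtain ⟨c, hc, hcu⟩ := exists_unique_nat_dvd_add p r
  have : cosetIndex p a b 0 = (Finset.range p).erase c := by
    ext d
    rw [mem_cosetIndex_zero, Finset.mem_erase, Finset.mem_range, and_comm, and_congr_left_iff]
    intro hd
    rw [ne_eq, ← hcu d hd, isRootMod_iff hr, not_iff_not]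
    have e1 : -(d : ℤ) - r = -(d + r) := by ring
    have e2 : -(d : ℤ) - (b - r) = -(d + r) - (b - r - r) := by ring
    rw [e2, dvd_sub_left h, e1, or_self, dvd_neg]
  rw [this, Finset.card_erase_of_mem (Finset.mem_range.2 hc), Finset.card_range]

theorem card_cosetIndex_zero_of_two_roots {r : ℤ} (hr : IsRootMod p a b r)
    (h : ¬ (p : ℤ) ∣ b - r - r) : (cosetIndex p a b 0).card = p - 2 := by
  obtain ⟨c, hc, hcu⟩ := exists_unique_nat_dvd_add p r
  obtain ⟨c', hc', hcu'⟩ := exists_unique_nat_dvd_add p (b - r)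
  have hne : c' ≠ c := by
    intro h0
    apply h
    have h1 := (hcu c hc).2 rfl
    have h2 := (hcu' c' hc').2 rfl
    rw [h0] at h2
    have := dvd_sub h2 h1
    rwa [add_sub_add_left_eq_sub] at this
  have : cosetIndex p a b 0 = ((Finset.range p).erase c).erase c' := by
    ext d
    rw [mem_cosetIndex_zero, Finset.mem_erase, Finset.mem_erase, Finset.mem_range, ← and_assoc,
      and_comm, and_congr_left_iff]
    intro hd
    rw [ne_eq, ne_eq, ← hcu d hd, ← hcu' d hd, isRootMod_iff hr, not_or, and_comm]
    have e1 : -(d : ℤ) - r = -(d + r) := by ring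
    have e2 : -(d : ℤ) - (b - r) = -(d + (b - r)) := by ring
    rw [e1, e2, dvd_neg, dvd_neg]
  rw [this, Finset.card_erase_of_mem (Finset.mem_erase.2 ⟨hne, Finset.mem_range.2 hc'⟩),
    Finset.card_erase_of_mem (Finset.mem_range.2 hc), Finset.card_range]
  omega

end LocalPrimes

section Integration

/-! ### Integration over a filtered group -/

variable {Q : Type*} [CommGroup Q] [TopologicalSpace Q] [IsTopologicalGroup Q]
  [MeasurableSpace Q] [BorelSpace Q]

/-- A decreasing sequence of open subgroups `U i` of `Q`, with a function `d i` that is constant on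
the cosets of `U i` and vanishes on `U i`, related by `d (i + 1) = d i + 2` outside of
`U (i + 1)`. -/
structure IsFiltration (U : ℕ → Subgroup Q) (d : ℕ → Q → ℕ) : Prop where
  isOpen : ∀ i, IsOpen (U i : Set Q)
  anti : Antitone U
  eq_zero_iff : ∀ i q, d i q = 0 ↔ q ∈ U i
  mul_left : ∀ i, ∀ u ∈ U i, ∀ q, d i (u * q) = d i q
  succ : ∀ i q, q ∉ U (i + 1) → d (i + 1) q = d i q + 2
  zero_le : ∀ i q, d 0 q ≤ d i q

/-- Representatives `g` of the cosets of the open subgroup `U`. -/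
structure IsCosetSystem {ι : Type*} (U : Subgroup Q) (g : ι → Q) : Prop where
  exists_mem : ∀ q, ∃ n, (g n)⁻¹ * q ∈ U
  eq_of_mem : ∀ m n, (g m)⁻¹ * g n ∈ U → m = n

variable {U : ℕ → Subgroup Q} {d : ℕ → Q → ℕ} {ν : Measure Q} [ν.IsMulLeftInvariant]

theorem measure_coset (V : Subgroup Q) (g : Q) :
    ν {q | g⁻¹ * q ∈ V} = ν (V : Set Q) := by
  have : {q | g⁻¹ * q ∈ V} = (fun q => g⁻¹ * q) ⁻¹' (V : Set Q) := rfl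
  rw [this, measure_preimage_mul]

theorem isOpen_coset {V : Subgroup Q} (hV : IsOpen (V : Set Q)) (g : Q) :
    IsOpen {q | g⁻¹ * q ∈ V} :=
  hV.preimage (continuous_const_mul g⁻¹)

namespace IsCosetSystem

variable {ι : Type*} {V : Subgroup Q} {g : ι → Q} (hg : IsCosetSystem V g)

include hg

theorem iUnion_eq : ⋃ n, {q | (g n)⁻¹ * q ∈ V} = Set.univ := by
  rw [Set.eq_univ_iff_forall]
  intro q
  obtain ⟨n, hn⟩ := hg.exists_mem q
  exact Set.mem_iUnion.2 ⟨n, hn⟩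

theorem pairwise_disjoint :
    Pairwise (Function.onFun Disjoint fun n => {q | (g n)⁻¹ * q ∈ V}) := by
  intro m n hmn
  rw [Function.onFun, Set.disjoint_left]
  intro q hm hn
  apply hmn
  apply hg.eq_of_mem
  have := V.mul_mem hm (V.inv_mem hn)
  convert this using 1
  group

/-- Each coset has measure one, so a summable family of bounds on the cosets dominates the integral
of the norm. -/
theorem integrable [Countable ι] (hV : IsOpen (V : Set Q)) (hν : ν (V : Set Q) = 1) {F : Q → ℂ}
    (hF : Continuous F) {B : ι → ℝ} (hB : Summable B)
    (hFB : ∀ n q, (g n)⁻¹ * q ∈ V → ‖F q‖ ≤ B n) : Integrable F ν := by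
  rw [← integrableOn_univ, ← hg.iUnion_eq]
  have hm : ∀ n, ν {q | (g n)⁻¹ * q ∈ V} = 1 := fun n => by rw [measure_coset, hν]
  have hint : ∀ n, IntegrableOn F {q | (g n)⁻¹ * q ∈ V} ν := fun n =>
    IntegrableOn.of_bound (by rw [hm]; exact ENNReal.one_lt_top)
      hF.aestronglyMeasurable.restrict (B n)
      ((ae_restrict_iff' (isOpen_coset hV _).measurableSet).2
        (Filter.Eventually.of_forall fun q hq => hFB n q hq))
  refine integrableOn_iUnion_of_summable_integral_norm hint ?_
  refine Summable.of_nonneg_of_le (fun n => integral_nonneg fun q => norm_nonneg _) (fun n => ?_) hB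
  calc ∫ q in {q | (g n)⁻¹ * q ∈ V}, ‖F q‖ ∂ν
      ≤ ∫ q in {q | (g n)⁻¹ * q ∈ V}, B n ∂ν := by
        refine setIntegral_mono_on (hint n).norm ?_ (isOpen_coset hV _).measurableSet
          fun q hq => hFB n q hq
        exact integrableOn_const (by rw [hm]; exact ENNReal.one_ne_top)
    _ = B n := by
        rw [setIntegral_const, Measure.real, hm]
        simp

theorem hasSum_integral [Countable ι] (hV : IsOpen (V : Set Q)) (hν : ν (V : Set Q) = 1)
    {F : Q → ℂ} (hF : Integrable F ν) {k : ι → ℂ}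
    (hk : ∀ n q, (g n)⁻¹ * q ∈ V → F q = k n) : HasSum k (∫ q, F q ∂ν) := by
  have h := hasSum_integral_iUnion (μ := ν) (f := F)
    (fun n => (isOpen_coset hV (g n)).measurableSet) hg.pairwise_disjoint
    (by rw [hg.iUnion_eq]; exact hF.integrableOn)
  rw [hg.iUnion_eq, setIntegral_univ] at h
  have e : k = fun n => ∫ q in {q | (g n)⁻¹ * q ∈ V}, F q ∂ν := by
    funext n
    rw [setIntegral_congr_fun (isOpen_coset hV _).measurableSet (fun q hq => hk n q hq),
      setIntegral_const, Measure.real, measure_coset, hν]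
    simp
  rw [e]
  exact h

end IsCosetSystem

namespace IsFiltration

variable (hU : IsFiltration U d)

include hU

theorem continuous_comp (i : ℕ) (Y : ℕ → ℂ) : Continuous fun q => Y (d i q) := by
  have : IsLocallyConstant (d i) := by
    rw [IsLocallyConstant.iff_exists_open]
    intro q
    refine ⟨{x | q⁻¹ * x ∈ U i}, isOpen_coset (hU.isOpen i) q, ?_, fun x hx => ?_⟩
    · simp [one_mem]
    · rw [← hU.mul_left i _ hx q]
      congr 1
      rw [mul_right_comm, inv_mul_cancel, one_mul]
  exact (this.comp Y).continuous

theorem apply_of_mem {q q' : Q} {i : ℕ} (h : q'⁻¹ * q ∈ U i) : d i q = d i q' := by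
  rw [← hU.mul_left i _ h q']
  congr 1
  rw [mul_right_comm, inv_mul_cancel, one_mul]

theorem integrable {ι : Type*} [Countable ι] {g : ι → Q} (hg : IsCosetSystem (U 0) g)
    (hν : ν (U 0 : Set Q) = 1) {χ : Q →* Circle} (hχ : Continuous χ) {Y : ℕ → ℂ} {C r : ℝ}
    (hC : 0 ≤ C) (hr : 0 ≤ r) (hr1 : r < 1) (hY : ∀ n, ‖Y n‖ ≤ C * r ^ n)
    (hs : Summable fun n => r ^ d 0 (g n)) (i : ℕ) :
    Integrable (fun q => Y (d i q) * ((χ q)⁻¹ : Circle)) ν := by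
  refine hg.integrable (hU.isOpen 0) hν (B := fun n => C * r ^ d 0 (g n)) ?_ (hs.mul_left C) ?_
  · exact (hU.continuous_comp i Y).mul (continuous_subtype_val.comp hχ.inv)
  · intro n q hq
    rw [norm_mul, Circle.norm_coe, mul_one, ← hU.apply_of_mem hq]
    refine (hY _).trans (mul_le_mul_of_nonneg_left ?_ hC)
    exact pow_le_pow_of_le_one hr hr1.le (hU.zero_le i q)

/-- Translation by u fixes the integral and multiplies the integrand by χ(u)⁻¹ ≠ 1. -/
theorem integral_eq_zero {χ : Q →* Circle} {Y : ℕ → ℂ} {i : ℕ} {u : Q} (hu : u ∈ U i)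
    (hχu : χ u ≠ 1) : ∫ q, Y (d i q) * ((χ q)⁻¹ : Circle) ∂ν = 0 := by
  have h := integral_mul_left_eq_self (μ := ν) (fun q => Y (d i q) * ((χ q)⁻¹ : Circle)) u
  have e : ∀ q, Y (d i (u * q)) * (((χ (u * q))⁻¹ : Circle) : ℂ)
      = ((χ u)⁻¹ : Circle) * (Y (d i q) * ((χ q)⁻¹ : Circle)) := by
    intro q
    rw [hU.mul_left i u hu, map_mul, mul_inv, Circle.coe_mul]
    ring
  simp only [e] at h
  rw [integral_const_mul] at h
  by_contra hne
  have h1 : (((χ u)⁻¹ : Circle) : ℂ) = 1 := mul_right_cancel₀ hne (by rw [h, one_mul])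
  apply hχu
  rw [← inv_eq_one]
  exact Circle.ext (h1.trans Circle.coe_one.symm)

/-- The level i + 1 function is a level i function, orthogonal to χ, plus a correction supported on
U (i + 1), where χ is trivial. -/
theorem integral_of_ramified {ι : Type*} [Countable ι] {g : ι → Q} (hg : IsCosetSystem (U 0) g)
    (hν : ν (U 0 : Set Q) = 1) {χ : Q →* Circle} (hχ : Continuous χ) {X : ℕ → ℂ} {C r : ℝ}
    (hC : 0 ≤ C) (hr : 0 ≤ r) (hr1 : r < 1) (hX : ∀ n, ‖X n‖ ≤ C * r ^ n) (hX0 : X 0 = 1)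
    (hs : Summable fun n => r ^ d 0 (g n)) (i : ℕ) (htriv : ∀ u ∈ U (i + 1), χ u = 1)
    {u : Q} (hu : u ∈ U i) (hχu : χ u ≠ 1) :
    ∫ q, X (d (i + 1) q) * ((χ q)⁻¹ : Circle) ∂ν = ν.real (U (i + 1) : Set Q) * (1 - X 2) := by
  have hm := (hU.isOpen (i + 1)).measurableSet
  have hfin : ν (U (i + 1) : Set Q) ≠ ⊤ := by
    refine ne_top_of_le_ne_top ENNReal.one_ne_top (hν ▸ measure_mono ?_)
    exact hU.anti (Nat.zero_le _)
  -- On U (i + 1) both positions vanish, so X 0 = 1 is replaced by X 2 and the indicator restores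
  -- the difference.
  have e : ∀ q, X (d (i + 1) q) * (((χ q)⁻¹ : Circle) : ℂ)
      = X (d i q + 2) * ((χ q)⁻¹ : Circle)
        + (U (i + 1) : Set Q).indicator (fun _ => 1 - X 2) q := by
    intro q
    by_cases hq : q ∈ U (i + 1)
    · rw [Set.indicator_of_mem hq, (hU.eq_zero_iff _ _).2 hq,
        (hU.eq_zero_iff _ _).2 (hU.anti (Nat.le_succ i) hq), htriv q hq, hX0]
      simp
    · rw [Set.indicator_of_notMem hq, hU.succ i q hq, add_zero]
  have hint : Integrable (fun q => X (d i q + 2) * (((χ q)⁻¹ : Circle) : ℂ)) ν := by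
    refine hU.integrable hg hν hχ (Y := fun n => X (n + 2)) (C := C * r ^ 2) (by positivity) hr hr1
      (fun n => ?_) hs i
    rw [mul_assoc, ← pow_add, add_comm 2 n]
    exact hX (n + 2)
  simp only [e]
  rw [integral_add hint, hU.integral_eq_zero (Y := fun n => X (n + 2)) hu hχu, zero_add,
    integral_indicator_const _ hm, Complex.real_smul]
  exact (integrable_indicator_iff hm).2 (integrableOn_const hfin)

theorem integral_of_unramified {ι : Type*} [Countable ι] {g : ι → Q}
    (hg : IsCosetSystem (U 0) g)
    (hν : ν (U 0 : Set Q) = 1) {χ : Q →* Circle} (hχ : Continuous χ) {X : ℕ → ℂ} {C r : ℝ}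
    (hC : 0 ≤ C) (hr : 0 ≤ r) (hr1 : r < 1) (hX : ∀ n, ‖X n‖ ≤ C * r ^ n)
    (hs : Summable fun n => r ^ d 0 (g n)) (htriv : ∀ u ∈ U 0, χ u = 1) :
    HasSum (fun n => X (d 0 (g n)) * (((χ (g n))⁻¹ : Circle) : ℂ))
      (∫ q, X (d 0 q) * ((χ q)⁻¹ : Circle) ∂ν) := by
  refine hg.hasSum_integral (hU.isOpen 0) hν (hU.integrable hg hν hχ hC hr hr1 hX hs 0) ?_
  intro n q hq
  have := htriv _ hq
  rw [map_mul, map_inv, inv_mul_eq_one] at this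
  rw [hU.apply_of_mem hq, this]

end IsFiltration

/-- The hypotheses make V the disjoint union of W and the cosets t c W for c in S. -/
theorem measure_eq_mul_card {V W : Subgroup Q} (hW : IsOpen (W : Set Q)) (hWV : W ≤ V)
    {S : Finset ℕ} {t : ℕ → Q} (htV : ∀ c ∈ S, t c ∈ V) (htW : ∀ c ∈ S, t c ∉ W)
    (hne : ∀ c ∈ S, ∀ e ∈ S, c ≠ e → (t c)⁻¹ * t e ∉ W)
    (hex : ∀ q ∈ V, q ∉ W → ∃ c ∈ S, (t c)⁻¹ * q ∈ W) :
    ν.real (V : Set Q) = ν.real (W : Set Q) * (S.card + 1) := by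
  have hunion : (V : Set Q) = (W : Set Q) ∪ ⋃ c ∈ S, {q | (t c)⁻¹ * q ∈ W} := by
    ext q
    simp only [SetLike.mem_coe, Set.mem_union, Set.mem_iUnion, Set.mem_ofPred_eq, exists_prop]
    constructor
    · intro hq
      by_cases h : q ∈ W
      · exact Or.inl h
      · exact Or.inr (hex q hq h)
    · rintro (h | ⟨c, hc, h⟩)
      · exact hWV h
      · have := V.mul_mem (htV c hc) (hWV h)
        rwa [mul_inv_cancel_left] at this
  have hdisj : Disjoint (W : Set Q) (⋃ c ∈ S, {q | (t c)⁻¹ * q ∈ W}) := by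
    rw [Set.disjoint_left]
    intro q hq h
    simp only [Set.mem_iUnion, Set.mem_ofPred_eq, exists_prop] at h
    obtain ⟨c, hc, h⟩ := h
    apply htW c hc
    have := W.mul_mem hq (W.inv_mem h)
    rw [mul_inv_rev, inv_inv, mul_inv_cancel_left] at this
    exact this
  have hmeas : MeasurableSet (⋃ c ∈ S, {q | (t c)⁻¹ * q ∈ W}) :=
    (isOpen_biUnion fun c _ => isOpen_coset hW _).measurableSet
  have hpd : (S : Set ℕ).PairwiseDisjoint fun c => {q | (t c)⁻¹ * q ∈ W} := by
    intro c hc e he hce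
    rw [Function.onFun, Set.disjoint_left]
    intro q h1 h2
    apply hne c hc e he hce
    have := W.mul_mem h1 (W.inv_mem h2)
    convert this using 1
    group
  have key : ν (V : Set Q) = ν (W : Set Q) * (S.card + 1 : ℕ) := by
    rw [hunion, measure_union hdisj hmeas,
      measure_biUnion_finset hpd fun c _ => (isOpen_coset hW _).measurableSet]
    simp only [measure_coset, Finset.sum_const, nsmul_eq_mul]
    push_cast
    ring
  rw [Measure.real, key, ENNReal.toReal_mul, ENNReal.toReal_natCast, Measure.real]
  push_cast
  rfl

end Integration

/-! ### Quadratic algebras from bases -/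

section QuadraticBasis

variable {R S : Type*} [CommRing R] [CommRing S] [Algebra R S] {a b : R}

/-- A basis `1, ω` of the `R`-algebra `S` with `ω² = a + b ω`. -/
structure IsQuadraticBasis (a b : R) (B : Module.Basis (Fin 2) R S) : Prop where
  zero : B 0 = 1
  one_mul_one : B 1 * B 1 = a • 1 + b • B 1

variable {B : Module.Basis (Fin 2) R S}

/-- The algebra with basis `1, ω` is the quadratic algebra. -/
def IsQuadraticBasis.equiv (hB : IsQuadraticBasis a b B) : QuadraticAlgebra R a b ≃ₐ[R] S :=
  AlgEquiv.ofBijective (QuadraticAlgebra.lift ⟨B 1, hB.one_mul_one⟩) (by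
    have e : (QuadraticAlgebra.lift ⟨B 1, hB.one_mul_one⟩ : QuadraticAlgebra R a b →ₐ[R] S)
        = ((QuadraticAlgebra.linearEquivTuple a b).trans B.equivFun.symm :
          QuadraticAlgebra R a b → S) := by
      funext x
      rw [LinearEquiv.trans_apply, Module.Basis.equivFun_symm_apply, Fin.sum_univ_two]
      simp [hB.zero]
    rw [e]
    exact LinearEquiv.bijective _)

theorem IsQuadraticBasis.equiv_apply (hB : IsQuadraticBasis a b B) (x : QuadraticAlgebra R a b) :
    hB.equiv x = x.re • 1 + x.im • B 1 := rfl

theorem leftMulMatrix_basis (z : QuadraticAlgebra R a b) :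
    Algebra.leftMulMatrix (QuadraticAlgebra.basis a b) z
      = !![z.re, a * z.im; z.im, z.re + b * z.im] := by
  have hb0 : QuadraticAlgebra.basis a b 0 = 1 := by
    rw [QuadraticAlgebra.basis, Module.Basis.coe_ofEquivFun]
    ext <;> simp [QuadraticAlgebra.re_one, QuadraticAlgebra.im_one]
  have hb1 : QuadraticAlgebra.basis a b 1 = ⟨0, 1⟩ := by
    rw [QuadraticAlgebra.basis, Module.Basis.coe_ofEquivFun]
    ext <;> simp
  ext i j
  rw [Algebra.leftMulMatrix_eq_repr_mul, QuadraticAlgebra.basis_repr_apply]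
  fin_cases i <;> fin_cases j <;> simp [hb0, hb1]

theorem algebra_norm_eq (z : QuadraticAlgebra R a b) : Algebra.norm R z = z.norm := by
  rw [Algebra.norm_eq_matrix_det (QuadraticAlgebra.basis a b), leftMulMatrix_basis,
    Matrix.det_fin_two_of, QuadraticAlgebra.norm_def]
  ring

theorem algebra_trace_eq (z : QuadraticAlgebra R a b) :
    Algebra.trace R _ z = 2 * z.re + b * z.im := by
  rw [Algebra.trace_eq_matrix_trace (QuadraticAlgebra.basis a b), leftMulMatrix_basis,
    Matrix.trace_fin_two_of]
  ring

theorem IsQuadraticBasis.norm_equiv (hB : IsQuadraticBasis a b B) (z : QuadraticAlgebra R a b) :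
    Algebra.norm R (hB.equiv z) = z.norm := by
  rw [Algebra.norm_eq_of_algEquiv, algebra_norm_eq]

theorem IsQuadraticBasis.trace_equiv (hB : IsQuadraticBasis a b B) (z : QuadraticAlgebra R a b) :
    Algebra.trace R S (hB.equiv z) = 2 * z.re + b * z.im := by
  rw [Algebra.trace_eq_of_algEquiv, algebra_trace_eq]

theorem IsQuadraticBasis.discr_eq (hB : IsQuadraticBasis a b B) :
    Algebra.discr R B = b ^ 2 + 4 * a := by
  have h0 : B 0 = hB.equiv ⟨1, 0⟩ := by rw [hB.equiv_apply, hB.zero]; simp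
  have h1 : B 1 = hB.equiv ⟨0, 1⟩ := by rw [hB.equiv_apply]; simp
  rw [Algebra.discr_def, Matrix.det_fin_two]
  simp only [Algebra.traceMatrix_apply, Algebra.traceForm_apply]
  rw [h0, h1, ← map_mul hB.equiv, ← map_mul hB.equiv, ← map_mul hB.equiv, ← map_mul hB.equiv]
  simp only [hB.trace_equiv, QuadraticAlgebra.re_mul, QuadraticAlgebra.im_mul]
  ring

end QuadraticBasis

/-! ### An integral basis 1, ω of a quadratic field and its completion at p -/

section NumberField

variable {E : Type*} [Field E] [NumberField E]

/-- The element 1 is a primitive vector of the lattice 𝓞 E, and a primitive vector of a rank two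
lattice extends to a basis. -/
theorem exists_isQuadraticBasis (hE : Module.finrank ℚ E = 2) :
    ∃ (a b : ℤ) (B : Module.Basis (Fin 2) ℤ (𝓞 E)), IsQuadraticBasis a b B := by
  have hcard : Fintype.card (Module.Free.ChooseBasisIndex ℤ (𝓞 E)) = Fintype.card (Fin 2) := by
    rw [← Module.finrank_eq_card_chooseBasisIndex, RingOfIntegers.rank, hE, Fintype.card_fin]
  let e : Module.Basis (Fin 2) ℤ (𝓞 E) :=
    (RingOfIntegers.basis E).reindex (Fintype.equivOfCardEq hcard)
  set m := e.repr 1 0 with hm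
  set n := e.repr 1 1 with hn
  have h1 : (1 : 𝓞 E) = m • e 0 + n • e 1 := by
    conv_lhs => rw [← e.sum_repr 1, Fin.sum_univ_two]
  -- The gcd of the coordinates of 1 divides 1 in 𝓞 E; its norm is its square, so it is a unit of ℤ.
  have hcop : IsCoprime m n := by
    rw [Int.isCoprime_iff_gcd_eq_one]
    obtain ⟨m', hm'⟩ := Int.gcd_dvd_left m n
    obtain ⟨n', hn'⟩ := Int.gcd_dvd_right m n
    have hu : IsUnit (algebraMap ℤ (𝓞 E) (m.gcd n)) := by
      refine IsUnit.of_mul_eq_one (m' • e 0 + n' • e 1) ?_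
      rw [← Algebra.smul_def, smul_add, smul_smul, smul_smul, ← hm', ← hn', ← h1]
    have h2 := hu.map (Algebra.norm ℤ)
    rw [Algebra.norm_algebraMap_of_basis e, Fintype.card_fin, isUnit_pow_iff two_ne_zero,
      Int.isUnit_iff] at h2
    omega
  obtain ⟨u, v, huv⟩ := hcop
  -- The Bézout coefficients make the change of basis from e to (1, w) have determinant one.
  let w : 𝓞 E := (-v) • e 0 + u • e 1
  have he0 : e 0 = u • (1 : 𝓞 E) + (-n) • w := by
    have : e 0 = (u * m + v * n) • e 0 := by rw [huv, one_smul]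
    rw [h1]
    conv_lhs => rw [this]
    simp only [w]
    module
  have he1 : e 1 = v • (1 : 𝓞 E) + m • w := by
    have : e 1 = (u * m + v * n) • e 1 := by rw [huv, one_smul]
    rw [h1]
    conv_lhs => rw [this]
    simp only [w]
    module
  have hli : LinearIndependent ℤ ![(1 : 𝓞 E), w] := by
    rw [LinearIndependent.pair_iff]
    intro x y hxy
    have h2 : (x * m - y * v) • e 0 + (x * n + y * u) • e 1 = 0 := by
      rw [← hxy, h1]
      simp only [w]
      module
    have h3 := Fintype.linearIndependent_iff.1 e.linearIndependent
      ![x * m - y * v, x * n + y * u] (by simpa [Fin.sum_univ_two] using h2)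
    have h4 : x * m - y * v = 0 := h3 0
    have h5 : x * n + y * u = 0 := h3 1
    constructor
    · linear_combination (-x) * huv + u * h4 + v * h5
    · linear_combination (-y) * huv - n * h4 + m * h5
  have hsp : ⊤ ≤ Submodule.span ℤ (Set.range ![(1 : 𝓞 E), w]) := by
    rw [← e.span_eq, Submodule.span_le]
    have hone : (1 : 𝓞 E) ∈ Submodule.span ℤ (Set.range ![(1 : 𝓞 E), w]) :=
      Submodule.subset_span ⟨0, rfl⟩
    have hw : w ∈ Submodule.span ℤ (Set.range ![(1 : 𝓞 E), w]) :=
      Submodule.subset_span ⟨1, rfl⟩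
    rintro _ ⟨i, rfl⟩
    fin_cases i
    · change e 0 ∈ _
      rw [he0]
      exact add_mem (Submodule.smul_mem _ _ hone) (Submodule.smul_mem _ _ hw)
    · change e 1 ∈ _
      rw [he1]
      exact add_mem (Submodule.smul_mem _ _ hone) (Submodule.smul_mem _ _ hw)
  let B := Module.Basis.mk hli hsp
  have hB0 : B 0 = 1 := Module.Basis.mk_apply hli hsp 0
  refine ⟨B.repr (B 1 * B 1) 0, B.repr (B 1 * B 1) 1, B, hB0, ?_⟩
  conv_lhs => rw [← B.sum_repr (B 1 * B 1), Fin.sum_univ_two, hB0]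

variable {a b : ℤ} {B : Module.Basis (Fin 2) ℤ (𝓞 E)}

theorem IsQuadraticBasis.numberField_discr (hB : IsQuadraticBasis a b B) :
    discr E = b ^ 2 + 4 * a := by
  rw [← discr_eq_discr E B, hB.discr_eq]

/-- The `ℚ`-basis `1, ω` of `E`. -/
def rationalBasis (B : Module.Basis (Fin 2) ℤ (𝓞 E)) : Module.Basis (Fin 2) ℚ E :=
  B.localizationLocalization ℚ (nonZeroDivisors ℤ) E

theorem rationalBasis_apply (i : Fin 2) : rationalBasis B i = (B i : E) :=
  Module.Basis.localizationLocalization_apply _ _ _ _ _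

theorem IsQuadraticBasis.coe_mul (hB : IsQuadraticBasis a b B) :
    (B 1 : E) * (B 1 : E) = a + b * (B 1 : E) := by
  have h := congrArg (algebraMap (𝓞 E) E) hB.one_mul_one
  simp only [zsmul_eq_mul, map_add, map_mul, map_intCast, mul_one] at h
  exact h

theorem IsQuadraticBasis.rational (hB : IsQuadraticBasis a b B) :
    IsQuadraticBasis (a : ℚ) (b : ℚ) (rationalBasis B) := by
  refine ⟨?_, ?_⟩
  · rw [rationalBasis_apply, hB.zero, show ((1 : 𝓞 E) : E) = 1 from map_one (algebraMap (𝓞 E) E)]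
  · rw [rationalBasis_apply, hB.coe_mul, Algebra.smul_def, Algebra.smul_def]
    simp

variable (p : ℕ) [Fact p.Prime]

/-- The `ℚ_p`-basis `1, ω` of `E_p`. -/
def localBasis (B : Module.Basis (Fin 2) ℤ (𝓞 E)) : Module.Basis (Fin 2) ℚ_[p] (Ep p E) :=
  Algebra.TensorProduct.basis ℚ_[p] (rationalBasis B)

theorem localBasis_apply (i : Fin 2) :
    localBasis p B i = (1 : ℚ_[p]) ⊗ₜ[ℚ] (B i : E) := by
  rw [localBasis, Algebra.TensorProduct.basis_apply, rationalBasis_apply]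

theorem IsQuadraticBasis.localized (hB : IsQuadraticBasis a b B) :
    IsQuadraticBasis (a : ℚ_[p]) (b : ℚ_[p]) (localBasis p B) := by
  refine ⟨?_, ?_⟩
  · rw [localBasis_apply, hB.zero, show ((1 : 𝓞 E) : E) = 1 from map_one (algebraMap (𝓞 E) E)]
    rfl
  · rw [localBasis_apply, Algebra.TensorProduct.tmul_mul_tmul, hB.coe_mul, mul_one,
      TensorProduct.tmul_add, Algebra.smul_def, Algebra.smul_def]
    have h : ∀ (n : ℤ) (x : E), (1 : ℚ_[p]) ⊗ₜ[ℚ] ((n : E) * x)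
        = algebraMap ℚ_[p] (Ep p E) n * (1 : ℚ_[p]) ⊗ₜ[ℚ] x := by
      intro n x
      have : (n : E) * x = (n : ℚ) • x := by rw [Algebra.smul_def]; simp
      rw [this, ← TensorProduct.smul_tmul, Algebra.TensorProduct.algebraMap_apply,
        Algebra.TensorProduct.tmul_mul_tmul, one_mul, mul_one, Algebra.smul_def]
      simp
    rw [h]
    congr 1
    have := h a 1
    rw [mul_one] at this
    rw [this]
    rfl

/-- `E_p` as a quadratic algebra. -/
def IsQuadraticBasis.localEquiv (hB : IsQuadraticBasis a b B) : LocalAlg p a b ≃ₐ[ℚ_[p]] Ep p E :=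
  (hB.localized p).equiv

theorem IsQuadraticBasis.localEquiv_mk (hB : IsQuadraticBasis a b B) (c d : ℚ) :
    hB.localEquiv p ⟨c, d⟩ = (1 : ℚ_[p]) ⊗ₜ[ℚ] hB.rational.equiv ⟨c, d⟩ := by
  rw [IsQuadraticBasis.localEquiv, IsQuadraticBasis.equiv_apply, IsQuadraticBasis.equiv_apply,
    localBasis_apply, rationalBasis_apply, TensorProduct.tmul_add, ← TensorProduct.smul_tmul,
    ← TensorProduct.smul_tmul, Algebra.smul_def, Algebra.smul_def,
    Algebra.TensorProduct.algebraMap_apply, Algebra.TensorProduct.algebraMap_apply,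
    Algebra.TensorProduct.tmul_mul_tmul, Algebra.smul_def, Algebra.smul_def]
  simp

end NumberField

section PrimesAbove

/-! ### The primes above `p` -/

variable {p : ℕ} [Fact p.Prime] {E : Type*} [Field E] [NumberField E]
  {a b : ℤ} {B : Module.Basis (Fin 2) ℤ (𝓞 E)}

/-- Reduction modulo the prime `(p, ω - r)`. -/
def residueHom (hB : IsQuadraticBasis a b B) {r : ℤ} (hr : IsRootMod p a b r) :
    𝓞 E →ₐ[ℤ] ZMod p :=
  (QuadraticAlgebra.lift (R := ℤ) (A := ZMod p) ⟨(r : ZMod p), by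
    have := (ZMod.intCast_zmod_eq_zero_iff_dvd _ p).2 hr
    push_cast at this
    rw [zsmul_eq_mul, zsmul_eq_mul]
    linear_combination this⟩).comp hB.equiv.symm.toAlgHom

theorem residueHom_equiv (hB : IsQuadraticBasis a b B) {r : ℤ} (hr : IsRootMod p a b r)
    (x : QuadraticAlgebra ℤ a b) :
    residueHom hB hr (hB.equiv x) = ((x.re + x.im * r : ℤ) : ZMod p) := by
  simp [residueHom]

/-- The prime `(p, ω - r)`. -/
def rootPrime (hB : IsQuadraticBasis a b B) {r : ℤ} (hr : IsRootMod p a b r) : Ideal (𝓞 E) :=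
  RingHom.ker (residueHom hB hr)

theorem mem_rootPrime (hB : IsQuadraticBasis a b B) {r : ℤ} (hr : IsRootMod p a b r)
    (x : QuadraticAlgebra ℤ a b) :
    hB.equiv x ∈ rootPrime hB hr ↔ (p : ℤ) ∣ x.re + x.im * r := by
  rw [rootPrime, RingHom.mem_ker, residueHom_equiv, ZMod.intCast_zmod_eq_zero_iff_dvd]

theorem residueHom_surjective (hB : IsQuadraticBasis a b B) {r : ℤ} (hr : IsRootMod p a b r) :
    Function.Surjective (residueHom hB hr) := by
  intro y
  obtain ⟨n, rfl⟩ := ZMod.intCast_surjective y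
  exact ⟨n, by simp⟩

theorem rootPrime_isMaximal (hB : IsQuadraticBasis a b B) {r : ℤ} (hr : IsRootMod p a b r) :
    (rootPrime hB hr).IsMaximal :=
  RingHom.ker_isMaximal_of_surjective _ (residueHom_surjective hB hr)

theorem span_prime_isMaximal : (Ideal.span {(p : ℤ)}).IsMaximal := by
  have hp : Prime (p : ℤ) := Nat.prime_iff_prime_int.1 Fact.out
  exact ((Ideal.span_singleton_prime hp.ne_zero).2 hp).isMaximal (by simpa using hp.ne_zero)

theorem mem_primesAbove_iff {P : Ideal (𝓞 E)} :
    P ∈ primesAbove p E ↔ P.IsPrime ∧ (p : 𝓞 E) ∈ P := by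
  refine and_congr_right fun hP => ⟨fun h => ?_, fun h => ⟨?_⟩⟩
  · have h1 : (p : ℤ) ∈ P.under ℤ := by
      rw [← h.over]
      exact Ideal.mem_span_singleton_self _
    simpa [Ideal.mem_comap] using h1
  · refine span_prime_isMaximal.eq_of_le ?_ ?_
    · exact (Ideal.IsPrime.under ℤ P).ne_top
    · rw [Ideal.span_singleton_le_iff_mem, Ideal.mem_comap]
      simpa using h

theorem rootPrime_mem_primesAbove (hB : IsQuadraticBasis a b B) {r : ℤ}
    (hr : IsRootMod p a b r) : rootPrime hB hr ∈ primesAbove p E := by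
  refine mem_primesAbove_iff.2 ⟨(rootPrime_isMaximal hB hr).isPrime, ?_⟩
  rw [rootPrime, RingHom.mem_ker, map_natCast, ZMod.natCast_self]

theorem equiv_mk_eq (hB : IsQuadraticBasis a b B) (c d : ℤ) :
    hB.equiv ⟨c, d⟩ = (c : 𝓞 E) + d * B 1 := by
  rw [hB.equiv_apply, zsmul_eq_mul, zsmul_eq_mul, mul_one]

/-- The elements p and ω - r generate the maximal ideal `rootPrime`. -/
theorem rootPrime_eq_of_mem (hB : IsQuadraticBasis a b B) {r : ℤ} (hr : IsRootMod p a b r)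
    {P : Ideal (𝓞 E)} (hP : P ∈ primesAbove p E) (h : hB.equiv ⟨-r, 1⟩ ∈ P) :
    P = rootPrime hB hr := by
  obtain ⟨hP1, hP2⟩ := mem_primesAbove_iff.1 hP
  symm
  refine (rootPrime_isMaximal hB hr).eq_of_le hP1.ne_top fun x hx => ?_
  obtain ⟨⟨c, d⟩, rfl⟩ := hB.equiv.surjective x
  obtain ⟨k, hk⟩ := (mem_rootPrime hB hr _).1 hx
  have e : hB.equiv ⟨c, d⟩ = (p : 𝓞 E) * (k : 𝓞 E) + (d : 𝓞 E) * hB.equiv ⟨-r, 1⟩ := by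
    have hk' : (c : 𝓞 E) + d * r = p * k := by exact_mod_cast hk
    rw [equiv_mk_eq, equiv_mk_eq, ← hk']
    push_cast
    ring
  rw [e]
  exact P.add_mem (P.mul_mem_right _ hP2) (P.mul_mem_left _ h)

/-- The product (ω - r)(ω - (b - r)) is minus the value of the minimal polynomial at r, a multiple
of p, so P contains one factor. -/
theorem eq_rootPrime_or (hB : IsQuadraticBasis a b B) {r : ℤ} (hr : IsRootMod p a b r)
    {P : Ideal (𝓞 E)} (hP : P ∈ primesAbove p E) :
    P = rootPrime hB hr ∨ P = rootPrime hB hr.conj := by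
  obtain ⟨hP1, hP2⟩ := mem_primesAbove_iff.1 hP
  have h : hB.equiv ⟨-r, 1⟩ * hB.equiv ⟨-(b - r), 1⟩ ∈ P := by
    obtain ⟨k, hk⟩ := hr
    have e : hB.equiv ⟨-r, 1⟩ * hB.equiv ⟨-(b - r), 1⟩ = (p : 𝓞 E) * ((-k : ℤ) : 𝓞 E) := by
      have h0 := hB.one_mul_one
      rw [zsmul_eq_mul, zsmul_eq_mul, mul_one] at h0
      have hk' : (r : 𝓞 E) ^ 2 - b * r - a = p * k := by exact_mod_cast hk
      rw [equiv_mk_eq, equiv_mk_eq]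
      push_cast
      linear_combination h0 - hk'
    rw [e]
    exact P.mul_mem_right _ hP2
  rcases hP1.mem_or_mem h with h | h
  · exact Or.inl (rootPrime_eq_of_mem hB hr hP h)
  · exact Or.inr (rootPrime_eq_of_mem hB hr.conj hP h)

theorem absNorm_rootPrime (hB : IsQuadraticBasis a b B) {r : ℤ} (hr : IsRootMod p a b r) :
    Ideal.absNorm (rootPrime hB hr) = p := by
  rw [Ideal.absNorm_apply, Submodule.cardQuot_apply]
  have e := RingHom.quotientKerEquivOfSurjective
    (f := (residueHom hB hr : 𝓞 E →+* ZMod p)) (residueHom_surjective hB hr)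
  exact (Nat.card_congr e.toEquiv).trans (Nat.card_zmod p)

theorem inertiaDeg_rootPrime (hB : IsQuadraticBasis a b B) {r : ℤ} (hr : IsRootMod p a b r) :
    (rootPrime hB hr).inertiaDeg ℤ = 1 := by
  have h := rootPrime_mem_primesAbove hB hr
  have := h.1
  have := h.2
  have e := Ideal.pow_inertiaDeg p (rootPrime hB hr)
  rw [absNorm_rootPrime] at e
  exact Nat.pow_right_injective (Fact.out : p.Prime).two_le (e.trans (pow_one p).symm)

theorem mem_span_prime_iff (hB : IsQuadraticBasis a b B) (x : QuadraticAlgebra ℤ a b) :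
    hB.equiv x ∈ Ideal.span {(p : 𝓞 E)} ↔ (p : ℤ) ∣ x.re ∧ (p : ℤ) ∣ x.im := by
  rw [Ideal.mem_span_singleton]
  constructor
  · rintro ⟨y, hy⟩
    obtain ⟨y, rfl⟩ := hB.equiv.surjective y
    have : x = p • y := by
      apply hB.equiv.injective
      rw [hy, map_nsmul, nsmul_eq_mul]
    rw [this, QuadraticAlgebra.re_smul, QuadraticAlgebra.im_smul, nsmul_eq_mul, nsmul_eq_mul]
    exact ⟨dvd_mul_right _ _, dvd_mul_right _ _⟩
  · rintro ⟨⟨c, hc⟩, d, hd⟩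
    refine ⟨hB.equiv ⟨c, d⟩, ?_⟩
    rw [← nsmul_eq_mul, ← map_nsmul]
    congr 1
    ext <;> simp [hc, hd]

/-- Without a root the norm form is anisotropic modulo p: otherwise -re/im would be a root. -/
theorem dvd_of_dvd_norm (h : ∀ r, ¬ IsRootMod p a b r) (x : QuadraticAlgebra ℤ a b)
    (hx : (p : ℤ) ∣ x.norm) : (p : ℤ) ∣ x.re ∧ (p : ℤ) ∣ x.im := by
  have hN := (ZMod.intCast_zmod_eq_zero_iff_dvd _ p).2 hx
  rw [QuadraticAlgebra.norm_def] at hN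
  push_cast at hN
  have him : (x.im : ZMod p) = 0 := by
    by_contra hne
    obtain ⟨r, hr⟩ := ZMod.intCast_surjective (-(x.re : ZMod p) / (x.im : ZMod p))
    apply h r
    rw [IsRootMod, ← ZMod.intCast_zmod_eq_zero_iff_dvd]
    push_cast
    rw [hr]
    field_simp
    linear_combination hN
  refine ⟨?_, (ZMod.intCast_zmod_eq_zero_iff_dvd _ p).1 him⟩
  rw [him] at hN
  rw [← ZMod.intCast_zmod_eq_zero_iff_dvd]
  simpa using hN

theorem algebraMap_norm_eq (hB : IsQuadraticBasis a b B) (x : QuadraticAlgebra ℤ a b) :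
    ((x.norm : ℤ) : 𝓞 E) = hB.equiv x * hB.equiv (star x) := by
  rw [← map_mul, ← QuadraticAlgebra.algebraMap_norm_eq_mul_star, AlgEquiv.commutes]
  rfl

theorem span_prime_isPrime_of_no_root (hB : IsQuadraticBasis a b B)
    (h : ∀ r, ¬ IsRootMod p a b r) : (Ideal.span {(p : 𝓞 E)}).IsPrime := by
  have hp : Prime (p : ℤ) := Nat.prime_iff_prime_int.1 Fact.out
  refine ⟨?_, ?_⟩
  · rw [Ideal.ne_top_iff_one]
    intro h1
    have e : (1 : 𝓞 E) = hB.equiv 1 := (map_one _).symm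
    rw [e, mem_span_prime_iff] at h1
    exact hp.not_dvd_one h1.1
  · intro x y hxy
    obtain ⟨x, rfl⟩ := hB.equiv.surjective x
    obtain ⟨y, rfl⟩ := hB.equiv.surjective y
    rw [← map_mul, mem_span_prime_iff] at hxy
    have h1 : (p : ℤ) ∣ (x * y).norm := by
      rw [QuadraticAlgebra.norm_def]
      exact dvd_sub (dvd_add (hxy.1.mul_left _) (hxy.2.mul_left _)) (hxy.2.mul_left _)
    rw [map_mul, hp.dvd_mul] at h1
    rw [mem_span_prime_iff, mem_span_prime_iff]
    exact h1.imp (dvd_of_dvd_norm h x) (dvd_of_dvd_norm h y)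

theorem primesAbove_of_no_root (hB : IsQuadraticBasis a b B) (h : ∀ r, ¬ IsRootMod p a b r) :
    primesAbove p E = {Ideal.span {(p : 𝓞 E)}} := by
  ext P
  rw [mem_primesAbove_iff, Set.mem_singleton_iff]
  constructor
  · rintro ⟨hP1, hP2⟩
    refine le_antisymm (fun x hx => ?_) ((Ideal.span_singleton_le_iff_mem _).2 hP2)
    obtain ⟨x, rfl⟩ := hB.equiv.surjective x
    rw [mem_span_prime_iff]
    apply dvd_of_dvd_norm h
    have h1 : ((x.norm : ℤ) : 𝓞 E) ∈ P := by
      rw [algebraMap_norm_eq hB]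
      exact P.mul_mem_right _ hx
    have hmem : P ∈ primesAbove p E := mem_primesAbove_iff.2 ⟨hP1, hP2⟩
    have h2 : x.norm ∈ P.under ℤ := by
      rw [Ideal.mem_comap]
      simpa using h1
    rw [← hmem.2.over, Ideal.mem_span_singleton] at h2
    exact h2
  · rintro rfl
    exact ⟨span_prime_isPrime_of_no_root hB h, Ideal.mem_span_singleton_self _⟩

theorem inertiaDeg_span_prime (hB : IsQuadraticBasis a b B) (h : ∀ r, ¬ IsRootMod p a b r) :
    (Ideal.span {(p : 𝓞 E)}).inertiaDeg ℤ = 2 := by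
  have hmem : Ideal.span {(p : 𝓞 E)} ∈ primesAbove p E := by
    rw [primesAbove_of_no_root hB h]; rfl
  have := hmem.1
  have := hmem.2
  have e := Ideal.pow_inertiaDeg p (Ideal.span {(p : 𝓞 E)})
  have h1 : (p : 𝓞 E) = algebraMap ℤ (𝓞 E) p := by simp
  rw [Ideal.absNorm_span_singleton, h1, Algebra.norm_algebraMap_of_basis B, Fintype.card_fin,
    Int.natAbs_pow, Int.natAbs_natCast, ← h1] at e
  exact Nat.pow_right_injective (Fact.out : p.Prime).two_le e

theorem splittingSign_of_no_root (hB : IsQuadraticBasis a b B) (h : ∀ r, ¬ IsRootMod p a b r) :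
    splittingSign p E = -1 := by
  rw [splittingSign, if_neg, if_pos (span_prime_isPrime_of_no_root hB h)]
  rw [primesAbove_of_no_root hB h, Set.ncard_singleton]
  norm_num

theorem rootPrime_conj_eq (hB : IsQuadraticBasis a b B) {r : ℤ} (hr : IsRootMod p a b r)
    (h : (p : ℤ) ∣ b - r - r) : rootPrime hB hr.conj = rootPrime hB hr := by
  refine rootPrime_eq_of_mem hB hr (rootPrime_mem_primesAbove hB _) ?_
  rw [mem_rootPrime]
  convert h using 1
  ring

theorem rootPrime_conj_ne (hB : IsQuadraticBasis a b B) {r : ℤ} (hr : IsRootMod p a b r)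
    (h : ¬ (p : ℤ) ∣ b - r - r) : rootPrime hB hr.conj ≠ rootPrime hB hr := by
  intro he
  apply h
  have h1 : hB.equiv ⟨-r, 1⟩ ∈ rootPrime hB hr := by
    rw [mem_rootPrime]
    simp
  rw [← he, mem_rootPrime] at h1
  convert h1 using 1
  ring

theorem primesAbove_of_double_root (hB : IsQuadraticBasis a b B) {r : ℤ}
    (hr : IsRootMod p a b r) (h : (p : ℤ) ∣ b - r - r) :
    primesAbove p E = {rootPrime hB hr} := by
  ext P
  rw [Set.mem_singleton_iff]
  refine ⟨fun hP => ?_, ?_⟩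
  · rcases eq_rootPrime_or hB hr hP with h1 | h1
    · exact h1
    · rw [h1, rootPrime_conj_eq hB hr h]
  · rintro rfl
    exact rootPrime_mem_primesAbove hB hr

theorem primesAbove_of_two_roots (hB : IsQuadraticBasis a b B) {r : ℤ}
    (hr : IsRootMod p a b r) :
    primesAbove p E = {rootPrime hB hr, rootPrime hB hr.conj} := by
  ext P
  rw [Set.mem_insert_iff, Set.mem_singleton_iff]
  refine ⟨fun hP => eq_rootPrime_or hB hr hP, ?_⟩
  rintro (rfl | rfl)
  · exact rootPrime_mem_primesAbove hB hr
  · exact rootPrime_mem_primesAbove hB hr.conj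

theorem splittingSign_of_double_root (hB : IsQuadraticBasis a b B) {r : ℤ}
    (hr : IsRootMod p a b r) (h : (p : ℤ) ∣ b - r - r) : splittingSign p E = 0 := by
  have hp : Prime (p : ℤ) := Nat.prime_iff_prime_int.1 Fact.out
  rw [splittingSign, if_neg, if_neg]
  -- If (p) were prime it would be the only prime above p, `rootPrime`, which contains ω - r; but ω
  -- - r is not divisible by p.
  · intro hP
    have hmem : Ideal.span {(p : 𝓞 E)} ∈ primesAbove p E :=
      mem_primesAbove_iff.2 ⟨hP, Ideal.mem_span_singleton_self _⟩
    rw [primesAbove_of_double_root hB hr h, Set.mem_singleton_iff] at hmem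
    have h1 : hB.equiv ⟨-r, 1⟩ ∈ rootPrime hB hr := by
      rw [mem_rootPrime]
      simp
    rw [← hmem, mem_span_prime_iff] at h1
    exact hp.not_dvd_one h1.2
  · rw [primesAbove_of_double_root hB hr h, Set.ncard_singleton]
    norm_num

theorem splittingSign_of_two_roots (hB : IsQuadraticBasis a b B) {r : ℤ}
    (hr : IsRootMod p a b r) (h : ¬ (p : ℤ) ∣ b - r - r) : splittingSign p E = 1 := by
  rw [splittingSign, if_pos]
  rw [primesAbove_of_two_roots hB hr, Set.ncard_pair (rootPrime_conj_ne hB hr h).symm]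

/-! ### Prime elements -/

/-- With (x) = P·J and N(P) = p, the cofactor m is ± N(J). It is prime to p, since a prime above p
dividing J is either P, excluded by x ∉ P², or another one, excluded by the choice of x. -/
theorem exists_of_isPrimeElementAt (hB : IsQuadraticBasis a b B) {r : ℤ}
    (hr : IsRootMod p a b r) {t : Eˣ} (ht : IsPrimeElementAt p (rootPrime hB hr) t) :
    ∃ x : QuadraticAlgebra ℤ a b, ((hB.equiv x : 𝓞 E) : E) = t ∧ (p : ℤ) ∣ x.re + x.im * r ∧
      (∃ m : ℤ, x.norm = p * m ∧ ¬ (p : ℤ) ∣ m) ∧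
      (¬ (p : ℤ) ∣ b - r - r → ¬ (p : ℤ) ∣ x.re + x.im * (b - r)) := by
  obtain ⟨x, hxt, hxP, hxP2, hxQ⟩ := ht
  obtain ⟨x, rfl⟩ := hB.equiv.surjective x
  refine ⟨x, hxt, (mem_rootPrime hB hr x).1 hxP, ?_, fun h => ?_⟩
  · have hp : Prime (p : ℤ) := Nat.prime_iff_prime_int.1 Fact.out
    have hp0 : p ≠ 0 := (Fact.out : p.Prime).ne_zero
    obtain ⟨J, hJ⟩ := Ideal.dvd_span_singleton.2 hxP
    have hN := congrArg Ideal.absNorm hJ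
    rw [Ideal.absNorm_span_singleton, hB.norm_equiv, map_mul, absNorm_rootPrime] at hN
    have hJp : ¬ (p : ℤ) ∣ (Ideal.absNorm J : ℤ) := by
      intro hdvd
      obtain ⟨Q, hQ1, hQ2, hQ3⟩ := Ideal.exists_isMaximal_dvd_of_dvd_absNorm hp J hdvd
      by_cases hQP : Q = rootPrime hB hr
      · apply hxP2
        rw [← Ideal.dvd_span_singleton, hJ, sq]
        rw [hQP] at hQ3
        exact mul_dvd_mul_left _ hQ3
      · refine hxQ Q ⟨hQ1.isPrime, ⟨hQ2.symm⟩⟩ hQP ?_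
        rw [← Ideal.dvd_span_singleton, hJ]
        exact hQ3.mul_left _
    rcases Int.natAbs_eq x.norm with h | h
    · refine ⟨Ideal.absNorm J, ?_, hJp⟩
      rw [h, hN]
      push_cast
      rfl
    · refine ⟨-Ideal.absNorm J, ?_, by rwa [dvd_neg]⟩
      rw [h, hN]
      push_cast
      ring
  · rw [← mem_rootPrime hB hr.conj]
    exact hxQ _ (rootPrime_mem_primesAbove hB hr.conj) (rootPrime_conj_ne hB hr h)

/-- The isomorphism of `E_p^×` with the unit group of the local quadratic algebra. -/
def localUnits (p : ℕ) [Fact p.Prime] (hB : IsQuadraticBasis a b B) :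
    (Ep p E)ˣ ≃* (LocalAlg p a b)ˣ :=
  Units.mapEquiv (hB.localEquiv p).symm.toRingEquiv.toMulEquiv

theorem coe_localUnits (hB : IsQuadraticBasis a b B) (s : (Ep p E)ˣ) :
    (localUnits p hB s : LocalAlg p a b) = (hB.localEquiv p).symm (s : Ep p E) := rfl

theorem coe_localUnits_unitsToEp (hB : IsQuadraticBasis a b B) {t : Eˣ}
    {x : QuadraticAlgebra ℤ a b} (hx : ((hB.equiv x : 𝓞 E) : E) = t) :
    (localUnits p hB (unitsToEp p t) : LocalAlg p a b) = ⟨x.re, x.im⟩ := by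
  rw [coe_localUnits, AlgEquiv.symm_apply_eq]
  have h := hB.localEquiv_mk p x.re x.im
  rw [Rat.cast_intCast, Rat.cast_intCast] at h
  rw [h]
  change (1 : ℚ_[p]) ⊗ₜ[ℚ] (t : E) = _
  rw [← hx]
  congr 1
  rw [hB.equiv_apply, hB.rational.equiv_apply, rationalBasis_apply]
  simp only [mul_one, map_add, map_mul, map_intCast, Algebra.smul_def, eq_intCast]

theorem isLocalPrime_of_isPrimeElementAt (hB : IsQuadraticBasis a b B) {r : ℤ}
    (hr : IsRootMod p a b r) {t : Eˣ} (ht : IsPrimeElementAt p (rootPrime hB hr) t) :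
    IsLocalPrime r (localUnits p hB (unitsToEp p t)) ∧
      (¬ (p : ℤ) ∣ b - r - r →
        ¬ MemPrime (b - r) (localUnits p hB (unitsToEp p t) : LocalAlg p a b)) := by
  obtain ⟨x, hx, h1, ⟨m, hm, hpm⟩, h2⟩ := exists_of_isPrimeElementAt hB hr ht
  have e := coe_localUnits_unitsToEp (p := p) hB hx
  refine ⟨⟨⟨?_, ?_⟩, ?_⟩, fun h h3 => h2 h ?_⟩
  · rw [e, gauge_zero_le_iff]
    exact ⟨Padic.norm_int_le_one _, Padic.norm_int_le_one _⟩
  · rw [e]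
    have := (Padic.norm_intCast_lt_one_iff (p := p)).2 h1
    push_cast at this
    rwa [mul_comm (r : ℚ_[p])]
  · have hN : (localUnits p hB (unitsToEp p t) : LocalAlg p a b).norm
        = ((p * m : ℤ) : ℚ_[p]) := by
      rw [e, ← hm, QuadraticAlgebra.norm_def, QuadraticAlgebra.norm_def]
      push_cast
      rfl
    rw [hN]
    push_cast
    rw [norm_mul, Padic.norm_p]
    have : ‖(m : ℚ_[p])‖ = 1 := by
      refine (Padic.norm_int_le_one m).antisymm (not_lt.1 fun h => hpm ?_)
      exact (Padic.norm_intCast_lt_one_iff).1 h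
    rw [this, mul_one]
  · have := h3.2
    rw [e] at this
    rw [← Padic.norm_intCast_lt_one_iff (p := p)]
    push_cast
    push_cast at this
    rwa [mul_comm (x.im : ℚ_[p])]

end PrimesAbove

section ToralFiltration

/-! ### The filtration of `ℚ_p^× \ E_p^×` by the unit groups of the orders -/

variable {p : ℕ} [Fact p.Prime] {E : Type*} [Field E] [NumberField E]
  {a b : ℤ} {B : Module.Basis (Fin 2) ℤ (𝓞 E)}

theorem mem_integersEp_iff (hB : IsQuadraticBasis a b B) (y : LocalAlg p a b) :
    hB.localEquiv p y ∈ integersEp p E ↔ gauge 0 y ≤ 1 := by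
  constructor
  · intro h
    suffices H : ∀ x ∈ integersEp p E, gauge 0 ((hB.localEquiv p).symm x) ≤ 1 by
      simpa using H _ h
    intro x hx
    refine Submodule.span_induction ?_ ?_ ?_ ?_ hx
    · rintro _ ⟨x, rfl⟩
      obtain ⟨x, rfl⟩ := hB.equiv.surjective x
      have e : (hB.localEquiv p).symm ((1 : ℚ_[p]) ⊗ₜ[ℚ] ((hB.equiv x : 𝓞 E) : E))
          = ⟨x.re, x.im⟩ := by
        rw [AlgEquiv.symm_apply_eq]
        have h := hB.localEquiv_mk p x.re x.im
        rw [Rat.cast_intCast, Rat.cast_intCast] at h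
        rw [h]
        congr 1
        rw [hB.equiv_apply, hB.rational.equiv_apply, rationalBasis_apply]
        simp only [mul_one, map_add, map_mul, map_intCast, Algebra.smul_def, eq_intCast]
      simp only [e]
      exact gauge_zero_le_iff.2 ⟨Padic.norm_int_le_one _, Padic.norm_int_le_one _⟩
    · simp [gauge]
    · intro x y _ _ hx hy
      rw [gauge_zero_le_iff] at hx hy
      rw [map_add, gauge_zero_le_iff, QuadraticAlgebra.re_add, QuadraticAlgebra.im_add]
      exact ⟨norm_add_le_of_le hx.1 hy.1, norm_add_le_of_le hx.2 hy.2⟩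
    · intro c x _ hx
      have : c • x = (c : ℚ_[p]) • x := rfl
      rw [this, map_smul, gauge_smul]
      exact mul_le_one₀ (PadicInt.norm_le_one c) (gauge_nonneg _ _) hx
  · intro h
    rw [gauge_zero_le_iff] at h
    obtain ⟨c, hc⟩ : ∃ c : ℤ_[p], (c : ℚ_[p]) = y.re := ⟨⟨_, h.1⟩, rfl⟩
    obtain ⟨d, hd⟩ : ∃ d : ℤ_[p], (d : ℚ_[p]) = y.im := ⟨⟨_, h.2⟩, rfl⟩
    have e : hB.localEquiv p y = c • localBasis p B 0 + d • localBasis p B 1 := by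
      have h1 : hB.localEquiv p y = y.re • (1 : Ep p E) + y.im • localBasis p B 1 :=
        (hB.localized p).equiv_apply y
      rw [h1, (hB.localized p).zero, ← hc, ← hd]
      rfl
    rw [e, localBasis_apply, localBasis_apply]
    exact add_mem (Submodule.smul_mem _ _ (Submodule.subset_span ⟨_, rfl⟩))
      (Submodule.smul_mem _ _ (Submodule.subset_span ⟨_, rfl⟩))

/-- Identifies the order of the statement with the unit ball of `gauge i`: the ω-coordinate must be
divisible by p^i, and the integral re is absorbed into ℤ_p. -/
theorem mem_orderEp_iff (hB : IsQuadraticBasis a b B) (i : ℕ) (x : LocalAlg p a b) :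
    hB.localEquiv p x ∈ orderEp p E i ↔ gauge i x ≤ 1 := by
  have hp := prime_cast_pos (p := p)
  have hpi : (0 : ℝ) < (p : ℝ) ^ i := pow_pos hp i
  have hp0 := pow_ne_zero i (padic_prime_ne_zero (p := p))
  have hpw : ∀ z : LocalAlg p a b, (p : LocalAlg p a b) ^ i * z = (p : ℚ_[p]) ^ i • z := by
    intro z
    rw [Algebra.smul_def, map_pow, map_natCast]
  constructor
  · rintro ⟨c, y, hy, hx⟩
    obtain ⟨y, rfl⟩ := (hB.localEquiv p).surjective y
    rw [mem_integersEp_iff, gauge_zero_le_iff] at hy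
    have e : x = algebraMap ℚ_[p] (LocalAlg p a b) c + (p : ℚ_[p]) ^ i • y := by
      apply (hB.localEquiv p).injective
      rw [hx, map_add, AlgEquiv.commutes, ← hpw, map_mul, map_pow, map_natCast]
    rw [e, gauge_le_iff, QuadraticAlgebra.re_add, QuadraticAlgebra.im_add,
      QuadraticAlgebra.algebraMap_eq, QuadraticAlgebra.re_smul, QuadraticAlgebra.im_smul, zero_add,
      smul_eq_mul, smul_eq_mul, norm_mul, norm_p_pow, mul_inv_cancel_left₀ hpi.ne']
    refine ⟨norm_add_le_of_le (PadicInt.norm_le_one c) ?_, hy.2⟩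
    rw [norm_mul, norm_p_pow]
    exact mul_le_one₀ (inv_le_one_of_one_le₀ (one_le_prime_pow i)) (norm_nonneg _) hy.1
  · intro h
    rw [gauge_le_iff] at h
    refine ⟨⟨x.re, h.1⟩, hB.localEquiv p ⟨0, x.im / (p : ℚ_[p]) ^ i⟩, ?_, ?_⟩
    · rw [mem_integersEp_iff, gauge_zero_le_iff, norm_zero, norm_div, norm_p_pow, div_inv_eq_mul,
        mul_comm]
      exact ⟨zero_le_one, h.2⟩
    · have h1 : (p : Ep p E) ^ i * hB.localEquiv p ⟨0, x.im / (p : ℚ_[p]) ^ i⟩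
          = hB.localEquiv p ⟨0, x.im⟩ := by
        rw [← map_natCast (hB.localEquiv p), ← map_pow, ← map_mul, hpw]
        congr 1
        ext
        · simp
        · simp only [QuadraticAlgebra.im_smul, smul_eq_mul]
          field_simp
      have h2 : algebraMap ℚ_[p] (Ep p E) x.re
          = hB.localEquiv p (algebraMap ℚ_[p] (LocalAlg p a b) x.re) := by
        rw [AlgEquiv.commutes]
      rw [h1]
      refine Eq.trans ?_ (congrArg₂ (· + ·) h2.symm rfl)
      rw [← map_add]
      congr 1
      ext <;> simp [QuadraticAlgebra.algebraMap_eq]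

theorem mem_orderUnits_iff (hB : IsQuadraticBasis a b B) (i : ℕ) (s : (Ep p E)ˣ) :
    s ∈ orderUnits p E i ↔ gauge i (localUnits p hB s : LocalAlg p a b) ≤ 1 ∧
      gauge i ((localUnits p hB s)⁻¹ : (LocalAlg p a b)ˣ).1 ≤ 1 := by
  rw [← map_inv, coe_localUnits, coe_localUnits, ← mem_orderEp_iff hB, ← mem_orderEp_iff hB,
    AlgEquiv.apply_symm_apply, AlgEquiv.apply_symm_apply]
  rfl

/-- If both s and s⁻¹ have gauge at most 1, the norm of s has absolute value at least 1, and
`norm_norm_le` leaves only equalities. -/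
theorem mem_orderUnits_iff' (hB : IsQuadraticBasis a b B) (i : ℕ) (s : (Ep p E)ˣ) :
    s ∈ orderUnits p E i ↔ gauge i (localUnits p hB s : LocalAlg p a b) = 1 ∧
      localUnits p hB s ∈ orderStab p a b i := by
  rw [mem_orderUnits_iff hB]
  set u := localUnits p hB s
  have h1 := norm_norm_le i (u : LocalAlg p a b)
  have h2 := norm_norm_le i ((u⁻¹ : (LocalAlg p a b)ˣ) : LocalAlg p a b)
  have h3 := gauge_nonneg i (u : LocalAlg p a b)
  have h4 := gauge_nonneg i ((u⁻¹ : (LocalAlg p a b)ˣ) : LocalAlg p a b)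
  have hN := norm_pos_iff.2 (unit_norm_ne_zero u)
  constructor
  · rintro ⟨h5, h6⟩
    rw [norm_norm_inv] at h2
    have h7 : ‖(u : LocalAlg p a b).norm‖⁻¹ ≤ 1 := h2.trans (pow_le_one₀ h4 h6)
    have h8 : 1 ≤ ‖(u : LocalAlg p a b).norm‖ := (inv_le_one₀ hN).1 h7
    have h9 : gauge i (u : LocalAlg p a b) = 1 := by nlinarith
    refine ⟨h9, mem_orderStab_of_le ?_⟩
    rw [h9, one_pow]
    exact h8
  · rintro ⟨h5, h6⟩
    rw [mem_orderStab, h5] at h6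
    rw [gauge_inv, h5, h6]
    simp

theorem localUnits_scalar (hB : IsQuadraticBasis a b B) (c : ℚ_[p]ˣ) :
    localUnits p hB (Units.map (algebraMap ℚ_[p] (Ep p E) : ℚ_[p] →* Ep p E) c)
      = Units.map (algebraMap ℚ_[p] (LocalAlg p a b) : ℚ_[p] →* LocalAlg p a b) c := by
  ext1
  rw [coe_localUnits, AlgEquiv.symm_apply_eq]
  exact ((hB.localEquiv p).commutes _).symm

theorem localUnits_mem_of_scalar (hB : IsQuadraticBasis a b B) (i : ℕ) {s : (Ep p E)ˣ}
    (hs : s ∈ scalars p E) : localUnits p hB s ∈ orderStab p a b i := by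
  obtain ⟨c, rfl⟩ := hs
  rw [localUnits_scalar]
  exact scalar_mem_orderStab i c

/-- The image of `𝒪_{E_p,i}^×` in `ℚ_p^× \ E_p^×`. -/
def unitFiltration (p : ℕ) [Fact p.Prime] (hB : IsQuadraticBasis a b B) (i : ℕ) :
    Subgroup (ToralQuotient p E) :=
  ((orderStab p a b i).comap (localUnits p hB).toMonoidHom).map (QuotientGroup.mk' (scalars p E))

/-- Scalars lie in `orderStab` at every level, so the choice of representative is immaterial. -/
theorem mk_mem_unitFiltration (hB : IsQuadraticBasis a b B) (i : ℕ) (s : (Ep p E)ˣ) :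
    (QuotientGroup.mk s : ToralQuotient p E) ∈ unitFiltration p hB i
      ↔ localUnits p hB s ∈ orderStab p a b i := by
  rw [unitFiltration, Subgroup.mem_map]
  constructor
  · rintro ⟨t, ht, hts⟩
    have h : t⁻¹ * s ∈ scalars p E := QuotientGroup.eq.1 hts
    have h1 := localUnits_mem_of_scalar hB i h
    have ht' : localUnits p hB t ∈ orderStab p a b i := Subgroup.mem_comap.1 ht
    have e : localUnits p hB s = localUnits p hB t * localUnits p hB (t⁻¹ * s) := by
      rw [← map_mul, mul_inv_cancel_left]
    rw [e]
    exact mul_mem ht' h1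
  · intro h
    exact ⟨s, Subgroup.mem_comap.2 h, rfl⟩

/-- The relative position of `s 𝒪` and `𝒪` for the class of `s`. -/
def quotientPosition (p : ℕ) [Fact p.Prime] (hB : IsQuadraticBasis a b B) (i : ℕ)
    (q : ToralQuotient p E) : ℕ := relativePosition i (localUnits p hB q.out)

theorem quotientPosition_mk (hB : IsQuadraticBasis a b B) (i : ℕ) (s : (Ep p E)ˣ) :
    quotientPosition p hB i (QuotientGroup.mk s) = relativePosition i (localUnits p hB s) := by
  have h : s⁻¹ * (QuotientGroup.mk s : ToralQuotient p E).out ∈ scalars p E := by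
    rw [← QuotientGroup.eq]
    exact (QuotientGroup.out_eq' _).symm
  have h1 := localUnits_mem_of_scalar hB i h
  rw [quotientPosition, ← relativePosition_mul_left h1 (localUnits p hB s), ← map_mul]
  congr 2
  rw [mul_right_comm, inv_mul_cancel, one_mul]

theorem continuous_re (hB : IsQuadraticBasis a b B) :
    Continuous fun x : Ep p E => ((hB.localEquiv p).symm x).re :=
  IsModuleTopology.continuous_of_linearMap
    ((QuadraticAlgebra.reₗ (a : ℚ_[p]) (b : ℚ_[p])).comp (hB.localEquiv p).symm.toLinearMap)

theorem continuous_im (hB : IsQuadraticBasis a b B) :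
    Continuous fun x : Ep p E => ((hB.localEquiv p).symm x).im :=
  IsModuleTopology.continuous_of_linearMap
    ((QuadraticAlgebra.imₗ (a : ℚ_[p]) (b : ℚ_[p])).comp (hB.localEquiv p).symm.toLinearMap)

theorem isOpen_orderEp (hB : IsQuadraticBasis a b B) (i : ℕ) : IsOpen (orderEp p E i) := by
  have e : orderEp p E i = (fun x => ((hB.localEquiv p).symm x).re) ⁻¹' Metric.closedBall 0 1 ∩
      (fun x => ((hB.localEquiv p).symm x).im) ⁻¹' Metric.closedBall 0 ((p : ℝ) ^ i)⁻¹ := by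
    have hpi : (0 : ℝ) < (p : ℝ) ^ i := pow_pos prime_cast_pos i
    ext x
    obtain ⟨x, rfl⟩ := (hB.localEquiv p).surjective x
    rw [mem_orderEp_iff, gauge_le_iff, Set.mem_inter_iff, Set.mem_preimage, Set.mem_preimage,
      mem_closedBall_zero_iff, mem_closedBall_zero_iff, AlgEquiv.symm_apply_apply,
      ← one_div, le_div_iff₀ hpi, mul_comm]
  rw [e]
  refine IsOpen.inter ?_ ?_
  · exact (IsUltrametricDist.isOpen_closedBall 0 one_ne_zero).preimage (continuous_re hB)
  · exact (IsUltrametricDist.isOpen_closedBall 0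
      (inv_ne_zero (pow_ne_zero i prime_cast_pos.ne'))).preimage (continuous_im hB)

theorem isOpen_orderUnits (hB : IsQuadraticBasis a b B) (i : ℕ) :
    IsOpen (orderUnits p E i) :=
  ((isOpen_orderEp hB i).preimage Units.continuous_val).inter
    ((isOpen_orderEp hB i).preimage (Units.continuous_val.comp continuous_inv))

theorem one_mem_orderUnits (hB : IsQuadraticBasis a b B) (i : ℕ) :
    (1 : (Ep p E)ˣ) ∈ orderUnits p E i := by
  rw [mem_orderUnits_iff' hB, map_one]
  refine ⟨?_, one_mem _⟩
  simp [gauge, QuadraticAlgebra.re_one, QuadraticAlgebra.im_one]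

theorem isOpen_unitFiltration (hB : IsQuadraticBasis a b B) (i : ℕ) :
    IsOpen (unitFiltration p hB i : Set (ToralQuotient p E)) := by
  rw [unitFiltration, Subgroup.coe_map]
  refine QuotientGroup.isOpenMap_coe _ ?_
  refine Subgroup.isOpen_of_mem_nhds _ (g := 1) ?_
  refine Filter.mem_of_superset ((isOpen_orderUnits hB i).mem_nhds (one_mem_orderUnits hB i)) ?_
  intro s hs
  exact ((mem_orderUnits_iff' hB i s).1 hs).2

/-- An element of `orderStab` can be rescaled by ℚ_p^× to gauge one, where it is a unit of the
order. -/
theorem image_orderUnits (hB : IsQuadraticBasis a b B) (i : ℕ) :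
    (QuotientGroup.mk : (Ep p E)ˣ → ToralQuotient p E) '' orderUnits p E i
      = unitFiltration p hB i := by
  ext q
  obtain ⟨s, rfl⟩ := QuotientGroup.mk_surjective q
  rw [SetLike.mem_coe, mk_mem_unitFiltration]
  constructor
  · rintro ⟨t, ht, hts⟩
    rw [← mk_mem_unitFiltration, ← hts, mk_mem_unitFiltration]
    exact ((mem_orderUnits_iff' hB i t).1 ht).2
  · intro hs
    obtain ⟨c, hc⟩ := exists_smul_gauge_eq_one i (localUnits p hB s)
    refine ⟨Units.map (algebraMap ℚ_[p] (Ep p E) : ℚ_[p] →* Ep p E) c * s, ?_, ?_⟩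
    · rw [mem_orderUnits_iff' hB, map_mul, localUnits_scalar]
      exact ⟨hc, mul_mem (scalar_mem_orderStab i c) hs⟩
    · have hc' : Units.map (algebraMap ℚ_[p] (Ep p E) : ℚ_[p] →* Ep p E) c ∈ scalars p E :=
        ⟨c, rfl⟩
      refine QuotientGroup.eq.2 ?_
      rw [mul_inv_rev, mul_comm, mul_inv_cancel_left]
      exact inv_mem hc'

theorem isFiltration_unitFiltration (hB : IsQuadraticBasis a b B) :
    IsFiltration (unitFiltration p hB) (quotientPosition p hB) where
  isOpen := isOpen_unitFiltration hB
  anti i j hij q := by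
    obtain ⟨s, rfl⟩ := QuotientGroup.mk_surjective q
    rw [mk_mem_unitFiltration, mk_mem_unitFiltration]
    exact fun h => orderStab_anti hij h
  eq_zero_iff i q := by
    obtain ⟨s, rfl⟩ := QuotientGroup.mk_surjective q
    rw [quotientPosition_mk, mk_mem_unitFiltration, relativePosition_eq_zero_iff]
  mul_left i u hu q := by
    obtain ⟨s, rfl⟩ := QuotientGroup.mk_surjective q
    obtain ⟨t, rfl⟩ := QuotientGroup.mk_surjective u
    rw [mk_mem_unitFiltration] at hu
    rw [← QuotientGroup.mk_mul, quotientPosition_mk, quotientPosition_mk, map_mul,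
      relativePosition_mul_left hu]
  succ i q hq := by
    obtain ⟨s, rfl⟩ := QuotientGroup.mk_surjective q
    rw [mk_mem_unitFiltration] at hq
    rw [quotientPosition_mk, quotientPosition_mk, relativePosition_succ hq]
  zero_le i q := by
    obtain ⟨s, rfl⟩ := QuotientGroup.mk_surjective q
    rw [quotientPosition_mk, quotientPosition_mk]
    exact le_relativePosition_zero i _

theorem measureReal_unitFiltration (hB : IsQuadraticBasis a b B)
    (ν : Measure (ToralQuotient p E)) [ν.IsMulLeftInvariant] (i : ℕ) :
    ν.real (unitFiltration p hB i : Set (ToralQuotient p E))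
      = ν.real (unitFiltration p hB (i + 1) : Set (ToralQuotient p E))
        * ((cosetIndex p a b i).card + 1) := by
  have hF := isFiltration_unitFiltration (p := p) hB
  have hmk : ∀ (j : ℕ) (s : (LocalAlg p a b)ˣ),
      (QuotientGroup.mk ((localUnits p hB).symm s) : ToralQuotient p E) ∈ unitFiltration p hB j
        ↔ s ∈ orderStab p a b j := by
    intro j s
    rw [mk_mem_unitFiltration, MulEquiv.apply_symm_apply]
  refine measure_eq_mul_card (Q := ToralQuotient p E) (hF.isOpen (i + 1))
    (hF.anti (Nat.le_succ i)) (t := fun c => QuotientGroup.mk ((localUnits p hB).symm (cosetUnit p a b i c))) ?_ ?_ ?_ ?_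
  · intro c hc
    rw [hmk]
    exact cosetUnit_mem hc
  · intro c hc
    rw [hmk]
    exact cosetUnit_not_mem hc
  · intro c hc e he hce
    rw [← QuotientGroup.mk_inv, ← QuotientGroup.mk_mul, ← map_inv, ← map_mul, hmk]
    exact cosetUnit_inv_mul_not_mem hc he hce
  · intro q hq hq'
    obtain ⟨s, rfl⟩ := QuotientGroup.mk_surjective q
    rw [mk_mem_unitFiltration] at hq hq'
    obtain ⟨c, hc, h⟩ := exists_cosetUnit hq hq'
    refine ⟨c, hc, ?_⟩
    rw [← QuotientGroup.mk_inv, ← QuotientGroup.mk_mul, mk_mem_unitFiltration, map_mul, map_inv,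
      MulEquiv.apply_symm_apply]
    exact h

/-- The first step of the filtration has index card + 1, with card taken at level 0, and every later
step has index p. -/
theorem measureReal_unitFiltration_succ (hB : IsQuadraticBasis a b B)
    {ν : Measure (ToralQuotient p E)} [ν.IsMulLeftInvariant]
    (hν : ν (unitFiltration p hB 0 : Set (ToralQuotient p E)) = 1) (i : ℕ) :
    ν.real (unitFiltration p hB (i + 1) : Set (ToralQuotient p E))
      = ((p : ℝ) ^ i * ((cosetIndex p a b 0).card + 1))⁻¹ := by
  induction i with
  | zero =>
    have h := measureReal_unitFiltration hB ν 0
    rw [Measure.real, hν, ENNReal.toReal_one] at h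
    rw [pow_zero, one_mul]
    exact eq_inv_of_mul_eq_one_left h.symm
  | succ i ih =>
    have h := measureReal_unitFiltration hB ν (i + 1)
    have hp := prime_cast_pos (p := p)
    rw [ih, card_cosetIndex_succ, Nat.cast_sub (Fact.out : p.Prime).one_le, Nat.cast_one,
      sub_add_cancel] at h
    rw [pow_succ, mul_right_comm, mul_inv, h, mul_assoc, mul_inv_cancel₀ hp.ne', mul_one]

/-! ### The conductor -/

/-- The circle has no small subgroups: w² - 1 = (w + 1)(w - 1) and |w + 1| ≥ 3/2 near 1, so repeated
squaring moves z away from 1 geometrically. -/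
theorem circle_eq_one_of_pow_close {z : Circle} (h : ∀ n : ℕ, ‖((z ^ n : Circle) : ℂ) - 1‖ < 1 / 2) :
    z = 1 := by
  by_contra hne
  have hpos : 0 < ‖(z : ℂ) - 1‖ := by
    rw [norm_pos_iff, sub_ne_zero]
    exact fun h => hne (Circle.ext (h.trans Circle.coe_one.symm))
  have key : ∀ k : ℕ, (3 / 2 : ℝ) ^ k * ‖(z : ℂ) - 1‖ ≤ ‖((z ^ (2 ^ k) : Circle) : ℂ) - 1‖ := by
    intro k
    induction k with
    | zero => simp
    | succ k ih =>
      set w : ℂ := ((z ^ (2 ^ k) : Circle) : ℂ) with hw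
      have e : ((z ^ (2 ^ (k + 1)) : Circle) : ℂ) - 1 = (w + 1) * (w - 1) := by
        rw [pow_succ 2 k, pow_mul, Circle.coe_pow, ← hw]
        ring
      have h1 : (3 / 2 : ℝ) ≤ ‖w + 1‖ := by
        have h2 := h (2 ^ k)
        have h3 : (2 : ℂ) = (w + 1) - (w - 1) := by ring
        have h4 := norm_sub_le (w + 1) (w - 1)
        rw [← h3] at h4
        norm_num at h4
        linarith
      rw [e, norm_mul, pow_succ, mul_comm ((3 / 2 : ℝ) ^ k), mul_assoc]
      exact mul_le_mul h1 ih (by positivity) (norm_nonneg _)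
  obtain ⟨k, hk⟩ := pow_unbounded_of_one_lt (1 / ‖(z : ℂ) - 1‖) (by norm_num : (1 : ℝ) < 3 / 2)
  rw [div_lt_iff₀ hpos] at hk
  linarith [key k, h (2 ^ k)]

theorem exists_localEquiv_mem (hB : IsQuadraticBasis a b B) {W : Set (Ep p E)}
    (hW : W ∈ nhds (1 : Ep p E)) :
    ∃ ε : ℝ, 0 < ε ∧ ∀ c d : ℚ_[p], ‖c - 1‖ < ε → ‖d‖ < ε → hB.localEquiv p ⟨c, d⟩ ∈ W := by
  set L : (Fin 2 → ℚ_[p]) →ₗ[ℚ_[p]] Ep p E := (hB.localEquiv p).toLinearMap.comp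
    (QuadraticAlgebra.linearEquivTuple (a : ℚ_[p]) (b : ℚ_[p])).symm.toLinearMap with hLdef
  have hL : ∀ c d : ℚ_[p], L ![c, d] = hB.localEquiv p ⟨c, d⟩ := fun c d => rfl
  have hg : Continuous L := IsModuleTopology.continuous_of_linearMap L
  clear_value L
  have hg1 : L ![1, 0] = 1 := by
    rw [hL]
    exact map_one (hB.localEquiv p)
  have hW3 : L ⁻¹' W ∈ nhds (![1, 0] : Fin 2 → ℚ_[p]) :=
    hg.continuousAt.preimage_mem_nhds (by rw [hg1]; exact hW)
  obtain ⟨ε, hε, hball⟩ := Metric.mem_nhds_iff.1 hW3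
  refine ⟨ε, hε, fun c d hc hd => ?_⟩
  have h : (![c, d] : Fin 2 → ℚ_[p]) ∈ Metric.ball (![1, 0] : Fin 2 → ℚ_[p]) ε := by
    rw [Metric.mem_ball, dist_pi_lt_iff hε, Fin.forall_fin_two]
    rw [dist_eq_norm, dist_eq_norm]
    simpa using And.intro hc hd
  rw [← hL]
  exact hball h

/-- In the topology of the unit group a neighbourhood of 1 constrains both s and s⁻¹, hence the two
pairs of coordinates. -/
theorem exists_norm_sub_one_lt (hB : IsQuadraticBasis a b B) {χ : (Ep p E)ˣ →* Circle}
    (hχ : Continuous χ) : ∃ ε : ℝ, 0 < ε ∧ ∀ (s : (Ep p E)ˣ) (c d c' d' : ℚ_[p]),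
      (s : Ep p E) = hB.localEquiv p ⟨c, d⟩ →
      ((s⁻¹ : (Ep p E)ˣ) : Ep p E) = hB.localEquiv p ⟨c', d'⟩ →
      ‖c - 1‖ < ε → ‖d‖ < ε → ‖c' - 1‖ < ε → ‖d'‖ < ε → ‖(χ s : ℂ) - 1‖ < 1 / 2 := by
  have hopen : {s : (Ep p E)ˣ | ‖(χ s : ℂ) - 1‖ < 1 / 2} ∈ nhds (1 : (Ep p E)ˣ) := by
    have hc : Continuous fun s : (Ep p E)ˣ => ‖(χ s : ℂ) - 1‖ :=
      ((continuous_subtype_val.comp hχ).sub continuous_const).norm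
    refine (isOpen_lt hc continuous_const).mem_nhds ?_
    simp
  rw [Units.isEmbedding_embedProduct.isInducing.nhds_eq_comap, Filter.mem_comap] at hopen
  obtain ⟨W, hW, hWs⟩ := hopen
  rw [map_one, Prod.one_eq_mk, nhds_prod_eq, Filter.mem_prod_iff] at hW
  obtain ⟨W₁, hW₁, W₂, hW₂, hW12⟩ := hW
  have hW₂' : MulOpposite.op ⁻¹' W₂ ∈ nhds (1 : Ep p E) :=
    MulOpposite.continuous_op.continuousAt.preimage_mem_nhds hW₂
  obtain ⟨ε₁, hε₁, h₁⟩ := exists_localEquiv_mem hB hW₁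
  obtain ⟨ε₂, hε₂, h₂⟩ := exists_localEquiv_mem hB hW₂'
  refine ⟨min ε₁ ε₂, lt_min hε₁ hε₂, fun s c d c' d' hs hs' hc hd hc' hd' => ?_⟩
  have m₁ : (s : Ep p E) ∈ W₁ := by
    rw [hs]
    exact h₁ c d (hc.trans_le (min_le_left _ _)) (hd.trans_le (min_le_left _ _))
  have m₂ : MulOpposite.op ((s⁻¹ : (Ep p E)ˣ) : Ep p E) ∈ W₂ := by
    rw [hs']
    exact h₂ c' d' (hc'.trans_le (min_le_right _ _)) (hd'.trans_le (min_le_right _ _))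
  exact hWs (hW12 (Set.mk_mem_prod m₁ m₂))

/-- Guarantees that `conductorExp` is a true minimum and not the default value 0 of `sInf` on the
empty set. Deep in the filtration χ is close to 1 on a subgroup, hence trivial there. -/
theorem exists_trivial_on_orderUnits (hB : IsQuadraticBasis a b B) {χ : (Ep p E)ˣ →* Circle}
    (hχ : Continuous χ) (hχ_triv : ∀ t ∈ scalars p E, χ t = 1) :
    ∃ i : ℕ, ∀ s ∈ orderUnits p E i, χ s = 1 := by
  have hp := prime_cast_pos (p := p)
  obtain ⟨ε, hε, hmem⟩ := exists_norm_sub_one_lt hB hχ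
  obtain ⟨i, hi⟩ := exists_pow_lt_of_lt_one hε (inv_lt_one_of_one_lt₀ (one_lt_prime_cast (p := p)))
  -- As χ is trivial on scalars, s may be replaced by s/re = 1 + yω with y small. The level i + 1
  -- ensures |y| < 1 as well as |y| < ε.
  have hclose : ∀ s ∈ orderUnits p E (i + 1), ‖(χ s : ℂ) - 1‖ < 1 / 2 := by
    intro s hs
    obtain ⟨hs1, hs2⟩ := (mem_orderUnits_iff' hB _ s).1 hs
    set x := (localUnits p hB s : LocalAlg p a b) with hx
    have hxN : ‖x.norm‖ = 1 := by rw [mem_orderStab.1 hs2, ← hx, hs1, one_pow]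
    have hre : ‖x.re‖ ≤ 1 := hs1 ▸ norm_re_le_gauge (i + 1) x
    have him : ‖x.im‖ ≤ ((p : ℝ)⁻¹) ^ (i + 1) := by
      have := pow_mul_norm_im_le_gauge (i + 1) x
      rw [hs1] at this
      rw [inv_pow, ← one_div, le_div_iff₀ (by positivity), mul_comm]
      exact this
    have hpinv : (p : ℝ)⁻¹ < 1 := inv_lt_one_of_one_lt₀ one_lt_prime_cast
    have hpinv0 : 0 ≤ (p : ℝ)⁻¹ := by positivity
    have him1 : ‖x.im‖ < 1 := him.trans_lt (pow_lt_one₀ hpinv0 hpinv (by omega))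
    have himε : ‖x.im‖ < ε :=
      (him.trans (pow_le_pow_of_le_one hpinv0 hpinv.le (Nat.le_succ i))).trans_lt hi
    have hre1 : ‖x.re‖ = 1 := by
      refine hre.antisymm (not_lt.1 fun h => ?_)
      have : ‖x.norm‖ < 1 := by
        rw [QuadraticAlgebra.norm_def, mul_assoc, mul_assoc]
        refine norm_sub_lt_of_lt (norm_add_lt_of_lt (norm_mul_lt_one_left h hre)
          ((norm_int_mul_le _ _).trans_lt (norm_mul_lt_one_left h him1.le)))
          ((norm_int_mul_le _ _).trans_lt (norm_mul_lt_one_left him1 him1.le))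
      exact this.ne hxN
    have hre0 : x.re ≠ 0 := norm_pos_iff.1 (hre1 ▸ one_pos)
    set z : (Ep p E)ˣ := Units.map (algebraMap ℚ_[p] (Ep p E) : ℚ_[p] →* Ep p E)
      (Units.mk0 x.re hre0)⁻¹ with hz
    have hzs : χ (z * s) = χ s := by
      rw [map_mul, hχ_triv z ⟨_, rfl⟩, one_mul]
    rw [← hzs]
    set y := x.im / x.re with hy
    have hyn : ‖y‖ = ‖x.im‖ := by rw [hy, norm_div, hre1, div_one]
    have hloc : (localUnits p hB (z * s) : LocalAlg p a b) = ⟨1, y⟩ := by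
      rw [map_mul, hz, localUnits_scalar, Units.val_mul, ← hx]
      have : ((Units.map (algebraMap ℚ_[p] (LocalAlg p a b) : ℚ_[p] →* LocalAlg p a b)
          (Units.mk0 x.re hre0)⁻¹ : (LocalAlg p a b)ˣ) : LocalAlg p a b) * x = x.re⁻¹ • x := by
        rw [Algebra.smul_def]
        simp
      rw [this]
      ext
      · simp [hre0]
      · simp [hy, div_eq_inv_mul]
    set N := (localUnits p hB (z * s) : LocalAlg p a b).norm with hN
    have hNval : N = 1 + b * y - a * y * y := by
      rw [hN, hloc, QuadraticAlgebra.norm_def]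
      simp
    have hNn : ‖N‖ = 1 := by
      have h1 : ‖N - 1‖ < ‖(1 : ℚ_[p])‖ := by
        have e : N - 1 = y * (b - a * y) := by rw [hNval]; ring
        rw [e, norm_one]
        refine norm_mul_lt_one_left (hyn ▸ him1) (norm_sub_le_of_le (Padic.norm_int_le_one _) ?_)
        exact (norm_int_mul_le _ _).trans (hyn ▸ him1.le)
      rw [norm_eq_of_norm_sub_lt h1, norm_one]
    have hN0 : N ≠ 0 := norm_pos_iff.1 (hNn ▸ one_pos)
    have hinv : (((localUnits p hB (z * s))⁻¹ : (LocalAlg p a b)ˣ) : LocalAlg p a b)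
        = ⟨1 + a * y * y / N, -y / N⟩ := by
      rw [unit_inv_eq, ← hN, hloc]
      ext
      · simp only [QuadraticAlgebra.re_smul, QuadraticAlgebra.re_star, smul_eq_mul]
        field_simp
        rw [hNval]
        ring
      · simp only [QuadraticAlgebra.im_smul, QuadraticAlgebra.im_star, smul_eq_mul]
        field_simp
    have e₁ : ((z * s : (Ep p E)ˣ) : Ep p E) = hB.localEquiv p ⟨1, y⟩ := by
      rw [← hloc, coe_localUnits, AlgEquiv.apply_symm_apply]
    have e₂ : (((z * s)⁻¹ : (Ep p E)ˣ) : Ep p E)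
        = hB.localEquiv p ⟨1 + a * y * y / N, -y / N⟩ := by
      rw [← hinv, ← map_inv, coe_localUnits, AlgEquiv.apply_symm_apply]
    refine hmem (z * s) _ _ _ _ e₁ e₂ (by simpa using hε) (hyn ▸ himε) ?_ ?_
    · rw [add_sub_cancel_left, norm_div, hNn, div_one, mul_assoc]
      refine (norm_int_mul_le _ _).trans_lt ?_
      rw [norm_mul]
      exact (mul_le_of_le_one_left (norm_nonneg _) (hyn ▸ him1.le)).trans_lt (hyn ▸ himε)
    · rw [norm_div, hNn, div_one, norm_neg]
      exact hyn ▸ himε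
  refine ⟨i + 1, fun s hs => circle_eq_one_of_pow_close fun n => ?_⟩
  rw [← map_pow]
  apply hclose
  obtain ⟨h1, h2⟩ := (mem_orderUnits_iff hB _ s).1 hs
  rw [mem_orderUnits_iff hB]
  have hpow : ∀ (u : (LocalAlg p a b)ˣ), gauge (i + 1) (u : LocalAlg p a b) ≤ 1 →
      gauge (i + 1) ((u ^ n : (LocalAlg p a b)ˣ) : LocalAlg p a b) ≤ 1 := by
    intro u hu
    induction n with
    | zero => simp [gauge, QuadraticAlgebra.re_one, QuadraticAlgebra.im_one]
    | succ n ih =>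
      rw [pow_succ, Units.val_mul]
      exact (gauge_mul_le _ _ _).trans (mul_le_one₀ ih (gauge_nonneg _ _) hu)
  rw [map_pow, ← inv_pow]
  exact ⟨hpow _ h1, hpow _ h2⟩

theorem trivial_on_conductorExp (hB : IsQuadraticBasis a b B) {χ : (Ep p E)ˣ →* Circle}
    (hχ : Continuous χ) (hχ_triv : ∀ t ∈ scalars p E, χ t = 1) :
    ∀ s ∈ orderUnits p E (conductorExp χ), χ s = 1 :=
  Nat.sInf_mem (exists_trivial_on_orderUnits hB hχ hχ_triv)

theorem exists_of_lt_conductorExp {χ : (Ep p E)ˣ →* Circle} {i : ℕ} (hi : i < conductorExp χ) :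
    ∃ s ∈ orderUnits p E i, χ s ≠ 1 := by
  have := Nat.notMem_of_lt_sInf hi
  simpa using this

end ToralFiltration

section Embedding

/-! ### The embedding in coordinates -/

variable {p : ℕ} [Fact p.Prime] {E : Type*} [Field E] [NumberField E]
  {a b : ℤ} {B : Module.Basis (Fin 2) ℤ (𝓞 E)}

/-- The trace-zero line is spanned by 2ω - b = ±√d_ξ, so everything about ξ is expressed through q.
-/
theorem exists_eq_of_trace_eq_zero (hB : IsQuadraticBasis a b B) {ξ : E} (hξ : ξ ≠ 0)
    (hξ_tr : Algebra.trace ℚ E ξ = 0) :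
    ∃ q : ℚ, q ≠ 0 ∧ ξ = hB.rational.equiv ⟨-(q * b), 2 * q⟩ := by
  obtain ⟨z, rfl⟩ := hB.rational.equiv.surjective ξ
  rw [hB.rational.trace_equiv] at hξ_tr
  have hre : z.re = -(z.im / 2 * b) := by linarith
  refine ⟨z.im / 2, fun h => hξ ?_, ?_⟩
  · have e : z = 0 := by
      ext
      · rw [hre, h]; simp
      · rw [QuadraticAlgebra.im_zero]; linarith
    rw [e, map_zero]
  · congr 1
    ext
    · exact hre
    · simp only; ring

theorem norm_traceZero (hB : IsQuadraticBasis a b B) (q : ℚ) :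
    Algebra.norm ℚ (hB.rational.equiv ⟨-(q * b), 2 * q⟩) = -(q ^ 2 * discr E) := by
  rw [hB.rational.norm_equiv, QuadraticAlgebra.norm_def, hB.numberField_discr]
  push_cast
  ring

theorem sq_traceZero (hB : IsQuadraticBasis a b B) (q : ℚ) :
    hB.rational.equiv ⟨-(q * b), 2 * q⟩ * hB.rational.equiv ⟨-(q * b), 2 * q⟩
      = algebraMap ℚ E (q ^ 2 * discr E) := by
  rw [← map_mul, ← hB.rational.equiv.commutes]
  congr 1
  rw [hB.numberField_discr]
  ext
  · simp [QuadraticAlgebra.algebraMap_eq]; ring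
  · simp [QuadraticAlgebra.algebraMap_eq]; ring

/-- The element 2ω - b has square d_ξ and goes to a pure quaternion, whose square is not positive in
a definite algebra. -/
theorem discr_neg_of_definite {u v : ℚ} (hu : u < 0) (hv : v < 0) (hB : IsQuadraticBasis a b B)
    (σ : E →ₐ[ℚ] ℍ[ℚ,u,v]) : discr E < 0 := by
  have hsq := sq_traceZero hB 1
  set ξ := hB.rational.equiv ⟨-(1 * b), 2 * 1⟩ with hξ
  have htr : Algebra.trace ℚ E ξ = 0 := by rw [hξ, hB.rational.trace_equiv]; ring
  have h := congrArg σ hsq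
  rw [map_mul, AlgHom.commutes, one_pow, one_mul] at h
  set w := σ ξ with hw
  have h0 := congrArg QuaternionAlgebra.re h
  have h1 := congrArg QuaternionAlgebra.imI h
  have h2 := congrArg QuaternionAlgebra.imJ h
  have h3 := congrArg QuaternionAlgebra.imK h
  simp at h0 h1 h2 h3
  -- Since w² is rational, a nonzero real part would kill the other coordinates; then ξ would be
  -- rational, against trace zero.
  have hre : w.re = 0 := by
    by_contra hne
    have e1 : w.imI = 0 := mul_left_cancel₀ hne (by linarith)
    have e2 : w.imJ = 0 := mul_left_cancel₀ hne (by linarith)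
    have e3 : w.imK = 0 := mul_left_cancel₀ hne (by linarith)
    have e : ξ = algebraMap ℚ E w.re := by
      apply σ.toRingHom.injective
      change σ ξ = σ _
      rw [AlgHom.commutes, ← hw]
      ext <;> simp [QuaternionAlgebra.algebraMap_eq, e1, e2, e3]
    rw [e, Algebra.trace_algebraMap] at htr
    simp only [nsmul_eq_mul, mul_eq_zero, Nat.cast_eq_zero] at htr
    exact htr.elim (Module.finrank_pos (R := ℚ) (M := E)).ne' hne
  have hd : (discr E : ℚ) ≤ 0 := by
    rw [← h0, hre]
    have := mul_pos_of_neg_of_neg hu hv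
    nlinarith [mul_nonneg (neg_nonneg.2 hu.le) (sq_nonneg w.imI),
      mul_nonneg (neg_nonneg.2 hv.le) (sq_nonneg w.imJ), mul_nonneg this.le (sq_nonneg w.imK)]
  have hd' : discr E ≤ 0 := by exact_mod_cast hd
  exact lt_of_le_of_ne hd' (discr_ne_zero E)

/-- In ξ = q(2ω - b) the corner entry a/2 = q(2k - b) means that ω has corner entry k. The factor 2
for odd discriminant in `constA` is what makes k an integer. -/
theorem exists_constA_eq (hB : IsQuadraticBasis a b B) (hd : discr E < 0) (q : ℚ) :
    ∃ k : ℤ, constA (hB.rational.equiv ⟨-(q * b), 2 * q⟩) = 2 * q * (2 * k - b) := by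
  have hsqrt : Rat.sqrt (Algebra.norm ℚ (hB.rational.equiv ⟨-(q * b), 2 * q⟩) * |(discr E : ℚ)|)
      = |q| * -discr E := by
    have hdq : (discr E : ℚ) < 0 := by exact_mod_cast hd
    rw [norm_traceZero hB, abs_of_neg hdq,
      show -(q ^ 2 * (discr E : ℚ)) * -(discr E : ℚ) = q * discr E * (q * discr E) by ring,
      Rat.sqrt_eq, abs_mul, abs_of_neg hdq]
  have hb := hB.numberField_discr
  -- The sign of q. The choices are 2k = b + e d for odd d, and 4k = 2b + e d for even d.
  obtain ⟨e, he, hqe⟩ : ∃ e : ℤ, (e = 1 ∨ e = -1) ∧ |q| = e * q := by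
    rcases abs_choice q with h | h
    · exact ⟨1, Or.inl rfl, by rw [h]; simp⟩
    · exact ⟨-1, Or.inr rfl, by rw [h]; simp⟩
  rw [constA, hsqrt, hqe]
  split_ifs with hodd
  · have hb' : Odd b := by
      rw [hb] at hodd
      by_contra h
      rw [Int.not_odd_iff_even] at h
      refine Int.not_even_iff_odd.2 hodd ?_
      exact (h.pow_of_ne_zero two_ne_zero).add ⟨2 * a, by ring⟩
    obtain ⟨k, hk⟩ : Even (b + e * discr E) := by
      refine hb'.add_odd ?_
      rcases he with rfl | rfl
      · simpa using hodd
      · simpa using hodd.neg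
    refine ⟨k, ?_⟩
    have hk' : (b : ℚ) + e * discr E = k + k := by exact_mod_cast hk
    linear_combination 2 * q * hk'
  · rw [Int.not_odd_iff_even] at hodd
    obtain ⟨c, hc⟩ : Even b := by
      rw [hb] at hodd
      by_contra h
      rw [Int.not_even_iff_odd] at h
      refine Int.not_even_iff_odd.2 ?_ hodd
      exact h.pow.add_even ⟨2 * a, by ring⟩
    refine ⟨c + e * (c ^ 2 + a), ?_⟩
    rw [hb, hc]
    push_cast
    ring

theorem constB_eq (hB : IsQuadraticBasis a b B) {q : ℚ} {k : ℤ}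
    (hk : constA (hB.rational.equiv ⟨-(q * b), 2 * q⟩) = 2 * q * (2 * k - b)) :
    constB (hB.rational.equiv ⟨-(q * b), 2 * q⟩) = 4 * q ^ 2 * (a + k * b - k ^ 2) := by
  rw [constB, hk, norm_traceZero hB, hB.numberField_discr]
  push_cast
  ring

/-- Since (2ξ)² = (2q)² d_ξ, the discriminant cancels. -/
theorem muExp_eq (hB : IsQuadraticBasis a b B) {q : ℚ} (hq : q ≠ 0) :
    muExp p (hB.rational.equiv ⟨-(q * b), 2 * q⟩) = padicValRat p (2 * q) := by
  have hd : (discr E : ℚ) ≠ 0 := by exact_mod_cast discr_ne_zero E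
  have h2q : (2 * q) ≠ 0 := mul_ne_zero two_ne_zero hq
  rw [muExp, norm_traceZero hB,
    show -4 * -(q ^ 2 * (discr E : ℚ)) = (2 * q) ^ 2 * discr E by ring,
    padicValRat.mul (pow_ne_zero 2 h2q) hd, padicValRat.pow]
  push_cast
  omega

variable {u v : ℚ}

/-- The image of `ω` in `M_2(ℚ_p)`. -/
def omegaMatrix (p : ℕ) [Fact p.Prime] (a b k : ℤ) (w : ℚ_[p]) : Matrix (Fin 2) (Fin 2) ℚ_[p] :=
  !![(k : ℚ_[p]), w * (a + k * b - k ^ 2); w⁻¹, (b : ℚ_[p]) - k]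

/-- Solving ξ = q(2ω - b) for ω turns the prescribed matrix of ξ into that of ω, with w = 2q. -/
theorem map_omega (hB : IsQuadraticBasis a b B) (σ : E →ₐ[ℚ] ℍ[ℚ,u,v])
    (ι : Bp p u v ≃ₐ[ℚ_[p]] Matrix (Fin 2) (Fin 2) ℚ_[p]) {q : ℚ} (hq : q ≠ 0) {k : ℤ}
    (hk : constA (hB.rational.equiv ⟨-(q * b), 2 * q⟩) = 2 * q * (2 * k - b))
    (hι : ι ((1 : ℚ_[p]) ⊗ₜ[ℚ] σ (hB.rational.equiv ⟨-(q * b), 2 * q⟩))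
      = xiMatrix p (hB.rational.equiv ⟨-(q * b), 2 * q⟩)) (x : LocalAlg p a b) :
    ι (Algebra.TensorProduct.map (AlgHom.id ℚ_[p] ℚ_[p]) σ (hB.localEquiv p x))
      = x.re • 1 + x.im • omegaMatrix p a b k ((2 * q : ℚ) : ℚ_[p]) := by
  have h2q : ((2 * q : ℚ) : ℚ_[p]) ≠ 0 := by
    exact_mod_cast mul_ne_zero two_ne_zero hq
  set F : LocalAlg p a b →ₐ[ℚ_[p]] Matrix (Fin 2) (Fin 2) ℚ_[p] :=
    (ι.toAlgHom.comp (Algebra.TensorProduct.map (AlgHom.id ℚ_[p] ℚ_[p]) σ)).comp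
      (hB.localEquiv p).toAlgHom with hF
  change F x = _
  have hω : F ⟨0, 1⟩ = omegaMatrix p a b k ((2 * q : ℚ) : ℚ_[p]) := by
    have h1 : F ⟨((-(q * b) : ℚ) : ℚ_[p]), ((2 * q : ℚ) : ℚ_[p])⟩
        = xiMatrix p (hB.rational.equiv ⟨-(q * b), 2 * q⟩) := by
      rw [← hι]
      change ι (Algebra.TensorProduct.map (AlgHom.id ℚ_[p] ℚ_[p]) σ (hB.localEquiv p _)) = _
      rw [hB.localEquiv_mk p, Algebra.TensorProduct.map_tmul]
      rfl
    have h2 : (⟨((-(q * b) : ℚ) : ℚ_[p]), ((2 * q : ℚ) : ℚ_[p])⟩ : LocalAlg p a b)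
        = ((-(q * b) : ℚ) : ℚ_[p]) • 1 + ((2 * q : ℚ) : ℚ_[p]) • ⟨0, 1⟩ := by
      ext <;> simp [QuadraticAlgebra.re_one, QuadraticAlgebra.im_one]
    rw [h2, map_add, map_smul, map_smul, map_one] at h1
    have h3 : F ⟨0, 1⟩ = ((2 * q : ℚ) : ℚ_[p])⁻¹ •
        (xiMatrix p (hB.rational.equiv ⟨-(q * b), 2 * q⟩) - ((-(q * b) : ℚ) : ℚ_[p]) • 1) := by
      rw [← h1, add_sub_cancel_left, smul_smul, inv_mul_cancel₀ h2q, one_smul]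
    have hq' : (q : ℚ_[p]) ≠ 0 := by exact_mod_cast hq
    rw [h3, xiMatrix, constB_eq hB hk, hk, omegaMatrix]
    ext i j
    fin_cases i <;> fin_cases j <;> simp <;> field_simp <;> ring
  have hx : x = x.re • 1 + x.im • ⟨0, 1⟩ := by
    ext <;> simp [QuadraticAlgebra.re_one, QuadraticAlgebra.im_one]
  conv_lhs => rw [hx]
  rw [map_add, map_smul, map_smul, map_one, hω]

theorem coe_diagPow_inv (m : ℤ) : ((diagPow p m)⁻¹ : GL (Fin 2) ℚ_[p]).1
    = !![1, 0; 0, (p : ℚ_[p]) ^ (-m)] := by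
  have h : (diagPow p m)⁻¹ = diagPow p (-m) := by
    rw [inv_eq_iff_mul_eq_one]
    ext i j
    have := padic_prime_ne_zero (p := p)
    fin_cases i <;> fin_cases j <;>
      simp [coe_diagPow, Matrix.mul_apply, Fin.sum_univ_two,
        mul_inv_cancel₀ (zpow_ne_zero m this)]
  rw [h]
  exact coe_diagPow _

/-- Conjugation by diag(1, p^m) only rescales the off-diagonal entries, replacing w by w p^m. -/
theorem conj_omegaMatrix (m : ℤ) (k : ℤ) {w : ℚ_[p]} (hw : w ≠ 0) (c t : ℚ_[p]) :
    ((diagPow p m)⁻¹ : GL (Fin 2) ℚ_[p]).1 * (c • 1 + t • omegaMatrix p a b k w)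
        * (diagPow p m : GL (Fin 2) ℚ_[p]).1
      = !![c + t * k, t * (w * (p : ℚ_[p]) ^ m * ((a + k * b - k ^ 2 : ℤ) : ℚ_[p]));
          t * (w * (p : ℚ_[p]) ^ m)⁻¹, c + t * ((b - k : ℤ) : ℚ_[p])] := by
  have hp := zpow_ne_zero m (padic_prime_ne_zero (p := p))
  have e : c • (1 : Matrix (Fin 2) (Fin 2) ℚ_[p]) + t • omegaMatrix p a b k w
      = !![c + t * k, t * (w * (a + k * b - k ^ 2)); t * w⁻¹, c + t * (b - k)] := by
    rw [omegaMatrix]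
    ext i j
    fin_cases i <;> fin_cases j <;> simp
  rw [e, coe_diagPow_inv, coe_diagPow, zpow_neg, Matrix.mul_fin_two, Matrix.mul_fin_two]
  ext i j
  fin_cases i <;> fin_cases j <;> simp <;> field_simp

/-- The lower left entry has norm p^i |im|, and re is recovered from the upper left entry by
subtracting an integer multiple of im. The other two entries are no larger. -/
theorem entryNorm_conj_omegaMatrix (i : ℕ) (k : ℤ) {w : ℚ_[p]} (hw : ‖w‖ = ((p : ℝ) ^ i)⁻¹)
    (x : LocalAlg p a b) :
    entryNorm !![x.re + x.im * (k : ℚ_[p]), x.im * (w * ((a + k * b - k ^ 2 : ℤ) : ℚ_[p]));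
      x.im * w⁻¹, x.re + x.im * ((b - k : ℤ) : ℚ_[p])] = gauge i x := by
  have hre := norm_re_le_gauge i x
  have him := norm_im_le_gauge i x
  have him' := pow_mul_norm_im_le_gauge i x
  have h1 : ∀ n : ℤ, ‖x.im * n‖ ≤ gauge i x := fun n => by
    rw [mul_comm]
    exact (norm_int_mul_le _ _).trans him
  apply le_antisymm
  · rw [entryNorm_le_iff]
    refine ⟨⟨norm_add_le_of_le hre (h1 _), ?_⟩, ?_, norm_add_le_of_le hre (h1 _)⟩
    · change ‖x.im * (w * _)‖ ≤ _
      rw [mul_left_comm, norm_mul, hw]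
      refine (mul_le_of_le_one_left (norm_nonneg _) ?_).trans (h1 _)
      exact inv_le_one_of_one_le₀ (one_le_prime_pow i)
    · change ‖x.im * w⁻¹‖ ≤ _
      rw [norm_mul, norm_inv, hw, inv_inv, mul_comm]
      exact him'
  · set M := !![x.re + x.im * (k : ℚ_[p]), x.im * (w * ((a + k * b - k ^ 2 : ℤ) : ℚ_[p]));
      x.im * w⁻¹, x.re + x.im * ((b - k : ℤ) : ℚ_[p])] with hM
    obtain ⟨⟨e1, -⟩, e2, -⟩ := entryNorm_le_iff.1 (le_refl (entryNorm M))
    have e3 : (p : ℝ) ^ i * ‖x.im‖ ≤ entryNorm M := by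
      have : ‖x.im * w⁻¹‖ ≤ entryNorm M := e2
      rwa [norm_mul, norm_inv, hw, inv_inv, mul_comm] at this
    have e4 : ‖x.im‖ ≤ entryNorm M :=
      (le_mul_of_one_le_left (norm_nonneg _) (one_le_prime_pow i)).trans e3
    refine gauge_le_iff.2 ⟨?_, e3⟩
    have e5 : x.re = (x.re + x.im * k) - x.im * k := by ring
    rw [e5]
    refine norm_sub_le_of_le e1 ?_
    rw [mul_comm]
    exact (norm_int_mul_le _ _).trans e4

/-- The element of `GL_2(ℚ_p)` attached to `s ∈ E_p^×`. -/
def toralGL (σ : E →ₐ[ℚ] ℍ[ℚ,u,v]) (ι : Bp p u v ≃ₐ[ℚ_[p]] Matrix (Fin 2) (Fin 2) ℚ_[p])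
    (s : (Ep p E)ˣ) : GL (Fin 2) ℚ_[p] :=
  Units.map (ι : Bp p u v →* Matrix (Fin 2) (Fin 2) ℚ_[p]) (torusEmb σ s)

/-- The entry norm of the conjugated matrix is the gauge of s and its determinant is the norm of s,
so its elementary divisors differ by the relative position. -/
theorem IsSpherical.apply_conj_toralGL {Ψ : GL (Fin 2) ℚ_[p] → ℂ} (hΨ : IsSpherical Ψ)
    (hu : u < 0) (hv : v < 0) (hB : IsQuadraticBasis a b B) (σ : E →ₐ[ℚ] ℍ[ℚ,u,v])
    (ι : Bp p u v ≃ₐ[ℚ_[p]] Matrix (Fin 2) (Fin 2) ℚ_[p]) {ξ : E} (hξ : ξ ≠ 0)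
    (hξ_tr : Algebra.trace ℚ E ξ = 0)
    (hι : ι ((1 : ℚ_[p]) ⊗ₜ[ℚ] σ ξ) = xiMatrix p ξ) (i : ℕ) (s : (Ep p E)ˣ) :
    Ψ ((diagPow p (-muExp p ξ + i))⁻¹ * toralGL σ ι s * diagPow p (-muExp p ξ + i))
      = Ψ (diagPow p (relativePosition i (localUnits p hB s))) := by
  obtain ⟨q, hq, rfl⟩ := exists_eq_of_trace_eq_zero hB hξ hξ_tr
  obtain ⟨k, hk⟩ := exists_constA_eq hB (discr_neg_of_definite hu hv hB σ) q
  have hp := prime_cast_pos (p := p)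
  have h2q0 : 2 * q ≠ 0 := mul_ne_zero two_ne_zero hq
  have h2q : ((2 * q : ℚ) : ℚ_[p]) ≠ 0 := by exact_mod_cast h2q0
  set m := -muExp p (hB.rational.equiv ⟨-(q * b), 2 * q⟩) + (i : ℤ) with hm
  rw [muExp_eq hB hq] at hm
  set w := ((2 * q : ℚ) : ℚ_[p]) * (p : ℚ_[p]) ^ m with hwdef
  -- |2q| = p^{-μ} and m = -μ + i, so w = 2q p^m has norm p^{-i}.
  have hw : ‖w‖ = ((p : ℝ) ^ i)⁻¹ := by
    rw [hwdef, norm_mul, Padic.eq_padicNorm, padicNorm.eq_zpow_of_nonzero h2q0, norm_zpow,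
      Padic.norm_p, hm]
    push_cast
    rw [inv_zpow, ← zpow_neg, ← zpow_add₀ hp.ne', ← zpow_natCast, ← zpow_neg]
    congr 1
    ring
  have hw0 : w ≠ 0 := mul_ne_zero h2q (zpow_ne_zero _ padic_prime_ne_zero)
  set x := (localUnits p hB s : LocalAlg p a b) with hx
  have hM : ((diagPow p m)⁻¹ * toralGL σ ι s * diagPow p m : GL (Fin 2) ℚ_[p]).1
      = !![x.re + x.im * (k : ℚ_[p]), x.im * (w * ((a + k * b - k ^ 2 : ℤ) : ℚ_[p]));
          x.im * w⁻¹, x.re + x.im * ((b - k : ℤ) : ℚ_[p])] := by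
    rw [hwdef, ← conj_omegaMatrix m k h2q, ← map_omega hB σ ι hq hk hι, hx, coe_localUnits,
      AlgEquiv.apply_symm_apply]
    rfl
  apply hΨ.eq_diagPow
  rw [hM, entryNorm_conj_omegaMatrix i k hw, ← relativePosition_spec, ← hx, Matrix.det_fin_two_of,
    QuadraticAlgebra.norm_def]
  congr 1
  push_cast
  field_simp
  ring

end Embedding

section MatrixRepresentation

/-! ### The toral integrand as a matrix coefficient -/

variable {p : ℕ} [Fact p.Prime] {E : Type*} [Field E] [NumberField E]
  {a b : ℤ} {B : Module.Basis (Fin 2) ℤ (𝓞 E)} {u v : ℚ}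
  {V : Type*} [NormedAddCommGroup V] [InnerProductSpace ℂ V]

/-- The representation of `GL_2(ℚ_p)` obtained from one of `B_p^×` through `ι`. -/
def matrixRep (ι : Bp p u v ≃ₐ[ℚ_[p]] Matrix (Fin 2) (Fin 2) ℚ_[p])
    (π : Representation ℂ (Bp p u v)ˣ V) : Representation ℂ (GL (Fin 2) ℚ_[p]) V :=
  MonoidHom.comp π (Units.map (ι.symm : Matrix (Fin 2) (Fin 2) ℚ_[p] →* Bp p u v))

theorem matrixRep_equiv {ι : Bp p u v ≃ₐ[ℚ_[p]] Matrix (Fin 2) (Fin 2) ℚ_[p]}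
    {π : Representation ℂ (Bp p u v)ˣ V} {α : ℂ}
    (h : Nonempty (Representation.Equiv π ((principalSeriesRep p α).comp
      (Units.map (ι : Bp p u v →* Matrix (Fin 2) (Fin 2) ℚ_[p]))))) :
    Nonempty ((matrixRep ι π).Equiv (principalSeriesRep p α)) := by
  obtain ⟨T⟩ := h
  refine ⟨Representation.Equiv.mk T.toLinearEquiv fun g => ?_⟩
  have h := T.toIntertwiningMap.isIntertwining'
    (Units.map (ι.symm : Matrix (Fin 2) (Fin 2) ℚ_[p] →* Bp p u v) g)
  have e : Units.map (ι : Bp p u v →* Matrix (Fin 2) (Fin 2) ℚ_[p])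
      (Units.map (ι.symm : Matrix (Fin 2) (Fin 2) ℚ_[p] →* Bp p u v) g) = g := by
    ext1
    exact ι.apply_symm_apply g.1
  rw [MonoidHom.comp_apply, e] at h
  exact h

/-- Unitarity moves π(h) from the second vector to the first as π(h⁻¹). -/
theorem toralIntegrand_eq (ι : Bp p u v ≃ₐ[ℚ_[p]] Matrix (Fin 2) (Fin 2) ℚ_[p])
    {π : Representation ℂ (Bp p u v)ˣ V}
    (hπ : ∀ h x y, inner ℂ (π h x) (π h y) = inner ℂ x y) (σ : E →ₐ[ℚ] ℍ[ℚ,u,v]) (f : V)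
    (χ : (Ep p E)ˣ →* Circle) (g : GL (Fin 2) ℚ_[p]) (s : (Ep p E)ˣ) :
    toralIntegrand σ π f χ
        (Units.map (ι.symm : Matrix (Fin 2) (Fin 2) ℚ_[p] →* Bp p u v) g) s
      = matrixCoeff (matrixRep ι π) f (g⁻¹ * toralGL σ ι s * g) * ((χ s)⁻¹ : Circle) := by
  rw [toralIntegrand, matrixCoeff]
  congr 2
  have e : Units.map (ι.symm : Matrix (Fin 2) (Fin 2) ℚ_[p] →* Bp p u v) (toralGL σ ι s)
      = torusEmb σ s := by
    ext1
    exact ι.symm_apply_apply (torusEmb σ s).1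
  rw [matrixRep, MonoidHom.comp_apply, map_mul _ (g⁻¹ * _) g, map_mul _ g⁻¹, map_inv, e]
  set h := Units.map (ι.symm : Matrix (Fin 2) (Fin 2) ℚ_[p] →* Bp p u v) g
  rw [← hπ h f, ← Module.End.mul_apply, ← map_mul, mul_assoc h⁻¹, mul_inv_cancel_left]

/-- The character of `ℚ_p^× \ E_p^×` induced by `χ`. -/
def quotientCharacter (χ : (Ep p E)ˣ →* Circle) (hχ_triv : ∀ t ∈ scalars p E, χ t = 1) :
    ToralQuotient p E →* Circle := QuotientGroup.lift (scalars p E) χ hχ_triv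

theorem quotientCharacter_mk {χ : (Ep p E)ˣ →* Circle} (hχ_triv : ∀ t ∈ scalars p E, χ t = 1)
    (s : (Ep p E)ˣ) : quotientCharacter χ hχ_triv (QuotientGroup.mk s) = χ s := rfl

theorem continuous_quotientCharacter {χ : (Ep p E)ˣ →* Circle} (hχ : Continuous χ)
    (hχ_triv : ∀ t ∈ scalars p E, χ t = 1) : Continuous (quotientCharacter χ hχ_triv) :=
  hχ.quotient_lift _

theorem toralIntegrandQuot_eq (hu : u < 0) (hv : v < 0) (hB : IsQuadraticBasis a b B)
    (σ : E →ₐ[ℚ] ℍ[ℚ,u,v]) (ι : Bp p u v ≃ₐ[ℚ_[p]] Matrix (Fin 2) (Fin 2) ℚ_[p])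
    {ξ : E} (hξ : ξ ≠ 0) (hξ_tr : Algebra.trace ℚ E ξ = 0)
    (hι : ι ((1 : ℚ_[p]) ⊗ₜ[ℚ] σ ξ) = xiMatrix p ξ)
    {χ : (Ep p E)ˣ →* Circle} (hχ_triv : ∀ t ∈ scalars p E, χ t = 1)
    {α : ℂ} {π : Representation ℂ (Bp p u v)ˣ V}
    (hπ : ∀ h x y, inner ℂ (π h x) (π h y) = inner ℂ x y)
    (hπ_ps : Nonempty (Representation.Equiv π ((principalSeriesRep p α).comp
      (Units.map (ι : Bp p u v →* Matrix (Fin 2) (Fin 2) ℚ_[p])))))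
    {f : V} (hf_sph : ∀ k : GL (Fin 2) ℤ_[p],
      π (Units.map (ι.symm : Matrix (Fin 2) (Fin 2) ℚ_[p] →* Bp p u v)
        (Matrix.GeneralLinearGroup.map (algebraMap ℤ_[p] ℚ_[p]) k)) f = f) :
    toralIntegrandQuot σ π f χ (basePoint ι ξ χ) = fun q =>
      matrixCoeff (matrixRep ι π) f (diagPow p (quotientPosition p hB (conductorExp χ) q))
        * ((quotientCharacter χ hχ_triv q)⁻¹ : Circle) := by
  obtain ⟨T⟩ := matrixRep_equiv hπ_ps
  have hΨ : IsSpherical (matrixCoeff (matrixRep ι π) f) :=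
    isSpherical_matrixCoeff (fun h x y => hπ _ x y) T hf_sph
  funext q
  rw [toralIntegrandQuot, basePoint, toralIntegrand_eq ι hπ,
    hΨ.apply_conj_toralGL hu hv hB σ ι hξ hξ_tr hι, quotientPosition]
  congr 3
  conv_rhs => rw [← QuotientGroup.out_eq' q]
  rfl

end MatrixRepresentation

section Cosets

/-! ### The cosets of the image of `𝒪_{E_p}^×` -/

variable {p : ℕ} [Fact p.Prime] {E : Type*} [Field E] [NumberField E]
  {a b : ℤ} {B : Module.Basis (Fin 2) ℤ (𝓞 E)}

theorem isCosetSystem_of_no_root (hB : IsQuadraticBasis a b B) (h : ∀ r, ¬ IsRootMod p a b r) :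
    IsCosetSystem (unitFiltration p hB 0) (fun _ : Unit => (QuotientGroup.mk 1 : ToralQuotient p E)) where
  exists_mem q := by
    obtain ⟨s, rfl⟩ := QuotientGroup.mk_surjective q
    refine ⟨(), ?_⟩
    rw [← QuotientGroup.mk_inv, ← QuotientGroup.mk_mul, mk_mem_unitFiltration,
      orderStab_zero_eq_top h]
    trivial
  eq_of_mem _ _ _ := rfl

theorem IsLocalPrime.not_mem_orderStab {r : ℤ} {s : (LocalAlg p a b)ˣ} (hs : IsLocalPrime r s) :
    s ∉ orderStab p a b 0 := by
  rw [← relativePosition_eq_zero_iff, hs.relativePosition_eq_one]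
  exact one_ne_zero

/-- With a double root the prime equals its conjugate, so s plays both roles in
`IsLocalPrime.mul_mem`. -/
theorem IsLocalPrime.sq_mem_orderStab {r : ℤ} (hr : IsRootMod p a b r) (h : (p : ℤ) ∣ b - r - r)
    {s : (LocalAlg p a b)ˣ} (hs : IsLocalPrime r s) : s * s ∈ orderStab p a b 0 := by
  refine hs.mul_mem hr ⟨hs.mem.congr ?_, hs.norm_eq⟩
  have := h.neg_right
  rwa [neg_sub] at this

theorem isCosetSystem_of_double_root (hB : IsQuadraticBasis a b B) {r : ℤ}
    (hr : IsRootMod p a b r) (h : (p : ℤ) ∣ b - r - r) {t : (Ep p E)ˣ}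
    (ht : IsLocalPrime r (localUnits p hB t)) :
    IsCosetSystem (unitFiltration p hB 0)
      (fun i : Bool => (QuotientGroup.mk (bif i then t else 1) : ToralQuotient p E)) where
  exists_mem q := by
    obtain ⟨s, rfl⟩ := QuotientGroup.mk_surjective q
    simp only [← QuotientGroup.mk_inv, ← QuotientGroup.mk_mul, mk_mem_unitFiltration]
    obtain ⟨n, hn⟩ := ht.exists_zpow hr (localUnits p hB s)
    have hsq := ht.sq_mem_orderStab hr h
    obtain ⟨k, hk⟩ := Int.even_or_odd' n
    have h2 : (localUnits p hB t ^ (2 * k)) ∈ orderStab p a b 0 := by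
      rw [zpow_mul, zpow_ofNat, sq]
      exact zpow_mem hsq k
    rcases hk with rfl | rfl
    · refine ⟨false, ?_⟩
      simpa using mul_mem h2 hn
    · refine ⟨true, ?_⟩
      have := mul_mem h2 hn
      rw [zpow_add, zpow_one, mul_inv, mul_assoc, mul_inv_cancel_left] at this
      simpa using this
  eq_of_mem m n hmn := by
    rw [← QuotientGroup.mk_inv, ← QuotientGroup.mk_mul, mk_mem_unitFiltration] at hmn
    have h1 := ht.not_mem_orderStab
    cases m <;> cases n <;> simp_all

/-- Powers of t exhaust the quotient, and they are distinct modulo units because t^n has relative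
position |n|. -/
theorem isCosetSystem_of_two_roots (hB : IsQuadraticBasis a b B) {r : ℤ}
    (hr : IsRootMod p a b r) {t : (Ep p E)ˣ} (ht : IsLocalPrime r (localUnits p hB t))
    (ht' : ¬ MemPrime (b - r) (localUnits p hB t : LocalAlg p a b)) :
    IsCosetSystem (unitFiltration p hB 0)
      (fun n : ℤ => (QuotientGroup.mk (t ^ n) : ToralQuotient p E)) where
  exists_mem q := by
    obtain ⟨s, rfl⟩ := QuotientGroup.mk_surjective q
    obtain ⟨n, hn⟩ := ht.exists_zpow hr (localUnits p hB s)
    refine ⟨n, ?_⟩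
    rw [← QuotientGroup.mk_inv, ← QuotientGroup.mk_mul, mk_mem_unitFiltration, map_mul, map_inv,
      map_zpow]
    exact hn
  eq_of_mem m n hmn := by
    rw [← QuotientGroup.mk_inv, ← QuotientGroup.mk_mul, mk_mem_unitFiltration, ← zpow_neg,
      ← zpow_add, map_zpow, ← relativePosition_eq_zero_iff, ht.relativePosition_zpow hr ht',
      Int.natAbs_eq_zero] at hmn
    omega

theorem quotientPosition_zpow (hB : IsQuadraticBasis a b B) {r : ℤ}
    (hr : IsRootMod p a b r) {t : (Ep p E)ˣ} (ht : IsLocalPrime r (localUnits p hB t))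
    (ht' : ¬ MemPrime (b - r) (localUnits p hB t : LocalAlg p a b)) (n : ℤ) :
    quotientPosition p hB 0 (QuotientGroup.mk (t ^ n)) = n.natAbs := by
  rw [quotientPosition_mk, map_zpow, ht.relativePosition_zpow hr ht']

/-- Convergence is needed whatever the conductor; the relative positions are finite in number or run
through |n| for n in ℤ. -/
theorem exists_isCosetSystem (hB : IsQuadraticBasis a b B) {ϖ : Ideal (𝓞 E) → Eˣ}
    (hϖ : ∀ P ∈ primesAbove p E, IsPrimeElementAt p P (ϖ P)) :
    ∃ (ι : Type) (_ : Countable ι) (g : ι → ToralQuotient p E),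
      IsCosetSystem (unitFiltration p hB 0) g ∧
      ∀ r : ℝ, 0 ≤ r → r < 1 → Summable fun n => r ^ quotientPosition p hB 0 (g n) := by
  by_cases h : ∀ r, ¬ IsRootMod p a b r
  · exact ⟨Unit, inferInstance, _, isCosetSystem_of_no_root hB h, fun r _ _ => Summable.of_finite⟩
  push Not at h
  obtain ⟨r, hr⟩ := h
  obtain ⟨ht, ht'⟩ :=
    isLocalPrime_of_isPrimeElementAt hB hr (hϖ _ (rootPrime_mem_primesAbove hB hr))
  by_cases h : (p : ℤ) ∣ b - r - r
  · exact ⟨Bool, inferInstance, _, isCosetSystem_of_double_root hB hr h ht,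
      fun r _ _ => Summable.of_finite⟩
  · refine ⟨ℤ, inferInstance, _, isCosetSystem_of_two_roots hB hr ht (ht' h), fun x hx hx1 => ?_⟩
    simp only [quotientPosition_zpow hB hr ht (ht' h)]
    apply Summable.of_nat_of_neg
    · simpa using summable_geometric_of_lt_one hx hx1
    · simpa using summable_geometric_of_lt_one hx hx1

end Cosets

section Factors

/-! ### Values of the local factors -/

variable {p : ℕ} [Fact p.Prime] {E : Type*} [Field E] [NumberField E]
  {a b : ℤ} {B : Module.Basis (Fin 2) ℤ (𝓞 E)} {α : ℂ}

theorem etaFactor_one : etaFactor p E 1 = (1 - (splittingSign p E : ℂ) * (p : ℂ)⁻¹)⁻¹ := by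
  rw [etaFactor, Complex.cpow_neg_one]

theorem zetaFactor_two : zetaFactor p 2 = (1 - ((p : ℂ)⁻¹) ^ 2)⁻¹ := by
  rw [zetaFactor, Complex.cpow_neg, Complex.cpow_ofNat, inv_pow]

theorem adjointFactor_one : adjointFactor p α 1
    = (1 - (p : ℂ)⁻¹)⁻¹ * (1 - satake p α ^ 2)⁻¹ * (1 - satake p α⁻¹ ^ 2)⁻¹ := by
  rw [adjointFactor, Complex.cpow_neg_one, satake_sq, satake_sq]

theorem cpow_neg_half : (p : ℂ) ^ (-(1 / 2) : ℂ) = (Real.sqrt p : ℂ)⁻¹ := by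
  rw [Complex.cpow_neg, Real.sqrt_eq_rpow, Complex.ofReal_cpow (Nat.cast_nonneg p)]
  push_cast
  rfl

theorem baseChangeTerm_one {f : ℕ} (hf : f = 1) (z : ℂ) :
    1 - α ^ f * z * (p : ℂ) ^ (-((f : ℂ) * (1 / 2))) = 1 - satake p α * z := by
  rw [hf, Nat.cast_one, one_mul, cpow_neg_half, satake, pow_one]
  ring

theorem baseChangeTerm_two {f : ℕ} (hf : f = 2) :
    1 - α ^ f * 1 * (p : ℂ) ^ (-((f : ℂ) * (1 / 2))) = 1 - satake p α ^ 2 := by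
  rw [hf, satake_sq, show ((2 : ℕ) : ℂ) * (1 / 2) = 1 by norm_num, Complex.cpow_neg_one, mul_one]

theorem baseChangeFactor_of_no_root (hB : IsQuadraticBasis a b B)
    (h : ∀ r, ¬ IsRootMod p a b r) (ϖ : Ideal (𝓞 E) → Eˣ) {χ : (Ep p E)ˣ →* Circle}
    (hχ : conductorExp χ = 0) (hχ1 : ∀ s, χ s = 1) :
    baseChangeFactor ϖ χ α (1 / 2) = (1 - satake p α ^ 2)⁻¹ * (1 - satake p α⁻¹ ^ 2)⁻¹ := by
  rw [baseChangeFactor, if_pos hχ, primesAbove_of_no_root hB h, finprod_mem_singleton, hχ1,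
    inv_one, Circle.coe_one, baseChangeTerm_two (inertiaDeg_span_prime hB h),
    baseChangeTerm_two (inertiaDeg_span_prime hB h)]

theorem baseChangeFactor_of_double_root (hB : IsQuadraticBasis a b B) {r : ℤ}
    (hr : IsRootMod p a b r) (h : (p : ℤ) ∣ b - r - r) (ϖ : Ideal (𝓞 E) → Eˣ)
    {χ : (Ep p E)ˣ →* Circle} (hχ : conductorExp χ = 0) :
    baseChangeFactor ϖ χ α (1 / 2)
      = (1 - satake p α * ((χ (unitsToEp p (ϖ (rootPrime hB hr))))⁻¹ : Circle))⁻¹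
        * (1 - satake p α⁻¹ * ((χ (unitsToEp p (ϖ (rootPrime hB hr))))⁻¹ : Circle))⁻¹ := by
  rw [baseChangeFactor, if_pos hχ, primesAbove_of_double_root hB hr h, finprod_mem_singleton,
    baseChangeTerm_one (inertiaDeg_rootPrime hB hr),
    baseChangeTerm_one (inertiaDeg_rootPrime hB hr)]

theorem baseChangeFactor_of_two_roots (hB : IsQuadraticBasis a b B) {r : ℤ}
    (hr : IsRootMod p a b r) (h : ¬ (p : ℤ) ∣ b - r - r) (ϖ : Ideal (𝓞 E) → Eˣ)
    {χ : (Ep p E)ˣ →* Circle} (hχ : conductorExp χ = 0) :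
    baseChangeFactor ϖ χ α (1 / 2)
      = ((1 - satake p α * ((χ (unitsToEp p (ϖ (rootPrime hB hr))))⁻¹ : Circle))⁻¹
        * (1 - satake p α⁻¹ * ((χ (unitsToEp p (ϖ (rootPrime hB hr))))⁻¹ : Circle))⁻¹)
        * ((1 - satake p α * ((χ (unitsToEp p (ϖ (rootPrime hB hr.conj))))⁻¹ : Circle))⁻¹
        * (1 - satake p α⁻¹ * ((χ (unitsToEp p (ϖ (rootPrime hB hr.conj))))⁻¹ : Circle))⁻¹) := by
  rw [baseChangeFactor, if_pos hχ, primesAbove_of_two_roots hB hr,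
    finprod_mem_pair (rootPrime_conj_ne hB hr h).symm,
    baseChangeTerm_one (inertiaDeg_rootPrime hB hr),
    baseChangeTerm_one (inertiaDeg_rootPrime hB hr),
    baseChangeTerm_one (inertiaDeg_rootPrime hB hr.conj),
    baseChangeTerm_one (inertiaDeg_rootPrime hB hr.conj)]

/-- The index of U_1 in U_0 is p - e_p = p(1 - e_p/p), which produces L_p(η_p, 1). -/
theorem measureReal_eq_etaFactor (hB : IsQuadraticBasis a b B)
    {ν : Measure (ToralQuotient p E)} [ν.IsMulLeftInvariant]
    (hν : ν (unitFiltration p hB 0 : Set (ToralQuotient p E)) = 1) (i : ℕ) :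
    (ν.real (unitFiltration p hB (i + 1) : Set (ToralQuotient p E)) : ℂ)
      = (p : ℂ) ^ (-((i + 1 : ℕ) : ℤ)) * etaFactor p E 1 := by
  have hp := prime_complex_ne_zero (p := p)
  have key : (((cosetIndex p a b 0).card : ℂ) + 1)
      = p * (1 - (splittingSign p E : ℂ) * (p : ℂ)⁻¹) := by
    have h2 := (Fact.out : p.Prime).two_le
    by_cases h : ∀ r, ¬ IsRootMod p a b r
    · rw [card_cosetIndex_zero_of_no_root h, splittingSign_of_no_root hB h]
      push_cast
      field_simp
      ring
    push Not at h
    obtain ⟨r, hr⟩ := h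
    by_cases h : (p : ℤ) ∣ b - r - r
    · rw [card_cosetIndex_zero_of_double_root hr h, splittingSign_of_double_root hB hr h,
        Nat.cast_sub (by omega)]
      push_cast
      ring
    · rw [card_cosetIndex_zero_of_two_roots hr h, splittingSign_of_two_roots hB hr h,
        Nat.cast_sub (by omega)]
      push_cast
      field_simp
      ring
  rw [measureReal_unitFiltration_succ hB hν, etaFactor_one]
  push_cast
  rw [key, ← mul_assoc, ← pow_succ, mul_inv, zpow_neg]
  norm_cast

end Factors

section Identities

/-! ### Identities between rational functions of the Satake parameters -/

variable {K : Type*} [Field K] {x y z w : K}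

/-- In these identities x, y stand for β₁, β₂, so xy = p⁻¹; X₁ is X 1, and z, w are inverse values
of χ at prime elements. -/
theorem ramified_identity (h₂ : 1 - x * y ≠ 0) (h₃ : 1 - x ^ 2 ≠ 0)
    (h₄ : 1 - y ^ 2 ≠ 0) {X₁ : K} (hX : (1 + x * y) * X₁ = x + y) :
    (1 - x * y)⁻¹ * (1 - x ^ 2)⁻¹ * (1 - y ^ 2)⁻¹ / (1 - (x * y) ^ 2)⁻¹
      * (1 - ((x + y) * X₁ - x * y)) = 1 := by
  rw [div_inv_eq_mul, show 1 - (x * y) ^ 2 = (1 - x * y) * (1 + x * y) by ring]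
  field_simp
  linear_combination -(x + y) * hX

theorem inert_identity (h₁ : 1 + x * y ≠ 0) (h₂ : 1 - x * y ≠ 0) (h₃ : 1 - x ^ 2 ≠ 0)
    (h₄ : 1 - y ^ 2 ≠ 0) :
    (1 + x * y)⁻¹ * ((1 - x * y)⁻¹ * (1 - x ^ 2)⁻¹ * (1 - y ^ 2)⁻¹)
      / ((1 - (x * y) ^ 2)⁻¹ * ((1 - x ^ 2)⁻¹ * (1 - y ^ 2)⁻¹)) = 1 := by
  rw [show 1 - (x * y) ^ 2 = (1 - x * y) * (1 + x * y) by ring]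
  field_simp

theorem double_root_identity (h₂ : 1 - x * y ≠ 0) (h₃ : 1 - x ^ 2 ≠ 0)
    (h₄ : 1 - y ^ 2 ≠ 0) (hz : z * z = 1) {X₁ : K}
    (hX : (1 + x * y) * X₁ = x + y) :
    (1 - x * y)⁻¹ * (1 - x ^ 2)⁻¹ * (1 - y ^ 2)⁻¹
      / ((1 - (x * y) ^ 2)⁻¹ * ((1 - x * z)⁻¹ * (1 - y * z)⁻¹)) * (X₁ * z + 1) = 1 := by
  have key : (1 - x * z) * (1 - y * z) * ((x + y) * z + (1 + x * y))
      = (1 - x ^ 2) * (1 - y ^ 2) := by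
    linear_combination (x * y * (x + y) * z - (x + y) ^ 2 + x * y * (1 + x * y)) * hz
  rw [show 1 - (x * y) ^ 2 = (1 - x * y) * (1 + x * y) by ring]
  field_simp
  linear_combination key + (1 - x * z) * (1 - y * z) * z * hX

/-- The two series over n ≥ 0, in z and in w = z⁻¹, both contain the term n = 0, hence the
subtraction of 1. -/
theorem two_sided_identity (hzw : z * w = 1) (h₁ : 1 + x * y ≠ 0) (h₂ : 1 - x * z ≠ 0)
    (h₃ : 1 - y * z ≠ 0) (h₄ : 1 - x * w ≠ 0) (h₅ : 1 - y * w ≠ 0) :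
    (1 + x * y - (x + y) * (x * y) * z) / ((1 + x * y) * ((1 - x * z) * (1 - y * z)))
      + (1 + x * y - (x + y) * (x * y) * w) / ((1 + x * y) * ((1 - x * w) * (1 - y * w))) - 1
      = (1 - x ^ 2) * (1 - y ^ 2) * (1 - x * y)
        / ((1 + x * y) * ((1 - x * z) * (1 - y * z) * ((1 - x * w) * (1 - y * w)))) := by
  have key : (1 + x * y - (x + y) * (x * y) * z) * ((1 - x * w) * (1 - y * w))
      + (1 + x * y - (x + y) * (x * y) * w) * ((1 - x * z) * (1 - y * z))
      - (1 + x * y) * ((1 - x * z) * (1 - y * z) * ((1 - x * w) * (1 - y * w)))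
      = (1 - x ^ 2) * (1 - y ^ 2) * (1 - x * y) := by
    obtain rfl : w = z⁻¹ := (eq_inv_of_mul_eq_one_right hzw)
    have hz : z ≠ 0 := left_ne_zero_of_mul_eq_one hzw
    field_simp
    ring
  rw [← key]
  field_simp

theorem split_identity (h₁ : 1 + x * y ≠ 0) (h₂ : 1 - x * y ≠ 0) (h₃ : 1 - x ^ 2 ≠ 0)
    (h₄ : 1 - y ^ 2 ≠ 0) (h₅ : 1 - x * z ≠ 0) (h₆ : 1 - y * z ≠ 0) (h₇ : 1 - x * w ≠ 0)
    (h₈ : 1 - y * w ≠ 0) :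
    (1 - x * y)⁻¹ * ((1 - x * y)⁻¹ * (1 - x ^ 2)⁻¹ * (1 - y ^ 2)⁻¹)
      / ((1 - (x * y) ^ 2)⁻¹ * ((1 - x * z)⁻¹ * (1 - y * z)⁻¹ * ((1 - x * w)⁻¹ * (1 - y * w)⁻¹)))
      * ((1 - x ^ 2) * (1 - y ^ 2) * (1 - x * y)
        / ((1 + x * y) * ((1 - x * z) * (1 - y * z) * ((1 - x * w) * (1 - y * w))))) = 1 := by
  rw [show 1 - (x * y) ^ 2 = (1 - x * y) * (1 + x * y) by ring]
  field_simp

end Identities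

section Evaluation

/-! ### Evaluation of the integral -/

variable {p : ℕ} [Fact p.Prime] {E : Type*} [Field E] [NumberField E]
  {a b : ℤ} {B : Module.Basis (Fin 2) ℤ (𝓞 E)} {α : ℂ} {X : ℕ → ℂ}

theorem quotientCharacter_eq_one (hB : IsQuadraticBasis a b B) {χ : (Ep p E)ˣ →* Circle}
    (hχ : Continuous χ) (hχ_triv : ∀ t ∈ scalars p E, χ t = 1) {q : ToralQuotient p E}
    (hq : q ∈ unitFiltration p hB (conductorExp χ)) : quotientCharacter χ hχ_triv q = 1 := by
  rw [← SetLike.mem_coe, ← image_orderUnits] at hq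
  obtain ⟨s, hs, rfl⟩ := hq
  exact trivial_on_conductorExp hB hχ hχ_triv s hs

theorem exists_quotientCharacter_ne_one (hB : IsQuadraticBasis a b B) {χ : (Ep p E)ˣ →* Circle}
    (hχ_triv : ∀ t ∈ scalars p E, χ t = 1) {i : ℕ} (hi : i < conductorExp χ) :
    ∃ q ∈ unitFiltration p hB i, quotientCharacter χ hχ_triv q ≠ 1 := by
  obtain ⟨s, hs, h⟩ := exists_of_lt_conductorExp hi
  refine ⟨QuotientGroup.mk s, ?_, h⟩
  rw [← SetLike.mem_coe, ← image_orderUnits]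
  exact ⟨s, hs, rfl⟩

theorem character_eq_one_of_mem (hB : IsQuadraticBasis a b B) {χ : (Ep p E)ˣ →* Circle}
    (hχ : Continuous χ) (hχ_triv : ∀ t ∈ scalars p E, χ t = 1) (h0 : conductorExp χ = 0)
    {s : (Ep p E)ˣ} (hs : localUnits p hB s ∈ orderStab p a b 0) : χ s = 1 := by
  rw [← mk_mem_unitFiltration, ← h0] at hs
  exact quotientCharacter_eq_one hB hχ hχ_triv hs

/-- The normalizing factor in front of the toral integral. -/
theorem normalizing_mul_eq_one (hX : IsSphericalSequence p α X) (hα : α ≠ 0) (hα₁ : α ^ 2 ≠ p)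
    (hα₂ : α ^ 2 ≠ (p : ℂ)⁻¹) :
    adjointFactor p α 1 / zetaFactor p 2 * (1 - X 2) = 1 := by
  have h1 := hX.apply_one
  have h2 := hX.apply_add_two hα 0
  have hc := satake_mul_satake_inv (p := p) hα
  have n1 := one_add_prime_inv_ne_zero (p := p)
  have n2 := one_sub_prime_inv_ne_zero (p := p)
  obtain ⟨n3, n4⟩ := hX.one_sub_satake_sq_ne_zero hα hα₁ hα₂
  rw [hX.zero, zero_add, mul_one] at h2
  rw [adjointFactor_one, zetaFactor_two, h2]
  rw [← hc] at h1 n1 n2 ⊢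
  exact ramified_identity n2 n3 n4 h1

variable {χ : (Ep p E)ˣ →* Circle} {ν : Measure (ToralQuotient p E)} [ν.IsMulLeftInvariant]

theorem integrable_sphericalSequence (hX : IsSphericalSequence p α X) (hα : α ≠ 0)
    (hα₁ : α ^ 2 ≠ p) (hα₂ : α ^ 2 ≠ (p : ℂ)⁻¹) (hB : IsQuadraticBasis a b B) (hχ : Continuous χ)
    (hχ_triv : ∀ t ∈ scalars p E, χ t = 1) {ϖ : Ideal (𝓞 E) → Eˣ}
    (hϖ : ∀ P ∈ primesAbove p E, IsPrimeElementAt p P (ϖ P))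
    (hν : ν (unitFiltration p hB 0 : Set (ToralQuotient p E)) = 1) (i : ℕ) :
    Integrable (fun q => X (quotientPosition p hB i q)
      * ((quotientCharacter χ hχ_triv q)⁻¹ : Circle)) ν := by
  obtain ⟨ι, _, g, hg, hs⟩ := exists_isCosetSystem hB hϖ
  obtain ⟨C, r, hC, hr, hr1, hXr⟩ := hX.exists_bound hα hα₁ hα₂
  exact (isFiltration_unitFiltration hB).integrable hg hν
    (continuous_quotientCharacter hχ hχ_triv) hC hr hr1 hXr (hs r hr hr1) i

theorem localFactor_of_ramified (hX : IsSphericalSequence p α X) (hα : α ≠ 0)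
    (hα₁ : α ^ 2 ≠ p) (hα₂ : α ^ 2 ≠ (p : ℂ)⁻¹) (hB : IsQuadraticBasis a b B) (hχ : Continuous χ)
    (hχ_triv : ∀ t ∈ scalars p E, χ t = 1) {ϖ : Ideal (𝓞 E) → Eˣ}
    (hϖ : ∀ P ∈ primesAbove p E, IsPrimeElementAt p P (ϖ P))
    (hν : ν (unitFiltration p hB 0 : Set (ToralQuotient p E)) = 1) (h0 : conductorExp χ ≠ 0) :
    etaFactor p E 1 * adjointFactor p α 1 / (zetaFactor p 2 * baseChangeFactor ϖ χ α (1 / 2))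
      * ∫ q, X (quotientPosition p hB (conductorExp χ) q)
        * ((quotientCharacter χ hχ_triv q)⁻¹ : Circle) ∂ν
      = (p : ℂ) ^ (-(conductorExp χ : ℤ)) * etaFactor p E 1 ^ 2 := by
  obtain ⟨ι, _, g, hg, hs⟩ := exists_isCosetSystem hB hϖ
  obtain ⟨C, r, hC, hr, hr1, hXr⟩ := hX.exists_bound hα hα₁ hα₂
  obtain ⟨i, hi⟩ := Nat.exists_eq_succ_of_ne_zero h0
  obtain ⟨u, hu, hχu⟩ := exists_quotientCharacter_ne_one hB hχ_triv (i := i) (by omega)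
  have htriv : ∀ q ∈ unitFiltration p hB (i + 1), quotientCharacter χ hχ_triv q = 1 :=
    fun q hq => quotientCharacter_eq_one hB hχ hχ_triv (by rw [hi]; exact hq)
  have hint := (isFiltration_unitFiltration hB).integral_of_ramified hg hν
    (continuous_quotientCharacter hχ hχ_triv) hC hr hr1 hXr hX.zero (hs r hr hr1) i htriv hu hχu
  have hnorm := normalizing_mul_eq_one hX hα hα₁ hα₂
  rw [baseChangeFactor, if_neg h0, mul_one, hi, hint, measureReal_eq_etaFactor hB hν]
  linear_combination (etaFactor p E 1 ^ 2 * (p : ℂ) ^ (-((i + 1 : ℕ) : ℤ))) * hnorm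

/-- For inert p the quotient is the single coset U_0, so χ is trivial and the integral equals 1. -/
theorem localFactor_of_no_root (hX : IsSphericalSequence p α X) (hα : α ≠ 0)
    (hα₁ : α ^ 2 ≠ p) (hα₂ : α ^ 2 ≠ (p : ℂ)⁻¹) (hB : IsQuadraticBasis a b B) (hχ : Continuous χ)
    (hχ_triv : ∀ t ∈ scalars p E, χ t = 1) {ϖ : Ideal (𝓞 E) → Eˣ}
    (hν : ν (unitFiltration p hB 0 : Set (ToralQuotient p E)) = 1) (h0 : conductorExp χ = 0)
    (h : ∀ r, ¬ IsRootMod p a b r) :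
    etaFactor p E 1 * adjointFactor p α 1 / (zetaFactor p 2 * baseChangeFactor ϖ χ α (1 / 2))
      * ∫ q, X (quotientPosition p hB 0 q) * ((quotientCharacter χ hχ_triv q)⁻¹ : Circle) ∂ν
      = 1 := by
  obtain ⟨C, r, hC, hr, hr1, hXr⟩ := hX.exists_bound hα hα₁ hα₂
  have hχ1 : ∀ s, χ s = 1 := fun s =>
    character_eq_one_of_mem hB hχ hχ_triv h0 (by rw [orderStab_zero_eq_top h]; trivial)
  have hint := (isFiltration_unitFiltration hB).integral_of_unramified
    (isCosetSystem_of_no_root hB h) hν (continuous_quotientCharacter hχ hχ_triv) hC hr hr1 hXr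
    Summable.of_finite fun q hq => quotientCharacter_eq_one hB hχ hχ_triv (by rwa [h0])
  have hval := hint.unique (hasSum_fintype _)
  rw [Fintype.sum_unique, quotientPosition_mk, map_one,
    relativePosition_eq_zero_iff.2 (one_mem _), hX.zero, quotientCharacter_mk, map_one, inv_one,
    Circle.coe_one, mul_one] at hval
  have n1 := one_add_prime_inv_ne_zero (p := p)
  have n2 := one_sub_prime_inv_ne_zero (p := p)
  obtain ⟨n3, n4⟩ := hX.one_sub_satake_sq_ne_zero hα hα₁ hα₂
  rw [hval, baseChangeFactor_of_no_root hB h ϖ h0 hχ1, etaFactor_one,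
    splittingSign_of_no_root hB h, adjointFactor_one, zetaFactor_two]
  push_cast
  rw [neg_one_mul, sub_neg_eq_add, mul_one]
  rw [← satake_mul_satake_inv hα] at n1 n2 ⊢
  exact inert_identity n1 n2 n3 n4

/-- For ramified p the integral is 1 + X 1 · χ(t)⁻¹, and χ(t)² = 1 because t² is a unit times a
scalar. -/
theorem localFactor_of_double_root (hX : IsSphericalSequence p α X) (hα : α ≠ 0)
    (hα₁ : α ^ 2 ≠ p) (hα₂ : α ^ 2 ≠ (p : ℂ)⁻¹) (hB : IsQuadraticBasis a b B) (hχ : Continuous χ)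
    (hχ_triv : ∀ t ∈ scalars p E, χ t = 1) {ϖ : Ideal (𝓞 E) → Eˣ}
    (hϖ : ∀ P ∈ primesAbove p E, IsPrimeElementAt p P (ϖ P))
    (hν : ν (unitFiltration p hB 0 : Set (ToralQuotient p E)) = 1) (h0 : conductorExp χ = 0)
    {r : ℤ} (hr : IsRootMod p a b r) (h : (p : ℤ) ∣ b - r - r) :
    etaFactor p E 1 * adjointFactor p α 1 / (zetaFactor p 2 * baseChangeFactor ϖ χ α (1 / 2))
      * ∫ q, X (quotientPosition p hB 0 q) * ((quotientCharacter χ hχ_triv q)⁻¹ : Circle) ∂ν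
      = 1 := by
  obtain ⟨ht, -⟩ :=
    isLocalPrime_of_isPrimeElementAt hB hr (hϖ _ (rootPrime_mem_primesAbove hB hr))
  have hfac := baseChangeFactor_of_double_root (α := α) hB hr h ϖ h0
  set t := unitsToEp p (ϖ (rootPrime hB hr))
  obtain ⟨C, x, hC, hx, hx1, hXr⟩ := hX.exists_bound hα hα₁ hα₂
  have hint := (isFiltration_unitFiltration hB).integral_of_unramified
    (isCosetSystem_of_double_root hB hr h ht) hν (continuous_quotientCharacter hχ hχ_triv)
    hC hx hx1 hXr Summable.of_finite
    fun q hq => quotientCharacter_eq_one hB hχ hχ_triv (by rwa [h0])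
  have hval := hint.unique (hasSum_fintype _)
  rw [Fintype.sum_bool, cond_true, cond_false, quotientPosition_mk, quotientPosition_mk, map_one,
    relativePosition_eq_zero_iff.2 (one_mem _), ht.relativePosition_eq_one, hX.zero,
    quotientCharacter_mk, quotientCharacter_mk, map_one, inv_one, Circle.coe_one, mul_one] at hval
  have hsq : ((χ t)⁻¹ : Circle) * ((χ t)⁻¹ : Circle) = 1 := by
    rw [← mul_inv, inv_eq_one, ← map_mul]
    refine character_eq_one_of_mem hB hχ hχ_triv h0 ?_
    rw [map_mul]
    exact ht.sq_mem_orderStab hr h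
  have hsq' := congrArg (Subtype.val : Circle → ℂ) hsq
  rw [Circle.coe_mul, Circle.coe_one] at hsq'
  obtain ⟨n6, n7⟩ := hX.one_sub_satake_mul_ne_zero hα hα₁ hα₂ (z := (((χ t)⁻¹ : Circle) : ℂ))
    (Circle.norm_coe _).le
  rw [hval, hfac, etaFactor_one, splittingSign_of_double_root hB hr h, adjointFactor_one,
    zetaFactor_two]
  have h1 := hX.apply_one
  have n1 := one_add_prime_inv_ne_zero (p := p)
  have n2 := one_sub_prime_inv_ne_zero (p := p)
  obtain ⟨n3, n4⟩ := hX.one_sub_satake_sq_ne_zero hα hα₁ hα₂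
  push_cast
  rw [zero_mul, sub_zero, inv_one, one_mul]
  rw [← satake_mul_satake_inv hα] at h1 n1 n2 ⊢
  exact double_root_identity n2 n3 n4 hsq' h1

theorem IsSphericalSequence.hasSum_int_natAbs (hX : IsSphericalSequence p α X) (hα : α ≠ 0)
    (hα₁ : α ^ 2 ≠ p) (hα₂ : α ^ 2 ≠ (p : ℂ)⁻¹) (z : Circle) :
    HasSum (fun n : ℤ => X n.natAbs * ((z ^ n : Circle) : ℂ))
      ((1 - satake p α ^ 2) * (1 - satake p α⁻¹ ^ 2) * (1 - (p : ℂ)⁻¹) / ((1 + (p : ℂ)⁻¹)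
        * ((1 - satake p α * z) * (1 - satake p α⁻¹ * z)
          * ((1 - satake p α * (z⁻¹ : Circle)) * (1 - satake p α⁻¹ * (z⁻¹ : Circle)))))) := by
  have hz := Circle.norm_coe z
  have hz' := Circle.norm_coe z⁻¹
  have h1 := hX.hasSum_mul_pow hα hα₁ hα₂ hz
  have h2 := hX.hasSum_mul_pow hα hα₁ hα₂ hz'
  have h := HasSum.of_nat_of_neg (f := fun n : ℤ => X n.natAbs * ((z ^ n : Circle) : ℂ))
    (by simpa using h1) (by simpa using h2)
  obtain ⟨n1, n2⟩ := hX.one_sub_satake_mul_ne_zero hα hα₁ hα₂ hz.le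
  obtain ⟨n3, n4⟩ := hX.one_sub_satake_mul_ne_zero hα hα₁ hα₂ hz'.le
  have n5 := one_add_prime_inv_ne_zero (p := p)
  have hzz : (z : ℂ) * ((z⁻¹ : Circle) : ℂ) = 1 := by
    rw [← Circle.coe_mul, mul_inv_cancel, Circle.coe_one]
  rw [← satake_mul_satake_inv hα] at n5
  have e := two_sided_identity hzz n5 n1 n2 n3 n4
  rw [satake_mul_satake_inv hα] at e
  have hf : X (0 : ℤ).natAbs * ((z ^ (0 : ℤ) : Circle) : ℂ) = 1 := by
    rw [Int.natAbs_zero, hX.zero, zpow_zero, Circle.coe_one, mul_one]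
  rw [hf] at h
  rw [← e, Circle.coe_inv]
  exact h

theorem localFactor_of_two_roots (hX : IsSphericalSequence p α X) (hα : α ≠ 0)
    (hα₁ : α ^ 2 ≠ p) (hα₂ : α ^ 2 ≠ (p : ℂ)⁻¹) (hB : IsQuadraticBasis a b B) (hχ : Continuous χ)
    (hχ_triv : ∀ t ∈ scalars p E, χ t = 1) {ϖ : Ideal (𝓞 E) → Eˣ}
    (hϖ : ∀ P ∈ primesAbove p E, IsPrimeElementAt p P (ϖ P))
    (hν : ν (unitFiltration p hB 0 : Set (ToralQuotient p E)) = 1) (h0 : conductorExp χ = 0)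
    {r : ℤ} (hr : IsRootMod p a b r) (h : ¬ (p : ℤ) ∣ b - r - r) :
    etaFactor p E 1 * adjointFactor p α 1 / (zetaFactor p 2 * baseChangeFactor ϖ χ α (1 / 2))
      * ∫ q, X (quotientPosition p hB 0 q) * ((quotientCharacter χ hχ_triv q)⁻¹ : Circle) ∂ν
      = 1 := by
  obtain ⟨ht, ht'⟩ :=
    isLocalPrime_of_isPrimeElementAt hB hr (hϖ _ (rootPrime_mem_primesAbove hB hr))
  obtain ⟨ht₂, -⟩ :=
    isLocalPrime_of_isPrimeElementAt hB hr.conj (hϖ _ (rootPrime_mem_primesAbove hB hr.conj))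
  have hfac := baseChangeFactor_of_two_roots (α := α) hB hr h ϖ h0
  set t := unitsToEp p (ϖ (rootPrime hB hr))
  set t₂ := unitsToEp p (ϖ (rootPrime hB hr.conj))
  obtain ⟨C, x, hC, hx, hx1, hXr⟩ := hX.exists_bound hα hα₁ hα₂
  have hs : Summable fun n : ℤ => x ^ quotientPosition p hB 0 (QuotientGroup.mk (t ^ n)) := by
    simp only [quotientPosition_zpow hB hr ht (ht' h)]
    apply Summable.of_nat_of_neg <;> simpa using summable_geometric_of_lt_one hx hx1
  have hint := (isFiltration_unitFiltration hB).integral_of_unramified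
    (isCosetSystem_of_two_roots hB hr ht (ht' h)) hν (continuous_quotientCharacter hχ hχ_triv)
    hC hx hx1 hXr hs
    fun q hq => quotientCharacter_eq_one hB hχ hχ_triv (by rwa [h0])
  simp only [quotientPosition_zpow hB hr ht (ht' h), quotientCharacter_mk, map_zpow, ← inv_zpow]
    at hint
  have hval := hint.unique (hX.hasSum_int_natAbs hα hα₁ hα₂ (χ t)⁻¹)
  -- The product of prime elements at the two primes above p is a scalar times a unit, so χ takes
  -- inverse values on them.
  have ht₂' : (χ t₂)⁻¹ = (χ t)⁻¹⁻¹ := by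
    rw [inv_inv, inv_eq_iff_mul_eq_one, mul_comm, ← map_mul]
    refine character_eq_one_of_mem hB hχ hχ_triv h0 ?_
    rw [map_mul]
    exact ht.mul_mem hr ht₂
  obtain ⟨n5, n6⟩ := hX.one_sub_satake_mul_ne_zero hα hα₁ hα₂ (Circle.norm_coe (χ t)⁻¹).le
  obtain ⟨n7, n8⟩ := hX.one_sub_satake_mul_ne_zero hα hα₁ hα₂ (Circle.norm_coe (χ t)⁻¹⁻¹).le
  have n1 := one_add_prime_inv_ne_zero (p := p)
  have n2 := one_sub_prime_inv_ne_zero (p := p)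
  obtain ⟨n3, n4⟩ := hX.one_sub_satake_sq_ne_zero hα hα₁ hα₂
  rw [hval, hfac, ht₂', etaFactor_one, splittingSign_of_two_roots hB hr h, adjointFactor_one,
    zetaFactor_two]
  rw [Int.cast_one, one_mul]
  rw [← satake_mul_satake_inv hα] at n1 n2 ⊢
  exact split_identity n1 n2 n3 n4 n5 n6 n7 n8

end Evaluation

end Toral

end

/-! ### The proposition -/

theorem proposition3p3 (p : ℕ) [Fact p.Prime]
    -- a definite quaternion algebra `B = ℍ[ℚ,u,v]`, and `E = ℚ(ξ) ⊂ B` with `ξ` pure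
    (u v : ℚ) (hu : u < 0) (hv : v < 0)
    (E : Type*) [Field E] [NumberField E] (hE : Module.finrank ℚ E = 2)
    (σ : E →ₐ[ℚ] ℍ[ℚ,u,v]) (ξ : E) (hξ : ξ ≠ 0) (hξ_tr : Algebra.trace ℚ E ξ = 0)
    -- the identification of `B_p` with `M_2(ℚ_p)`, which exists exactly if `p ∤ d_B`
    (ι : Toral.Bp p u v ≃ₐ[ℚ_[p]] Matrix (Fin 2) (Fin 2) ℚ_[p])
    (hι : ι ((1 : ℚ_[p]) ⊗ₜ[ℚ] σ ξ) = Toral.xiMatrix p ξ)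
    -- a unitary character of `ℚ_p^× \ E_p^×`
    (χ : (Toral.Ep p E)ˣ →* Circle) (hχ : Continuous χ)
    (hχ_triv : ∀ t ∈ Toral.scalars p E, χ t = 1)
    -- a unitary representation of `B_p^×` in the unramified principal series with Satake
    -- parameter `(α, α⁻¹)`; the conditions on `α` say that the principal series is irreducible
    (α : ℂ) (hα : α ≠ 0) (hα₁ : α ^ 2 ≠ p) (hα₂ : α ^ 2 ≠ (p : ℂ)⁻¹)
    (V : Type*) [NormedAddCommGroup V] [InnerProductSpace ℂ V]
    (π : Representation ℂ (Toral.Bp p u v)ˣ V)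
    (hπ_unitary : ∀ h x y, inner ℂ (π h x) (π h y) = inner ℂ x y)
    (hπ_ps : Nonempty (Representation.Equiv π ((Toral.principalSeriesRep p α).comp
      (Units.map (ι : Toral.Bp p u v →* Matrix (Fin 2) (Fin 2) ℚ_[p])))))
    -- a nonzero vector fixed by `GL_2(ℤ_p)`
    (f : V) (hf : f ≠ 0)
    (hf_sph : ∀ k : GL (Fin 2) ℤ_[p],
      π (Units.map (ι.symm : Matrix (Fin 2) (Fin 2) ℚ_[p] →* Toral.Bp p u v)
        (Matrix.GeneralLinearGroup.map (algebraMap ℤ_[p] ℚ_[p]) k)) f = f)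
    -- prime elements for the primes of `E` above `p`
    (ϖ : Ideal (𝓞 E) → Eˣ)
    (hϖ : ∀ P ∈ Toral.primesAbove p E, Toral.IsPrimeElementAt p P (ϖ P))
    -- the invariant measure on `ℚ_p^× \ E_p^×` giving volume one to the image of `𝒪_{E_p}^×`
    (ν : Measure (Toral.ToralQuotient p E)) [ν.IsHaarMeasure]
    (hν : ν ((QuotientGroup.mk : (Toral.Ep p E)ˣ → Toral.ToralQuotient p E) ''
      Toral.orderUnits p E 0) = 1) :
    Integrable (Toral.toralIntegrandQuot σ π f χ (Toral.basePoint ι ξ χ)) ν ∧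
    Toral.localFactor ϖ α ν σ π f χ (Toral.basePoint ι ξ χ) =
      if Toral.conductorExp χ = 0 then 1
      else (p : ℂ) ^ (-(Toral.conductorExp χ : ℤ)) * Toral.etaFactor p E 1 ^ 2 := by

  obtain ⟨a, b, B, hB⟩ := Toral.exists_isQuadraticBasis hE
  have hν₀ : ν (Toral.unitFiltration p hB 0 : Set (Toral.ToralQuotient p E)) = 1 := by
    rw [← Toral.image_orderUnits]
    exact hν
  obtain ⟨T⟩ := Toral.matrixRep_equiv hπ_ps
  have hX := Toral.isSphericalSequence_matrixCoeff (fun h x y => hπ_unitary _ x y) T hf_sph hα hf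
  have hint := Toral.toralIntegrandQuot_eq hu hv hB σ ι hξ hξ_tr hι hχ_triv hπ_unitary hπ_ps hf_sph
  refine ⟨?_, ?_⟩
  · rw [hint]
    exact Toral.integrable_sphericalSequence hX hα hα₁ hα₂ hB hχ hχ_triv hϖ hν₀ _
  rw [Toral.localFactor, hint]
  split_ifs with h0
  · rw [h0]
    -- No root, a double root or two roots of x² - bx - a modulo p: p is inert, ramified or split.
    by_cases h : ∀ r, ¬ Toral.IsRootMod p a b r
    · exact Toral.localFactor_of_no_root hX hα hα₁ hα₂ hB hχ hχ_triv hν₀ h0 h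
    push Not at h
    obtain ⟨r, hr⟩ := h
    by_cases h : (p : ℤ) ∣ b - r - r
    · exact Toral.localFactor_of_double_root hX hα hα₁ hα₂ hB hχ hχ_triv hϖ hν₀ h0 hr h
    · exact Toral.localFactor_of_two_roots hX hα hα₁ hα₂ hB hχ hχ_triv hϖ hν₀ h0 hr h
  · exact Toral.localFactor_of_ramified hX hα hα₁ hα₂ hB hχ hχ_triv hϖ hν₀ h0
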